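/- Consider the incompressible micropolar system on $\mathbb{R}^3$ with the normalization $\kappa=\mu=1$, $\chi=\nu=\tfrac12$: $$\partial_t u-\Delta u+u\cdot\nabla u+\nabla\pi-\nabla\times\omega=0,\qquad \partial_t\omega-\Delta\omega+u\cdot\nabla\omega+2\omega-\nabla\operatorname{div}\omega-\nabla\times u=0,\qquad \operatorname{div}u=0,$$ with $(u,\omega)|_{t=0}=f=(u_0,\omega_0)$, $\operatorname{div}u_0=0$, all fields being real-valued. A mild solution is a solution $U=(u,\omega)$ of $$U(t)=G(t)f-\int_0^tG(t-\tau)\begin{pmatrix}\mathbf P\nabla\cdot(u\otimes u)\\ \nabla\cdot(u\otimes\omega)\end{pmatrix}(\tau)\,d\tau ,$$ where $G(t)$ is the solution operator of the linear system $\partial_tu-\Delta u-\nabla\times\omega=0$, $\partial_t\omega-\Delta\omega+2\omega-\nabla\operatorname{div}\omega-\nabla\times u=0$, that is, $\widehat{G(t)f}(\xi)=e^{-t\mathcal A(\xi)}\hat f(\xi)$ with $\mathcal A(\xi)$ the $6\times 6$ symbol of this linear system, $\nabla\cdot(v\otimes w)=\sum_k\partial_k(v_kw)$, and $\mathbf P$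 is the Leray projection with symbol $\delta_{ij}-\xi_i\xi_j/|\xi|^2$. Let $\varphi,\psi$ be nonnegative Schwartz functions on $\mathbb{R}^3$ supported in $\{|\xi|\le\frac43\}$ and $\{\frac34\le|\xi|\le\frac83\}$, with $\sum_{j\in\mathbb{Z}}\psi(2^{-j}\xi)=1$ for $\xi\ne0$ and $\varphi(\xi)+\sum_{j\ge0}\psi(2^{-j}\xi)=1$ for all $\xi$. For $s\in\mathbb{R}$, $1\le p,r\le\infty$, the space $F\dot B^s_{p,r}$ consists of the tempered distributions $g$ (modulo polynomials) with $\hat g\in L^1_{loc}(\mathbb{R}^3)$ and $$\|g\|_{F\dot B^s_{p,r}}=\Big\|\big(2^{js}\|\psi(2^{-j}\cdot)\hat g\|_{L^p}\big)_{j\in\mathbb{Z}}\Big\|_{\ell^r}<\infty ,$$ and $\tilde L^q(0,\infty;F\dot B^s_{p,r})$ is given by the norm $\big\|\big(2^{js}\|\psi(2^{-j}\cdot)\hat g\|_{L^q(0,\infty;L^p)}\big)_{j}\big\|_{\ell^r}$. For $\alpha\in(0,1)$ set $$Y_\alpha=C([0,\infty);F\dot B^{-1}_{1,2})\cap\tilde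 L^{\frac2{1+\alpha}}(0,\infty;F\dot B^{\alpha}_{1,2})\cap\tilde L^{\frac2{1-\alpha}}(0,\infty;F\dot B^{-\alpha}_{1,2}).$$ **Theorem.** Let $r\in(2,\infty]$. The micropolar system is ill-posed in $F\dot B^{-1}_{1,r}(\mathbb{R}^3)$: the solution map is discontinuous at the origin. That is, for every $\alpha\in(0,1)$ and $T>0$, the map $f\mapsto U[f]$, sending real data $f\in F\dot B^{-1}_{1,2}$ with $\operatorname{div}u_0=0$ that admit a global mild solution in $Y_\alpha$ to that solution, is not continuous at $f=0$ from the norm of $F\dot B^{-1}_{1,r}$ to the norm of $L^\infty(0,T;F\dot B^{-1}_{1,r})$. More precisely, there exist real-valued initial data $f^N=(u^N_0,\omega^N_0)\in F\dot B^{-1}_{1,2}$ with $\operatorname{div}u_0^N=0$, times $t^N>0$, and a constant $c_0>0$ independent of $N$, such that $$\|f^N\|_{F\dot B^{-1}_{1,r}}\to0\quad\text{and}\quad t^N\to0\qquad(N\to\infty),$$ and, for every $N$, there is a global mild solution $(u,\omega)[f^N]$ with the initial datum $f^N$ that lies in $Y_\alpha$ for every $\alpha\in(0,1)$, is real-valued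 with $\operatorname{div}u[f^N](t)=0$ for all $t\ge 0$, is for each $\alpha\in(0,1)$ the only mild solution in $Y_\alpha$ with this datum, and satisfies $$\|u[f^N](t^N)\|_{F\dot B^{-1}_{1,r}}\ge c_0\quad\text{and}\quad\|\omega[f^N](t^N)\|_{F\dot B^{-1}_{1,r}}\ge c_0 .$$ -/

import Mathlib

open MeasureTheory Filter Topology Set
open scoped ENNReal NNReal SchwartzMap FourierTransform LineDeriv

namespace Micropolar

noncomputable section

/-! ### The underlying spaces -/

/-- Three-dimensional Euclidean space (positions, and also frequencies). -/
abbrev E3 := EuclideanSpace ℝ (Fin 3)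

/-- Complex three-vectors with the Euclidean norm. -/
abbrev C3 := EuclideanSpace ℂ (Fin 3)

/-- Tempered distributions on `ℝ³` with values in `ℂ³`. -/
abbrev VField := 𝓢'(E3, C3)

/-- A pair (linear velocity, micro-rotation velocity). -/
abbrev State := VField × VField

/-- A distribution is real-valued: it is real on real test functions. -/
def IsRealField (u : VField) : Prop :=
  ∀ φ : 𝓢(E3, ℂ), (∀ x, (φ x).im = 0) → ∀ i, (u φ i).im = 0

/-- `div u = 0` in the sense of distributions. -/
def IsDivFree (u : VField) : Prop :=
  ∀ φ : 𝓢(E3, ℂ), ∑ k : Fin 3, ((∂_{(EuclideanSpace.single k 1 : E3)} u : VField) φ) k = 0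

/-! ### Littlewood-Paley theory and Fourier-Besov norms -/

/-- A pair `(φ, ψ)` of nonnegative Schwartz functions that defines the dyadic decomposition. -/
structure DyadicPartition where
  φ : 𝓢(E3, ℝ)
  ψ : 𝓢(E3, ℝ)
  φ_nonneg : ∀ ξ, 0 ≤ φ ξ
  ψ_nonneg : ∀ ξ, 0 ≤ ψ ξ
  φ_supp : Function.support φ ⊆ {ξ | ‖ξ‖ ≤ 4 / 3}
  ψ_supp : Function.support ψ ⊆ {ξ | 3 / 4 ≤ ‖ξ‖ ∧ ‖ξ‖ ≤ 8 / 3}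
  sum_ψ : ∀ ξ : E3, ξ ≠ 0 → HasSum (fun j : ℤ => ψ (((2 : ℝ) ^ (-j)) • ξ)) 1
  sum_φ_ψ : ∀ ξ : E3, HasSum (fun j : ℕ => ψ (((2 : ℝ) ^ (-(j : ℤ))) • ξ)) (1 - φ ξ)

/-- `g` is a locally integrable function that represents the Fourier transform of `u`, for the
convention `û(ξ) = ∫ e^{-i x·ξ} u(x) dx`. Mathlib's transform `𝓕` uses `e^{-2π i x·ζ}` instead, so
that `𝓕 u (ζ) = û(2πζ)`.

The pairing is required against all Schwartz functions: a locally integrable `û` for which the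
homogeneous norms below are finite has at most polynomial growth in the mean, so that its product
with a Schwartz function is integrable, and the identity for compactly supported test functions
extends by density. The function `g` is unique up to null sets. In particular a class of tempered
distributions modulo polynomials has at most one representative that admits such a `g`. -/
structure HasFourierDensity (u : VField) (g : E3 → C3) : Prop where
  locallyIntegrable : LocallyIntegrable g
  integrable : ∀ φ : 𝓢(E3, ℂ), Integrable (fun ζ : E3 => φ ζ • g ((2 * Real.pi) • ζ))
  fourier_eq : ∀ φ : 𝓢(E3, ℂ), (𝓕 u : VField) φ = ∫ ζ : E3, φ ζ • g ((2 * Real.pi) • ζ)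

/-- The norm in `L^p` of the Fourier transform of the dyadic block `Δ_j u`. Since the density is
unique up to null sets, the infimum is over a single value; it is `∞` if `û ∉ L¹_loc`. -/
def blockNorm (P : DyadicPartition) (p : ℝ≥0∞) (j : ℤ) (u : VField) : ℝ≥0∞ :=
  ⨅ (g : E3 → C3) (_ : HasFourierDensity u g),
    eLpNorm (fun ξ : E3 => P.ψ (((2 : ℝ) ^ (-j)) • ξ) • g ξ) p volume

/-- The norm of a sequence in `ℓ^r(ℤ)`, `1 ≤ r ≤ ∞`. -/
def seqNorm (r : ℝ≥0∞) (a : ℤ → ℝ≥0∞) : ℝ≥0∞ :=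
  if r = ∞ then ⨆ j, a j else (∑' j, a j ^ r.toReal) ^ (1 / r.toReal)

/-- The norm of the homogeneous Fourier-Besov space `FḂ^s_{p,r}(ℝ³)`; it is `∞` outside of the
space. -/
def fbNorm (P : DyadicPartition) (s : ℝ) (p r : ℝ≥0∞) (u : VField) : ℝ≥0∞ :=
  seqNorm r fun j => (2 : ℝ≥0∞) ^ ((j : ℝ) * s) * blockNorm P p j u

/-- The Fourier-Besov norm of a pair of fields. -/
def stateNorm (P : DyadicPartition) (s : ℝ) (p r : ℝ≥0∞) (U : State) : ℝ≥0∞ :=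
  fbNorm P s p r U.1 + fbNorm P s p r U.2

/-- The Chemin-Lerner norm of `L̃^q(0, ∞; FḂ^s_{p,r}(ℝ³))`. -/
def chNorm (P : DyadicPartition) (q : ℝ≥0∞) (s : ℝ) (p r : ℝ≥0∞) (u : ℝ → VField) : ℝ≥0∞ :=
  seqNorm r fun j => (2 : ℝ≥0∞) ^ ((j : ℝ) * s) *
    eLpNorm (fun t : ℝ => blockNorm P p j (u t)) q (volume.restrict (Ioi 0))

/-- `U ∈ C([0, ∞); FḂ^s_{p,r})`. -/
def IsContinuousIn (P : DyadicPartition) (s : ℝ) (p r : ℝ≥0∞) (U : ℝ → State) : Prop :=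
  (∀ t : ℝ, 0 ≤ t → stateNorm P s p r (U t) < ∞) ∧
  ∀ t₀ : ℝ, 0 ≤ t₀ →
    Tendsto (fun t => stateNorm P s p r (U t - U t₀)) (𝓝[Ici 0] t₀) (𝓝 0)

/-- Membership of both components in `L̃^q(0, ∞; FḂ^s_{p,r}(ℝ³))`. -/
def MemCh (P : DyadicPartition) (q : ℝ≥0∞) (s : ℝ) (p r : ℝ≥0∞) (U : ℝ → State) : Prop :=
  chNorm P q s p r (fun t => (U t).1) < ∞ ∧ chNorm P q s p r (fun t => (U t).2) < ∞

/-! ### The micropolar system with `κ = μ = 1`, `χ = ν = 1/2`, in its integral form -/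

/-- The matrix `𝓑(ξ)`, the symbol of `-∇×`. -/
def symB (ξ : E3) : Matrix (Fin 3) (Fin 3) ℂ :=
  Complex.I • !![0, (ξ 2 : ℂ), -(ξ 1 : ℂ); -(ξ 2 : ℂ), 0, (ξ 0 : ℂ); (ξ 1 : ℂ), -(ξ 0 : ℂ), 0]

/-- The matrix `𝓒(ξ)`, the symbol of `-∇div`. -/
def symC (ξ : E3) : Matrix (Fin 3) (Fin 3) ℂ :=
  Matrix.of fun i j => (ξ i : ℂ) * (ξ j : ℂ)

/-- The symbol `𝓐(ξ)` of the linear part of the system. -/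
def symA (ξ : E3) : Matrix (Fin 3 ⊕ Fin 3) (Fin 3 ⊕ Fin 3) ℂ :=
  Matrix.fromBlocks
    (((‖ξ‖ ^ 2 : ℝ) : ℂ) • 1) (symB ξ)
    (symB ξ) (((‖ξ‖ ^ 2 + 2 : ℝ) : ℂ) • 1 + symC ξ)

/-- The symbol `e^{-t𝓐(ξ)}` of the linear solution operator `G(t)`. -/
def symG (t : ℝ) (ξ : E3) : Matrix (Fin 3 ⊕ Fin 3) (Fin 3 ⊕ Fin 3) ℂ :=
  NormedSpace.exp ((-(t : ℂ)) • symA ξ)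

/-- The vector `(a, b)` in `ℂ⁶`. -/
def join (a b : C3) : Fin 3 ⊕ Fin 3 → ℂ := Sum.elim (fun i => a i) (fun i => b i)

/-- The Fourier transform of `∇·(u ⊗ v) = ∑ₖ ∂ₖ (uₖ v)` in terms of the Fourier transforms
`a = û` and `b = v̂`; a product becomes `(2π)⁻³` times a convolution. -/
def divTensor (a b : E3 → C3) (ξ : E3) : C3 :=
  WithLp.toLp 2 fun l => ∑ k : Fin 3, Complex.I * (ξ k : ℂ) *
    ((((2 * Real.pi) ^ 3 : ℝ) : ℂ)⁻¹ * ∫ η : E3, a (ξ - η) k * b η l)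

/-- The Leray projection at the frequency `ξ`, with the symbol `δᵢⱼ - ξᵢ ξⱼ / |ξ|²`. -/
def leray (ξ : E3) (v : C3) : C3 :=
  WithLp.toLp 2 fun i =>
    v i - ∑ j : Fin 3, ((ξ i : ℂ) * (ξ j : ℂ) / ((‖ξ‖ ^ 2 : ℝ) : ℂ)) * v j

/-- The Fourier transform of `(𝐏∇·(u ⊗ u), ∇·(u ⊗ ω))` in terms of `a = û` and `b = ω̂`. -/
def nonlin (a b : E3 → C3) (ξ : E3) : Fin 3 ⊕ Fin 3 → ℂ :=
  join (leray ξ (divTensor a a ξ)) (divTensor a b ξ)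

/-- `U` is a global mild solution with the initial datum `f`:
`U(t) = G(t) f - ∫₀ᵗ G(t-τ) (𝐏∇·(u ⊗ u), ∇·(u ⊗ ω))(τ) dτ` for all `t ≥ 0`. Both sides are
identified through their Fourier transforms, which have to be (jointly measurable) functions, and
all the integrals that occur have to converge absolutely. -/
def IsMildSolution (f : State) (U : ℝ → State) : Prop :=
  U 0 = f ∧
  ∃ a b : ℝ → E3 → C3,
    AEStronglyMeasurable (fun z : ℝ × E3 => a z.1 z.2) ((volume.restrict (Ioi 0)).prod volume) ∧
    AEStronglyMeasurable (fun z : ℝ × E3 => b z.1 z.2) ((volume.restrict (Ioi 0)).prod volume) ∧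
    (∀ t : ℝ, 0 ≤ t → HasFourierDensity (U t).1 (a t) ∧ HasFourierDensity (U t).2 (b t)) ∧
    (∀ᵐ τ ∂(volume.restrict (Ioi (0 : ℝ))), ∀ᵐ ξ : E3, ∀ k l : Fin 3,
      Integrable (fun η : E3 => a τ (ξ - η) k * a τ η l) ∧
      Integrable (fun η : E3 => a τ (ξ - η) k * b τ η l)) ∧
    ∀ t : ℝ, 0 ≤ t → ∀ᵐ ξ : E3,
      IntervalIntegrable (fun τ => (symG (t - τ) ξ).mulVec (nonlin (a τ) (b τ) ξ)) volume 0 t ∧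
      join (a t ξ) (b t ξ) = (symG t ξ).mulVec (join (a 0 ξ) (b 0 ξ)) -
        ∫ τ in (0 : ℝ)..t, (symG (t - τ) ξ).mulVec (nonlin (a τ) (b τ) ξ)

/-- The global mild solutions in the well-posedness class
`C([0,∞); FḂ^{-1}_{1,2}) ∩ L̃^{2/(1+α)}(0,∞; FḂ^α_{1,2}) ∩ L̃^{2/(1-α)}(0,∞; FḂ^{-α}_{1,2})`. -/
structure IsGlobalSolution (P : DyadicPartition) (α : ℝ) (f : State) (U : ℝ → State) : Prop where
  mild : IsMildSolution f U
  continuous : IsContinuousIn P (-1) 1 2 U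
  memCh_pos : MemCh P (ENNReal.ofReal (2 / (1 + α))) α 1 2 U
  memCh_neg : MemCh P (ENNReal.ofReal (2 / (1 - α))) (-α) 1 2 U

/-- Admissible initial data: pairs of real vector fields in `FḂ^{-1}_{1,2}` with a
divergence-free velocity. -/
structure IsInitialDatum (P : DyadicPartition) (f : State) : Prop where
  finite : stateNorm P (-1) 1 2 f < ∞
  real : IsRealField f.1 ∧ IsRealField f.2
  divFree : IsDivFree f.1

/-- Continuity at the origin of the solution map `f ↦ U[f]`, defined on the admissible data that
have a global solution, from the norm of `FḂ^{-1}_{1,r}` for the data to the norm of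
`L^∞(0,T; FḂ^{-1}_{1,r})` for the solutions. -/
def SolutionMapContinuousAtOrigin (P : DyadicPartition) (α : ℝ) (r : ℝ≥0∞) (T : ℝ) : Prop :=
  ∀ ε : ℝ≥0∞, 0 < ε → ∃ δ : ℝ≥0∞, 0 < δ ∧ ∀ (f : State) (U V : ℝ → State),
    IsInitialDatum P f → IsGlobalSolution P α f U → IsGlobalSolution P α 0 V →
    stateNorm P (-1) 1 r f < δ →
    ∀ t ∈ Icc (0 : ℝ) T, stateNorm P (-1) 1 r (U t - V t) < ε

end

end Micropolar

/-!
# Norm inflation for the micropolar system in `FḂ^{-1}_{1,r}`, `r > 2`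

Everything takes place on the Fourier side, where a state is a function `w t ξ` with values in `ℂ⁶`
(`Vec`).

*Global solutions.* The symbol `𝓐(ξ)` is coercive with constant `|ξ|²/2` (`symA_coercive`), so that
the linear semigroup decays like `e^{-t|ξ|²/2}`. The function `|ξ|^{2/q} e^{-t|ξ|²/2}` is bounded in
`L^q(dt)` uniformly in `ξ`; therefore the Duhamel term with the quadratic nonlinearity maps the space
`L²(0,∞; L¹_ξ)` to itself (`wNorm_duhamel_sub_le`), and with the appropriate weight to every
`L^q(0,∞; L¹_ξ)`, block by block and summably over the dyadic blocks
(`lintegral_duhamel_sub_rpow_le`). A Picard iteration gives a global solution for data whose linear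
evolution is small in `L²(0,∞; L¹_ξ)` (`exists_isFourierSol`), and the solution is unique in this
space (`IsFourierSol.unique`). For data with `|ξ|⁻¹ ĝ ∈ L¹` it is a mild solution in the class `Y_α`
for all `α` (`IsFourierSol.isGlobalSolution`). Conversely, by interpolation `Y_α` is contained in
`L²(0,∞; L¹_ξ)` (`mixNorm_lt_top_of_chNorm`), which yields uniqueness in `Y_α`
(`IsFourierSol.eq_stateOf`). Reality follows from uniqueness; the divergence vanishes as the
semigroup and the Leray projection preserve this property.

*The data.* The datum `lacunary c M K` lives on `K` scales `M, M², …, M^K`. At each scale it has a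
pair of divergence-free bumps at the frequencies `± M^k e₀` and `± M^k e₀ ± e₁`, both with amplitude
`c` relative to `|ξ|`, and the micro-rotation is equal to the velocity. Its norm in `FḂ^{-1}_{1,r}` is
of order `c K^{1/r}`, while the linear evolution has in `L²(0,∞; L¹_ξ)` a norm of order `c √K = ε`
(`mixNorm_heat_lacunary_le`). With `ε` fixed and `K → ∞`, the former tends to zero for `r > 2`
(`tendsto_stateNorm_lacunary`).

*Inflation.* On the data the linear evolution is the heat flow up to an error of order `1/M`
(`wNorm_linFlow_sub_heatFlow_le`). The high-high interaction of the two bumps of a scale produces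
frequencies near `e₁`. A linear functional orthogonal to `ξ` removes the Leray projection, and the
contributions of all scales then have the same sign (`le_interaction`); each contributes a multiple
of `c²` to the time integral over `[0, 1/M]`, hence all of them a multiple of `c² K = ε²`
(`le_pairing_integral_quad`). The remainder is of order `ε³ + ε²/M`. If `ε` is small and `M` is
large, a fixed multiple of `ε²` survives in velocity and micro-rotation at the time `1/M`
(`exists_inflation`).
-/

namespace Micropolar

noncomputable section

/-! ### The linear solution operator -/

/-- The space `ℂ⁶` of the values of `(û, ω̂)`, with the maximum norm. -/
abbrev Vec := Fin 3 ⊕ Fin 3 → ℂ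

theorem sq_norm_le_sum_normSq (v : Vec) : ‖v‖ ^ 2 ≤ ∑ i, Complex.normSq (v i) := by
  have h0 : 0 ≤ ∑ i, Complex.normSq (v i) := Finset.sum_nonneg fun i _ => Complex.normSq_nonneg _
  have : ‖v‖ ≤ √(∑ i, Complex.normSq (v i)) := by
    rw [pi_norm_le_iff_of_nonneg (Real.sqrt_nonneg _)]
    intro i
    rw [← Real.sqrt_sq (norm_nonneg (v i)), Complex.sq_norm]
    exact Real.sqrt_le_sqrt (Finset.single_le_sum
      (f := fun i => Complex.normSq (v i)) (fun i _ => Complex.normSq_nonneg _) (Finset.mem_univ i))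
  calc ‖v‖ ^ 2 ≤ √(∑ i, Complex.normSq (v i)) ^ 2 := by gcongr
    _ = _ := Real.sq_sqrt h0

theorem sum_normSq_le (v : Vec) : ∑ i, Complex.normSq (v i) ≤ 6 * ‖v‖ ^ 2 := by
  calc ∑ i, Complex.normSq (v i) ≤ ∑ _i : Fin 3 ⊕ Fin 3, ‖v‖ ^ 2 := by
        refine Finset.sum_le_sum fun i _ => ?_
        rw [← Complex.sq_norm]
        gcongr
        exact norm_le_pi_norm v i
    _ = _ := by simp

theorem norm_sq_eq (ξ : E3) : ‖ξ‖ ^ 2 = ξ 0 ^ 2 + ξ 1 ^ 2 + ξ 2 ^ 2 := by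
  rw [EuclideanSpace.norm_sq_eq, Fin.sum_univ_three]; simp

/-- The symbol `𝓐(ξ)` is coercive with constant `|ξ|²/2`: the difference of the two sides is
`½|ξ|²|b|² + |ξ·b|² + ½|ξ·a|² + ½|𝓑a + 2b|²` for the vector `(a, b)`. -/
theorem symA_coercive (ξ : E3) (v : Vec) :
    ‖ξ‖ ^ 2 / 2 * ∑ i, Complex.normSq (v i) ≤
      (∑ i, starRingEnd ℂ (v i) * (symA ξ).mulVec v i).re := by
  rw [norm_sq_eq]
  have key : (∑ i, starRingEnd ℂ (v i) * (symA ξ).mulVec v i).re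
      - (ξ 0 ^ 2 + ξ 1 ^ 2 + ξ 2 ^ 2) / 2 * ∑ i, Complex.normSq (v i) =
    (ξ 0 ^ 2 + ξ 1 ^ 2 + ξ 2 ^ 2) / 2 * ∑ i, Complex.normSq (v (.inr i)) +
    Complex.normSq (∑ i, (ξ i : ℂ) * v (.inr i)) + Complex.normSq (∑ i, (ξ i : ℂ) * v (.inl i)) / 2
    + (∑ i, Complex.normSq ((symB ξ).mulVec (fun j => v (.inl j)) i + 2 * v (.inr i))) / 2 := by
    have hx := norm_sq_eq ξ
    simp only [symA, symB, symC, Matrix.mulVec, dotProduct, Fintype.sum_sum_type,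
      Fin.sum_univ_three, Matrix.fromBlocks_apply₁₁, Matrix.fromBlocks_apply₁₂,
      Matrix.fromBlocks_apply₂₁, Matrix.fromBlocks_apply₂₂, Matrix.add_apply, Matrix.smul_apply,
      Matrix.of_apply, hx, Complex.normSq_apply, smul_eq_mul]
    simp [-Complex.ofReal_pow]
    ring
  have h1 : ∀ (s : Finset (Fin 3)) (f : Fin 3 → ℂ), 0 ≤ ∑ i ∈ s, Complex.normSq (f i) :=
    fun s f => Finset.sum_nonneg fun i _ => Complex.normSq_nonneg _
  have h2 := h1 Finset.univ fun i => v (.inr i)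
  have h3 := h1 Finset.univ fun i =>
    ((symB ξ).mulVec (fun j => v (.inl j)) i + 2 * v (.inr i))
  have h4 := Complex.normSq_nonneg (∑ i, (ξ i : ℂ) * v (.inr i))
  have h5 := Complex.normSq_nonneg (∑ i, (ξ i : ℂ) * v (.inl i))
  have h6 : 0 ≤ (ξ 0 ^ 2 + ξ 1 ^ 2 + ξ 2 ^ 2) / 2 * ∑ i, Complex.normSq (v (.inr i)) := by
    positivity
  linarith

section
attribute [local instance] Matrix.linftyOpNormedRing Matrix.linftyOpNormedAlgebra

theorem hasDerivAt_symG (ξ : E3) (t : ℝ) (i j : Fin 3 ⊕ Fin 3) :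
    HasDerivAt (fun t => symG t ξ i j) ((-(symG t ξ * symA ξ)) i j) t := by
  have h := hasDerivAt_exp_smul_const (𝕂 := ℝ) (-symA ξ) t
  have e : ∀ t, symG t ξ = NormedSpace.exp (t • (-symA ξ)) := by
    intro s; unfold symG; congr 1
    ext i j; simp
  simp only [e]
  rw [← mul_neg]
  have h1 := (hasDerivAt_pi (ι := Fin 3 ⊕ Fin 3)).1 h i
  exact (hasDerivAt_pi (ι := Fin 3 ⊕ Fin 3)).1 h1 j

theorem continuous_symG : Continuous fun p : ℝ × E3 => symG p.1 p.2 := by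
  unfold symG
  refine (NormedSpace.exp_continuous (𝔸 := Matrix (Fin 3 ⊕ Fin 3) (Fin 3 ⊕ Fin 3) ℂ)).comp ?_
  refine Continuous.smul (Complex.continuous_ofReal.comp continuous_fst).neg ?_
  refine continuous_matrix fun i j => ?_
  rcases i with i | i <;> rcases j with j | j <;> fin_cases i <;> fin_cases j <;>
    simp [symA, symB, symC] <;> fun_prop

theorem symG_zero (ξ : E3) : symG 0 ξ = 1 := by simp [symG]

theorem symG_add (s t : ℝ) (ξ : E3) : symG (s + t) ξ = symG s ξ * symG t ξ := by
  unfold symG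
  rw [← Matrix.exp_add_of_commute]
  · rw [← add_smul]; push_cast; ring_nf
  · exact ((Commute.refl _).smul_left _).smul_right _

theorem symA_commute_symG (t : ℝ) (ξ : E3) : Commute (symA ξ) (symG t ξ) := by
  unfold symG
  exact ((Commute.refl (symA ξ)).smul_right _).exp_right
end

theorem hasDerivAt_symG_mulVec (ξ : E3) (v : Vec) (t : ℝ) :
    HasDerivAt (fun t => (symG t ξ).mulVec v) (-(symA ξ).mulVec ((symG t ξ).mulVec v)) t := by
  rw [hasDerivAt_pi]
  intro i
  have h' := fun i j => hasDerivAt_symG ξ t i j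
  rw [← (symA_commute_symG t ξ).eq] at h'
  have := HasDerivAt.fun_sum (u := Finset.univ) fun j _ => (h' i j).mul_const (v j)
  rw [Matrix.mulVec_mulVec]
  simpa [Matrix.mulVec, dotProduct] using this

/-- The energy estimate, from the coercivity of the symbol. -/
theorem sum_normSq_symG_mulVec_le (ξ : E3) (v : Vec) {t : ℝ} (ht : 0 ≤ t) :
    ∑ i, Complex.normSq ((symG t ξ).mulVec v i) ≤
      Real.exp (-(t * ‖ξ‖ ^ 2)) * ∑ i, Complex.normSq (v i) := by
  set y : ℝ → Vec := fun t => (symG t ξ).mulVec v with hy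
  set E : ℝ → ℝ := fun t => Real.exp (t * ‖ξ‖ ^ 2) * ∑ i, Complex.normSq (y t i) with hE
  have hd : ∀ s, HasDerivAt E (Real.exp (s * ‖ξ‖ ^ 2) * (‖ξ‖ ^ 2 * ∑ i, Complex.normSq (y s i)
      - 2 * (∑ i, starRingEnd ℂ (y s i) * (symA ξ).mulVec (y s) i).re)) s := by
    intro s
    have hyi : ∀ i, HasDerivAt (fun t => y t i) (-(symA ξ).mulVec (y s) i) s := fun i =>
      (hasDerivAt_pi.1 (hasDerivAt_symG_mulVec ξ v s)) i
    have hn : ∀ i, HasDerivAt (fun t => Complex.normSq (y t i))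
        (-2 * (starRingEnd ℂ (y s i) * (symA ξ).mulVec (y s) i).re) s := by
      intro i
      have hr : HasDerivAt (fun t => (y t i).re) (-(symA ξ).mulVec (y s) i).re s :=
        (Complex.reCLM.hasFDerivAt.comp_hasDerivAt s (hyi i))
      have hi : HasDerivAt (fun t => (y t i).im) (-(symA ξ).mulVec (y s) i).im s :=
        (Complex.imCLM.hasFDerivAt.comp_hasDerivAt s (hyi i))
      have := (hr.mul hr).add (hi.mul hi)
      simp only [Complex.normSq_apply]
      refine this.congr_deriv ?_
      simp
      ring
    have hs := HasDerivAt.fun_sum (u := Finset.univ) fun i _ => hn i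
    have he : HasDerivAt (fun t : ℝ => Real.exp (t * ‖ξ‖ ^ 2))
        (Real.exp (s * ‖ξ‖ ^ 2) * ‖ξ‖ ^ 2) s := by
      simpa using ((hasDerivAt_id s).mul_const (‖ξ‖ ^ 2)).exp
    refine (he.mul hs).congr_deriv ?_
    rw [← Finset.mul_sum, Complex.re_sum]
    ring
  have hanti : Antitone E := by
    refine antitone_of_hasDerivAt_nonpos hd fun s => ?_
    have := symA_coercive ξ (y s)
    refine mul_nonpos_of_nonneg_of_nonpos (Real.exp_nonneg _) ?_
    linarith
  have h := hanti ht
  simp only [hE, hy, symG_zero, Matrix.one_mulVec, zero_mul, Real.exp_zero, one_mul] at h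
  rw [Real.exp_neg, ← div_eq_inv_mul, le_div_iff₀ (Real.exp_pos _), mul_comm]
  exact h

/-- The linear semigroup decays like the heat semigroup of half the speed. -/
theorem norm_symG_mulVec_le (ξ : E3) (v : Vec) {t : ℝ} (ht : 0 ≤ t) :
    ‖(symG t ξ).mulVec v‖ ≤ 3 * Real.exp (-(t * ‖ξ‖ ^ 2 / 2)) * ‖v‖ := by
  refine abs_le_of_sq_le_sq' ?_ (by positivity) |>.2
  calc ‖(symG t ξ).mulVec v‖ ^ 2 ≤ _ := sq_norm_le_sum_normSq _
    _ ≤ _ := sum_normSq_symG_mulVec_le ξ v ht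
    _ ≤ Real.exp (-(t * ‖ξ‖ ^ 2)) * (9 * ‖v‖ ^ 2) := by
        gcongr
        exact (sum_normSq_le v).trans (by nlinarith [sq_nonneg ‖v‖])
    _ = _ := by
        rw [mul_pow, mul_pow, ← Real.exp_nat_mul]
        push_cast
        rw [show (2 : ℝ) * -(t * ‖ξ‖ ^ 2 / 2) = -(t * ‖ξ‖ ^ 2) by ring]
        ring

/-- The semigroup is close to the scalar semigroup `e^{-tl}` on vectors on which `𝓐 - l` is
small: this is the mean value inequality for `s ↦ e^{-(t-s)𝓐} e^{-sl} v`. -/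
theorem norm_symG_mulVec_sub_le (ξ : E3) (v : Vec) {t l D : ℝ} (ht : 0 ≤ t) (hl : 0 ≤ l)
    (hl' : l ≤ ‖ξ‖ ^ 2) (hD : ‖(symA ξ).mulVec v - (l : ℂ) • v‖ ≤ D) :
    ‖(symG t ξ).mulVec v - (Real.exp (-(t * l)) : ℂ) • v‖ ≤
      3 * D * t * Real.exp (-(t * l / 2)) := by
  set z : ℝ → Vec := fun s => (Real.exp (-(s * l)) : ℂ) • (symG (t - s) ξ).mulVec v with hz
  have hd : ∀ s, HasDerivAt z ((Real.exp (-(s * l)) : ℂ) •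
      (symG (t - s) ξ).mulVec ((symA ξ).mulVec v - (l : ℂ) • v)) s := by
    intro s
    have h1 : HasDerivAt (fun s => (symG (t - s) ξ).mulVec v)
        ((symA ξ).mulVec ((symG (t - s) ξ).mulVec v)) s := by
      have := (hasDerivAt_symG_mulVec ξ v (t - s)).scomp s ((hasDerivAt_id s).const_sub t)
      simpa [Function.comp_def] using! this
    have h2 : HasDerivAt (fun s : ℝ => (Real.exp (-(s * l)) : ℂ))
        ((Real.exp (-(s * l)) : ℂ) * -(l : ℂ)) s := by
      have : HasDerivAt (fun s : ℝ => Real.exp (-(s * l))) (Real.exp (-(s * l)) * -l) s := by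
        simpa using (((hasDerivAt_id s).mul_const l).neg).exp
      simpa using this.ofReal_comp
    refine (h2.smul h1).congr_deriv ?_
    rw [Matrix.mulVec_sub, Matrix.mulVec_smul, Matrix.mulVec_mulVec, Matrix.mulVec_mulVec,
      (symA_commute_symG (t - s) ξ).eq, smul_sub, smul_smul, mul_neg, neg_smul, sub_eq_add_neg,
      sub_eq_add_neg]
  have hD0 : 0 ≤ D := (norm_nonneg _).trans hD
  have hb : ∀ s ∈ Ico 0 t, ‖(Real.exp (-(s * l)) : ℂ) •
      (symG (t - s) ξ).mulVec ((symA ξ).mulVec v - (l : ℂ) • v)‖ ≤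
      3 * D * Real.exp (-(t * l / 2)) := by
    intro s hs
    rw [norm_smul, Complex.norm_real, Real.norm_eq_abs, abs_of_pos (Real.exp_pos _)]
    calc _ ≤ Real.exp (-(s * l)) * (3 * Real.exp (-((t - s) * ‖ξ‖ ^ 2 / 2)) * D) := by
          gcongr
          exact (norm_symG_mulVec_le ξ _ (by linarith [hs.2])).trans (by gcongr)
      _ = 3 * D * (Real.exp (-(s * l)) * Real.exp (-((t - s) * ‖ξ‖ ^ 2 / 2))) := by ring
      _ ≤ _ := by
          rw [← Real.exp_add]
          gcongr
          nlinarith [hs.1, hs.2, mul_nonneg hs.1 hl,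
            mul_nonneg (sub_nonneg.2 hs.2.le) (sub_nonneg.2 hl')]
  have := norm_image_sub_le_of_norm_deriv_le_segment' (f := z)
    (fun s _ => (hd s).hasDerivWithinAt) hb t (right_mem_Icc.2 ht)
  simp only [hz, sub_self, symG_zero, Matrix.one_mulVec, sub_zero, zero_mul, neg_zero,
    Real.exp_zero, Complex.ofReal_one, one_smul] at this
  rw [norm_sub_rev]
  refine this.trans (le_of_eq (by ring))

theorem starRingEnd_symG (t : ℝ) (ξ : E3) :
    symG t (-ξ) = (symG t ξ).map (starRingEnd ℂ) := by
  have h : symA (-ξ) = (symA ξ).map (starRingEnd ℂ) := by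
    ext i j
    rcases i with i | i <;> rcases j with j | j <;> fin_cases i <;> fin_cases j <;>
      simp [symA, symB, symC, map_ofNat]
  unfold symG
  rw [h]
  have := Matrix.exp_transpose ((-(t : ℂ)) • symA ξ)
  have h2 := Matrix.exp_conjTranspose ((-(t : ℂ)) • symA ξ).transpose
  have e : ∀ A : Matrix (Fin 3 ⊕ Fin 3) (Fin 3 ⊕ Fin 3) ℂ,
      A.transpose.conjTranspose = A.map (starRingEnd ℂ) := fun A => by ext i j; simp
  rw [this, e, e] at h2
  rw [← h2]
  congr 1
  ext i j; simp

/-- `-𝓑(ξ)v` is orthogonal to `ξ`, so that the longitudinal part of the velocity solves the heat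
equation. -/
theorem symG_mulVec_longitudinal (ξ : E3) (v : Vec) (t : ℝ)
    (h : ∑ i : Fin 3, (ξ i : ℂ) * v (.inl i) = 0) :
    ∑ i : Fin 3, (ξ i : ℂ) * (symG t ξ).mulVec v (.inl i) = 0 := by
  set y : ℝ → Vec := fun t => (symG t ξ).mulVec v with hy
  set L : ℝ → ℂ := fun t => ∑ i : Fin 3, (ξ i : ℂ) * y t (.inl i) with hL
  have hyi : ∀ s i, HasDerivAt (fun t => y t i) (-(symA ξ).mulVec (y s) i) s := fun s i =>
      (hasDerivAt_pi.1 (hasDerivAt_symG_mulVec ξ v s)) i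
  have hd : ∀ s, HasDerivAt L (-((‖ξ‖ ^ 2 : ℝ) : ℂ) * L s) s := by
    intro s
    refine (HasDerivAt.fun_sum (u := Finset.univ) fun i _ =>
      (hyi s (.inl i)).const_mul (ξ i : ℂ)).congr_deriv ?_
    simp only [hL, symA, symB, Matrix.mulVec, dotProduct, Fintype.sum_sum_type,
      Fin.sum_univ_three, Matrix.fromBlocks_apply₁₁, Matrix.fromBlocks_apply₁₂,
      Matrix.smul_apply, smul_eq_mul]
    simp
    ring
  set H : ℝ → ℂ := fun s => Complex.exp (((‖ξ‖ ^ 2 : ℝ) : ℂ) * s) * L s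
  have hH : ∀ s, HasDerivAt H 0 s := by
    intro s
    have h1 : HasDerivAt (fun s : ℝ => Complex.exp (((‖ξ‖ ^ 2 : ℝ) : ℂ) * s))
        (Complex.exp (((‖ξ‖ ^ 2 : ℝ) : ℂ) * s) * ((‖ξ‖ ^ 2 : ℝ) : ℂ)) s := by
      have := (((hasDerivAt_id s).ofReal_comp).const_mul ((‖ξ‖ ^ 2 : ℝ) : ℂ)).cexp
      simpa using this
    refine (h1.mul (hd s)).congr_deriv ?_
    ring
  have hc := is_const_of_deriv_eq_zero (fun s => (hH s).differentiableAt)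
    (fun s => (hH s).deriv) t 0
  have h0 : L 0 = 0 := by simpa [hL, hy, symG_zero] using h
  simp only [H, h0, mul_zero, mul_eq_zero, Complex.exp_ne_zero, false_or] at hc
  exact hc

/-! ### The quadratic term -/

/-- The velocity component of a vector of `ℂ⁶`. -/
def vel (v : Vec) : C3 := WithLp.toLp 2 fun i => v (.inl i)

/-- The micro-rotation component of a vector of `ℂ⁶`. -/
def rot (v : Vec) : C3 := WithLp.toLp 2 fun i => v (.inr i)

@[simp] theorem vel_apply (v : Vec) (i : Fin 3) : vel v i = v (.inl i) := rfl
@[simp] theorem rot_apply (v : Vec) (i : Fin 3) : rot v i = v (.inr i) := rfl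
@[simp] theorem join_vel_rot (v : Vec) : join (vel v) (rot v) = v := by
  funext i; rcases i with i | i <;> rfl

/-- The Fourier transform of the quadratic term `(𝐏∇·(u ⊗ u), ∇·(u ⊗ ω))` as a function of the
Fourier transform `w` of `(u, ω)`. -/
def quad (w : E3 → Vec) (ξ : E3) : Vec :=
  nonlin (fun η => vel (w η)) (fun η => rot (w η)) ξ

theorem abs_apply_le_norm (ξ : E3) (i : Fin 3) : |ξ i| ≤ ‖ξ‖ := by
  simpa using PiLp.norm_apply_le ξ i

theorem norm_divTensor_sub_le {a b a' b' : E3 → C3} {ξ : E3} {δ : ℝ} (l : Fin 3)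
    (h : ∀ k, ‖(∫ η : E3, a (ξ - η) k * b η l) - ∫ η : E3, a' (ξ - η) k * b' η l‖ ≤ δ) :
    ‖divTensor a b ξ l - divTensor a' b' ξ l‖ ≤ 3 * ‖ξ‖ * δ := by
  have hδ : 0 ≤ δ := (norm_nonneg _).trans (h 0)
  have hpi : ‖((((2 * Real.pi) ^ 3 : ℝ) : ℂ))⁻¹‖ ≤ 1 := by
    rw [norm_inv, Complex.norm_real, Real.norm_eq_abs, abs_of_pos (by positivity)]
    refine inv_le_one_of_one_le₀ (one_le_pow₀ ?_)
    linarith [Real.pi_gt_three]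
  simp only [divTensor]
  rw [← Finset.sum_sub_distrib]
  refine (norm_sum_le _ _).trans ?_
  calc _ ≤ ∑ _k : Fin 3, ‖ξ‖ * δ := by
        refine Finset.sum_le_sum fun k _ => ?_
        rw [← mul_sub, ← mul_sub, norm_mul, norm_mul, norm_mul, Complex.norm_I, one_mul,
          Complex.norm_real, Real.norm_eq_abs]
        calc _ ≤ ‖ξ‖ * (1 * δ) := by
              gcongr
              · exact abs_apply_le_norm ξ k
              · exact h k
          _ = _ := by ring
    _ = _ := by simp; ring

theorem norm_leray_sub_le (ξ : E3) {v v' : C3} {δ : ℝ} (h : ∀ l, ‖v l - v' l‖ ≤ δ) (i : Fin 3) :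
    ‖leray ξ v i - leray ξ v' i‖ ≤ 4 * δ := by
  have hδ : 0 ≤ δ := (norm_nonneg _).trans (h 0)
  have hle : ∀ j, ‖(ξ i : ℂ) * (ξ j : ℂ) / ((‖ξ‖ ^ 2 : ℝ) : ℂ)‖ ≤ 1 := by
    intro j
    rw [norm_div, norm_mul, Complex.norm_real, Complex.norm_real, Complex.norm_real,
      Real.norm_eq_abs, Real.norm_eq_abs, Real.norm_eq_abs, abs_of_nonneg (sq_nonneg ‖ξ‖), sq]
    exact div_le_one_of_le₀ (mul_le_mul (abs_apply_le_norm ξ i) (abs_apply_le_norm ξ j)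
      (abs_nonneg _) (norm_nonneg _)) (by positivity)
  simp only [leray]
  rw [sub_sub_sub_comm, ← Finset.sum_sub_distrib]
  refine (norm_sub_le _ _).trans ?_
  calc _ ≤ δ + ∑ _j : Fin 3, δ := by
        gcongr
        · exact h i
        · refine (norm_sum_le _ _).trans (Finset.sum_le_sum fun j _ => ?_)
          rw [← mul_sub, norm_mul]
          calc _ ≤ 1 * δ := by gcongr; exacts [hle j, h j]
            _ = δ := one_mul _
    _ = _ := by simp; ring

theorem norm_quad_sub_le {w w' : E3 → Vec} {ξ : E3} {δ : ℝ}
    (h : ∀ p q, ‖(∫ η, w (ξ - η) p * w η q) - ∫ η, w' (ξ - η) p * w' η q‖ ≤ δ) :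
    ‖quad w ξ - quad w' ξ‖ ≤ 12 * ‖ξ‖ * δ := by
  have hδ : 0 ≤ δ := (norm_nonneg _).trans (h (.inl 0) (.inl 0))
  rw [pi_norm_le_iff_of_nonneg (by positivity)]
  intro i
  rcases i with i | i
  · have := norm_leray_sub_le ξ (v := divTensor (fun η => vel (w η)) (fun η => vel (w η)) ξ)
      (v' := divTensor (fun η => vel (w' η)) (fun η => vel (w' η)) ξ)
      (fun l => norm_divTensor_sub_le l fun k => h (.inl k) (.inl l)) i
    refine this.trans (le_of_eq (by ring))
  · have := norm_divTensor_sub_le (a := fun η => vel (w η)) (b := fun η => rot (w η))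
      (a' := fun η => vel (w' η)) (b' := fun η => rot (w' η)) i fun k => h (.inl k) (.inr i)
    refine this.trans ?_
    have : 0 ≤ ‖ξ‖ * δ := by positivity
    linarith

/-- `|w| * |w'|` at the frequency `ξ`. -/
def absConv (w w' : E3 → Vec) (ξ : E3) : ℝ≥0∞ := ∫⁻ η, ‖w (ξ - η)‖ₑ * ‖w' η‖ₑ

theorem integrable_of_absConv {w w' : E3 → Vec} (hw : Measurable w) (hw' : Measurable w')
    {ξ : E3} (h : absConv w w' ξ < ∞) (p q : Fin 3 ⊕ Fin 3) :
    Integrable fun η => w (ξ - η) p * w' η q := by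
  refine ⟨?_, ?_⟩
  · have h1 : Measurable fun η => w (ξ - η) p :=
      (measurable_pi_apply p).comp (hw.comp (measurable_const.sub measurable_id))
    have h2 : Measurable fun η => w' η q := (measurable_pi_apply q).comp hw'
    exact (h1.mul h2).aestronglyMeasurable
  · refine lt_of_le_of_lt (lintegral_mono fun η => ?_) h
    rw [enorm_mul]
    gcongr
    · exact enorm_le_iff_norm_le.2 (norm_le_pi_norm _ p)
    · exact enorm_le_iff_norm_le.2 (norm_le_pi_norm _ q)

/-- The quadratic term is locally Lipschitz, in terms of convolutions. -/
theorem enorm_quad_sub_le {w w' : E3 → Vec} (hw : Measurable w) (hw' : Measurable w') {ξ : E3}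
    (h : absConv w w ξ < ∞) (h' : absConv w' w' ξ < ∞) :
    ‖quad w ξ - quad w' ξ‖ₑ ≤ 12 * ‖ξ‖ₑ * (absConv w (w - w') ξ + absConv (w - w') w' ξ) := by
  set D := absConv w (w - w') ξ + absConv (w - w') w' ξ with hD
  have key : ∀ p q, ‖(∫ η, w (ξ - η) p * w η q) - ∫ η, w' (ξ - η) p * w' η q‖ₑ ≤ D := by
    intro p q
    rw [← integral_sub (integrable_of_absConv hw hw h p q) (integrable_of_absConv hw' hw' h' p q)]
    refine (enorm_integral_le_lintegral_enorm _).trans ?_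
    rw [hD, absConv, absConv, ← lintegral_add_left]
    · refine lintegral_mono fun η => ?_
      have e : w (ξ - η) p * w η q - w' (ξ - η) p * w' η q =
        w (ξ - η) p * (w - w') η q + (w - w') (ξ - η) p * w' η q := by
        simp only [Pi.sub_apply]; ring
      rw [e]
      refine (enorm_add_le _ _).trans ?_
      rw [enorm_mul, enorm_mul]
      gcongr <;> exact enorm_le_iff_norm_le.2 (norm_le_pi_norm _ _)
    · exact ((hw.comp (measurable_const.sub measurable_id)).enorm).mul (hw.sub hw').enorm
  by_cases hDt : D = ∞
  · by_cases hξ : ξ = 0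
    · have := norm_quad_sub_le (ξ := ξ) (w := w) (w' := w')
        (δ := ∑ p, ∑ q, ‖(∫ η, w (ξ - η) p * w η q) - ∫ η, w' (ξ - η) p * w' η q‖) (fun p q => by
          refine le_trans ?_ (Finset.single_le_sum (fun p _ => Finset.sum_nonneg
            fun q _ => norm_nonneg _) (Finset.mem_univ p))
          exact Finset.single_le_sum (f := fun q => ‖(∫ η, w (ξ - η) p * w η q) -
            ∫ η, w' (ξ - η) p * w' η q‖) (fun q _ => norm_nonneg _) (Finset.mem_univ q))
      rw [hξ] at this ⊢
      simp only [norm_zero, mul_zero, zero_mul] at this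
      rw [norm_le_zero_iff.1 this]; simp
    · rw [hDt, ENNReal.mul_top (by simp [hξ])]; exact le_top
  · have := norm_quad_sub_le (ξ := ξ) (w := w) (w' := w') (δ := D.toReal) (fun p q => by
      rw [← toReal_enorm]; exact ENNReal.toReal_mono hDt (key p q))
    rw [← ofReal_norm, ← ofReal_norm, ← ENNReal.ofReal_toReal hDt,
      show (12 : ℝ≥0∞) = ENNReal.ofReal 12 by simp, ← ENNReal.ofReal_mul (by norm_num),
      ← ENNReal.ofReal_mul (by positivity)]
    exact ENNReal.ofReal_le_ofReal this

@[simp] theorem quad_zero (ξ : E3) : quad 0 ξ = 0 := by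
  have := norm_quad_sub_le (w := fun η => 0) (w' := fun η => 0) (ξ := ξ) (δ := 0) (by simp)
  funext i
  rcases i with i | i <;>
    simp [quad, nonlin, join, leray, divTensor]

theorem absConv_zero_right (w : E3 → Vec) (ξ : E3) : absConv w 0 ξ = 0 := by simp [absConv]

theorem enorm_quad_le {w : E3 → Vec} (hw : Measurable w) {ξ : E3} (h : absConv w w ξ < ∞) :
    ‖quad w ξ‖ₑ ≤ 12 * ‖ξ‖ₑ * absConv w w ξ := by
  simpa [absConv_zero_right] using
    enorm_quad_sub_le (w' := 0) hw measurable_const h (by simp [absConv_zero_right])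

theorem lintegral_absConv {w w' : E3 → Vec} (hw : Measurable w) (hw' : Measurable w') :
    ∫⁻ ξ, absConv w w' ξ = (∫⁻ ξ, ‖w ξ‖ₑ) * ∫⁻ ξ, ‖w' ξ‖ₑ := by
  unfold absConv
  rw [lintegral_lintegral_swap]
  · calc _ = ∫⁻ η, (∫⁻ ξ, ‖w ξ‖ₑ) * ‖w' η‖ₑ := by
          refine lintegral_congr fun η => ?_
          rw [lintegral_mul_const _ (by fun_prop)]
          rw [lintegral_sub_right_eq_self (fun ξ => ‖w ξ‖ₑ) η]
      _ = _ := lintegral_const_mul _ hw'.enorm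
  · refine Measurable.aemeasurable ?_
    exact ((hw.comp (measurable_fst.sub measurable_snd)).enorm).mul (hw'.comp measurable_snd).enorm

theorem measurable_absConv {w w' : ℝ → E3 → Vec} (hw : Measurable (Function.uncurry w))
    (hw' : Measurable (Function.uncurry w')) :
    Measurable fun p : ℝ × E3 => absConv (w p.1) (w' p.1) p.2 := by
  unfold absConv
  refine Measurable.lintegral_prod_right' (f := fun z : (ℝ × E3) × E3 =>
    ‖w z.1.1 (z.1.2 - z.2)‖ₑ * ‖w' z.1.1 z.2‖ₑ) ?_
  have h1 : Measurable fun z : (ℝ × E3) × E3 => w z.1.1 (z.1.2 - z.2) :=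
    hw.comp (f := fun z : (ℝ × E3) × E3 => (z.1.1, z.1.2 - z.2)) (by fun_prop)
  have h2 : Measurable fun z : (ℝ × E3) × E3 => w' z.1.1 z.2 :=
    hw'.comp (f := fun z : (ℝ × E3) × E3 => (z.1.1, z.2)) (by fun_prop)
  exact h1.enorm.mul h2.enorm

theorem measurable_quad {w : ℝ → E3 → Vec} (hw : Measurable (Function.uncurry w)) :
    Measurable fun p : ℝ × E3 => quad (w p.1) p.2 := by
  have hI : ∀ p q, Measurable fun z : ℝ × E3 => ∫ η, w z.1 (z.2 - η) p * w z.1 η q := by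
    intro p q
    have h1 : Measurable fun z : (ℝ × E3) × E3 => w z.1.1 (z.1.2 - z.2) p :=
      (measurable_pi_apply p).comp
        (hw.comp (f := fun z : (ℝ × E3) × E3 => (z.1.1, z.1.2 - z.2)) (by fun_prop))
    have h2 : Measurable fun z : (ℝ × E3) × E3 => w z.1.1 z.2 q :=
      (measurable_pi_apply q).comp
        (hw.comp (f := fun z : (ℝ × E3) × E3 => (z.1.1, z.2)) (by fun_prop))
    exact (StronglyMeasurable.integral_prod_right' (h1.mul h2).stronglyMeasurable).measurable
  have hc : ∀ i : Fin 3, Measurable fun z : ℝ × E3 => ((z.2 i : ℝ) : ℂ) := fun i => by fun_prop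
  have hd : ∀ (q : Fin 3 → Fin 3 ⊕ Fin 3) (l : Fin 3), Measurable fun z : ℝ × E3 =>
      ∑ k : Fin 3, Complex.I * (z.2 k : ℂ) * ((((2 * Real.pi) ^ 3 : ℝ) : ℂ)⁻¹ *
        ∫ η : E3, w z.1 (z.2 - η) (.inl k) * w z.1 η (q l)) := fun q l =>
    Finset.measurable_sum _ fun k _ => ((hc k).const_mul _).mul ((hI _ _).const_mul _)
  refine measurable_pi_iff.2 fun i => ?_
  rcases i with i | i
  · refine (hd .inl i).sub (Finset.measurable_sum _ fun j _ => ?_)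
    refine Measurable.mul (((hc i).mul (hc j)).div ?_) (hd .inl j)
    fun_prop
  · exact hd .inr i

theorem quad_congr {w w' : E3 → Vec} (h : w =ᵐ[volume] w') (ξ : E3) : quad w ξ = quad w' ξ := by
  have h2 : (fun η => w (ξ - η)) =ᵐ[volume] fun η => w' (ξ - η) :=
    (Measure.measurePreserving_sub_left volume ξ).quasiMeasurePreserving.ae_eq_comp h
  have hI : ∀ p q, ∫ η, w (ξ - η) p * w η q = ∫ η, w' (ξ - η) p * w' η q := by
    intro p q
    refine integral_congr_ae ?_
    filter_upwards [h, h2] with η e1 e2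
    rw [e1, e2]
  have := norm_quad_sub_le (w := w) (w' := w') (ξ := ξ) (δ := 0) (by
    intro p q; rw [hI]; simp)
  rw [mul_zero, norm_le_zero_iff, sub_eq_zero] at this
  exact this

/-- The quadratic term commutes with complex conjugation in physical space. -/
theorem quad_star (w : E3 → Vec) (ξ : E3) :
    quad (fun η => star (w (-η))) ξ = star (quad w (-ξ)) := by
  have hI : ∀ p q, ∫ η, starRingEnd ℂ (w (-(ξ - η)) p) * starRingEnd ℂ (w (-η) q) =
      starRingEnd ℂ (∫ η, w (-ξ - η) p * w η q) := by
    intro p q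
    rw [← integral_conj, ← integral_neg_eq_self]
    refine integral_congr_ae (ae_of_all _ fun η => ?_)
    simp only [map_mul, neg_neg]
    congr 3
    simp
    abel
  funext i
  rcases i with i | i
  · simp only [quad, nonlin, join, leray, divTensor, vel_apply, rot_apply, hI, Sum.elim_inl,
      Pi.star_apply, RCLike.star_def, map_sub, map_sum, map_mul, map_div₀, map_inv₀,
      Complex.conj_ofReal, Complex.conj_I, norm_neg, PiLp.neg_apply, Complex.ofReal_neg, map_neg,
      neg_mul, mul_neg, neg_neg]
  · simp only [quad, nonlin, join, leray, divTensor, vel_apply, rot_apply, hI, Sum.elim_inr,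
      Pi.star_apply, RCLike.star_def, map_sum, map_mul, map_inv₀,
      Complex.conj_ofReal, Complex.conj_I, norm_neg, PiLp.neg_apply, Complex.ofReal_neg, map_neg,
      neg_mul, mul_neg, neg_neg]

theorem quad_longitudinal (w : E3 → Vec) (ξ : E3) :
    ∑ i : Fin 3, (ξ i : ℂ) * quad w ξ (.inl i) = 0 := by
  by_cases hξ : ξ = 0
  · simp [hξ]
  have hx : ((‖ξ‖ ^ 2 : ℝ) : ℂ) ≠ 0 := by
    simpa using hξ
  have hx2 : ((‖ξ‖ ^ 2 : ℝ) : ℂ) = (ξ 0 : ℂ) ^ 2 + (ξ 1 : ℂ) ^ 2 + (ξ 2 : ℂ) ^ 2 := by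
    rw [norm_sq_eq]; push_cast; ring
  simp only [quad, nonlin, join, leray, Sum.elim_inl, Fin.sum_univ_three]
  field_simp
  rw [hx2]
  ring

/-! ### The heat kernel in time, uniformly in the frequency -/

/-- The multiplier `ρ^{2/q} e^{-sρ²/2}`, cut off to `s ≥ 0`. For `ρ > 0` its norm in `L^q(ds)` does
not depend on `ρ`. -/
def heatKer (q ρ s : ℝ) : ℝ≥0∞ :=
  if 0 ≤ s then ENNReal.ofReal (ρ ^ (2 / q) * Real.exp (-(s * ρ ^ 2 / 2))) else 0

theorem measurable_heatKer (q : ℝ) : Measurable fun p : ℝ × ℝ => heatKer q p.1 p.2 := by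
  unfold heatKer
  refine Measurable.ite (measurableSet_le measurable_const measurable_snd) ?_ measurable_const
  exact ((measurable_fst.pow_const _).mul (by fun_prop)).ennreal_ofReal

theorem lintegral_exp_neg_mul_Ici {c : ℝ} (hc : 0 < c) :
    ∫⁻ s in Ici (0 : ℝ), ENNReal.ofReal (Real.exp (-(c * s))) = ENNReal.ofReal (1 / c) := by
  have h1 : IntegrableOn (fun s : ℝ => Real.exp (-c * s)) (Ioi 0) :=
    integrableOn_exp_mul_Ioi (by linarith) 0
  have h2 := integral_exp_mul_Ioi (a := -c) (by linarith) 0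
  rw [setLIntegral_congr Ioi_ae_eq_Ici.symm, ← ofReal_integral_eq_lintegral_ofReal]
  · congr 1
    simp only [← neg_mul]
    rw [h2]; simp [neg_div_neg_eq]
  · simpa [IntegrableOn] using h1
  · exact ae_of_all _ fun _ => (Real.exp_pos _).le

theorem lintegral_heatKer_rpow_le {q ρ : ℝ} (hq : 1 ≤ q) (hρ : 0 ≤ ρ) (σ : ℝ) :
    ∫⁻ t, heatKer q ρ (t - σ) ^ q ≤ 2 := by
  have hq0 : 0 < q := by linarith
  rw [lintegral_sub_right_eq_self (fun t => heatKer q ρ t ^ q) σ]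
  rcases hρ.eq_or_lt with rfl | hρ
  · have : ∀ t, heatKer q 0 t ^ q = 0 := by
      intro t
      rw [heatKer, Real.zero_rpow (by positivity)]
      simp [hq0]
    simp [this]
  have e : ∀ t, heatKer q ρ t ^ q = (Ici (0 : ℝ)).indicator
      (fun t => ENNReal.ofReal (ρ ^ 2) * ENNReal.ofReal (Real.exp (-(q * ρ ^ 2 / 2 * t)))) t := by
    intro t
    by_cases ht : 0 ≤ t
    · rw [heatKer, if_pos ht, indicator_of_mem (mem_Ici.2 ht),
        ENNReal.ofReal_rpow_of_nonneg (by positivity) hq0.le, ← ENNReal.ofReal_mul (by positivity),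
        Real.mul_rpow (by positivity) (by positivity), ← Real.rpow_mul hρ.le, ← Real.exp_mul,
        div_mul_cancel₀ _ hq0.ne', Real.rpow_two]
      ring_nf
    · rw [heatKer, if_neg ht, indicator_of_notMem (by simpa using ht), ENNReal.zero_rpow_of_pos hq0]
  simp only [e]
  rw [lintegral_indicator measurableSet_Ici, lintegral_const_mul _ (by fun_prop),
    lintegral_exp_neg_mul_Ici (by positivity), ← ENNReal.ofReal_mul (by positivity)]
  rw [show (2 : ℝ≥0∞) = ENNReal.ofReal 2 by simp]
  refine ENNReal.ofReal_le_ofReal ?_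
  have : ρ ^ 2 * (1 / (q * ρ ^ 2 / 2)) = 2 / q := by field_simp
  rw [this, div_le_iff₀ hq0]
  linarith

/-- Jensen's inequality for a measure of arbitrary mass. -/
theorem rpow_lintegral_le {X : Type*} [MeasurableSpace X] (μ : Measure X) {q : ℝ} (hq : 1 < q)
    {f : X → ℝ≥0∞} (hf : AEMeasurable f μ) :
    (∫⁻ x, f x ∂μ) ^ q ≤ (∫⁻ x, f x ^ q ∂μ) * μ univ ^ (q - 1) := by
  have hq0 : 0 < q := by linarith
  have hc := Real.HolderConjugate.conjExponent hq
  have h := ENNReal.lintegral_mul_le_Lp_mul_Lq μ hc hf (g := fun _ => 1) aemeasurable_const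
  simp only [Pi.mul_apply, mul_one, ENNReal.one_rpow, lintegral_one] at h
  calc _ ≤ ((∫⁻ x, f x ^ q ∂μ) ^ (1 / q) * μ univ ^ (1 / q.conjExponent)) ^ q := by gcongr
    _ = _ := by
      rw [ENNReal.mul_rpow_of_nonneg _ _ hq0.le, ← ENNReal.rpow_mul, ← ENNReal.rpow_mul,
        one_div_mul_cancel hq0.ne', ENNReal.rpow_one]
      congr 2
      rw [Real.conjExponent]
      field_simp

/-- Convolution in time with the heat kernel maps `L¹` to `L^q`, for all frequencies at once. -/
theorem lintegral_rpow_heatKer_le {X : Type*} [MeasurableSpace X] (m : Measure X) [SFinite m]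
    {q : ℝ} (hq : 1 < q) {ρ σ : X → ℝ} {h : X → ℝ≥0∞} (hρ : Measurable ρ) (hρ0 : ∀ x, 0 ≤ ρ x)
    (hσ : Measurable σ) (hh : Measurable h) :
    ∫⁻ t, (∫⁻ x, heatKer q (ρ x) (t - σ x) * h x ∂m) ^ q ≤ 2 * (∫⁻ x, h x ∂m) ^ q := by
  have hq0 : 0 < q := by linarith
  have hk : Measurable fun z : ℝ × X => heatKer q (ρ z.2) (z.1 - σ z.2) :=
    (measurable_heatKer q).comp
      ((hρ.comp measurable_snd).prodMk (measurable_fst.sub (hσ.comp measurable_snd)))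
  have hkt : ∀ t, Measurable fun x => heatKer q (ρ x) (t - σ x) := fun t =>
    hk.comp (measurable_const.prodMk measurable_id)
  -- Jensen for the measure `h m` brings the power inside, and after the exchange of the
  -- integrals the norm of the kernel in `L^q(dt)` is bounded for every `x` separately.
  set μ := m.withDensity h with hμ
  have e : ∀ t, ∫⁻ x, heatKer q (ρ x) (t - σ x) * h x ∂m
      = ∫⁻ x, heatKer q (ρ x) (t - σ x) ∂μ := by
    intro t
    rw [hμ, lintegral_withDensity_eq_lintegral_mul _ hh (hkt t)]
    simp [mul_comm]
  have hu : μ univ = ∫⁻ x, h x ∂m := by simp [hμ]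
  simp only [e]
  calc _ ≤ ∫⁻ t, (∫⁻ x, heatKer q (ρ x) (t - σ x) ^ q ∂μ) * μ univ ^ (q - 1) :=
        lintegral_mono fun t => rpow_lintegral_le μ hq (hkt t).aemeasurable
    _ = (∫⁻ t, ∫⁻ x, heatKer q (ρ x) (t - σ x) ^ q ∂μ) * μ univ ^ (q - 1) := by
        rw [lintegral_mul_const]
        exact (hk.pow_const q).lintegral_prod_right'
    _ = (∫⁻ x, (∫⁻ t : ℝ, heatKer q (ρ x) (t - σ x) ^ q) ∂μ) * μ univ ^ (q - 1) := by
        rw [lintegral_lintegral_swap (hk.pow_const q).aemeasurable]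
    _ ≤ (∫⁻ _, 2 ∂μ) * μ univ ^ (q - 1) := by
        gcongr with x
        exact lintegral_heatKer_rpow_le hq.le (hρ0 x) _
    _ = 2 * μ univ ^ q := by
        rw [lintegral_const, mul_assoc]
        congr 1
        conv_lhs => enter [1]; rw [← ENNReal.rpow_one (μ univ)]
        rw [← ENNReal.rpow_add_of_nonneg _ _ zero_le_one (by linarith)]
        congr 1; ring
    _ = _ := by rw [hu]

/-! ### The norm of `L²_t L¹_ξ` -/

/-- The norm of `L²(I; L¹(ℝ³))` of a function of time and frequency. -/
def mixNorm (I : Set ℝ) (h : ℝ → E3 → ℝ≥0∞) : ℝ≥0∞ :=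
  (∫⁻ t in I, (∫⁻ ξ, h t ξ) ^ (2 : ℝ)) ^ (1 / 2 : ℝ)

/-- The norm of `w` in `L²(I; L¹(ℝ³))`. -/
def wNorm (I : Set ℝ) (w : ℝ → E3 → Vec) : ℝ≥0∞ := mixNorm I fun t ξ => ‖w t ξ‖ₑ

theorem mixNorm_rpow_two (I : Set ℝ) (h : ℝ → E3 → ℝ≥0∞) :
    mixNorm I h ^ (2 : ℝ) = ∫⁻ t in I, (∫⁻ ξ, h t ξ) ^ (2 : ℝ) := by
  rw [mixNorm, ← ENNReal.rpow_mul]; norm_num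

theorem mixNorm_mono_ae {I : Set ℝ} {h h' : ℝ → E3 → ℝ≥0∞}
    (hle : ∀ᵐ t ∂(volume.restrict I), ∀ᵐ ξ, h t ξ ≤ h' t ξ) : mixNorm I h ≤ mixNorm I h' := by
  unfold mixNorm
  refine ENNReal.rpow_le_rpow (lintegral_mono_ae ?_) (by norm_num)
  filter_upwards [hle] with t ht
  exact ENNReal.rpow_le_rpow (lintegral_mono_ae ht) (by norm_num)

theorem mixNorm_mono {I : Set ℝ} {h h' : ℝ → E3 → ℝ≥0∞} (hle : ∀ t ξ, h t ξ ≤ h' t ξ) :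
    mixNorm I h ≤ mixNorm I h' :=
  mixNorm_mono_ae (ae_of_all _ fun t => ae_of_all _ fun ξ => hle t ξ)

theorem mixNorm_mono_set {I J : Set ℝ} (hIJ : I ⊆ J) (h : ℝ → E3 → ℝ≥0∞) :
    mixNorm I h ≤ mixNorm J h :=
  ENNReal.rpow_le_rpow (lintegral_mono_set hIJ) (by norm_num)

theorem mixNorm_add_le (I : Set ℝ) {h h' : ℝ → E3 → ℝ≥0∞}
    (hm : Measurable (Function.uncurry h)) (hm' : Measurable (Function.uncurry h')) :
    mixNorm I (fun t ξ => h t ξ + h' t ξ) ≤ mixNorm I h + mixNorm I h' := by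
  have := ENNReal.lintegral_Lp_add_le (μ := volume.restrict I) (p := 2)
    (f := fun t => ∫⁻ ξ, h t ξ) (g := fun t => ∫⁻ ξ, h' t ξ)
    (hm.lintegral_prod_right').aemeasurable (hm'.lintegral_prod_right').aemeasurable (by norm_num)
  unfold mixNorm
  refine le_trans (le_of_eq ?_) this
  congr 1
  refine lintegral_congr fun t => ?_
  rw [lintegral_add_left hm.of_uncurry_left]
  rfl

theorem mixNorm_const_mul (I : Set ℝ) {h : ℝ → E3 → ℝ≥0∞} (hm : Measurable (Function.uncurry h))
    (c : ℝ≥0∞) : mixNorm I (fun t ξ => c * h t ξ) = c * mixNorm I h := by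
  unfold mixNorm
  have : ∀ t, ∫⁻ ξ, c * h t ξ = c * ∫⁻ ξ, h t ξ := fun t =>
    lintegral_const_mul _ hm.of_uncurry_left
  have hM : Measurable fun t => ∫⁻ ξ, h t ξ := Measurable.lintegral_prod_right' hm
  simp only [this, ENNReal.mul_rpow_of_nonneg _ _ (zero_le_two : (0 : ℝ) ≤ 2)]
  rw [lintegral_const_mul _ (hM.pow_const _),
    ENNReal.mul_rpow_of_nonneg _ _ (by norm_num), ← ENNReal.rpow_mul]
  norm_num

theorem mixNorm_tsum_le (I : Set ℝ) {h : ℕ → ℝ → E3 → ℝ≥0∞}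
    (hm : ∀ n, Measurable (Function.uncurry (h n))) :
    mixNorm I (fun t ξ => ∑' n, h n t ξ) ≤ ∑' n, mixNorm I (h n) := by
  have hfin : ∀ m, mixNorm I (fun t ξ => ∑ n ∈ Finset.range m, h n t ξ) ≤ ∑' n, mixNorm I (h n) := by
    intro m
    refine le_trans ?_ (ENNReal.sum_le_tsum (Finset.range m))
    induction m with
    | zero => simp [mixNorm]
    | succ m ih =>
      simp only [Finset.sum_range_succ]
      have hs : Measurable (Function.uncurry fun t ξ => ∑ n ∈ Finset.range m, h n t ξ) :=
        Finset.measurable_fun_sum _ fun n _ => hm n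
      exact (mixNorm_add_le I hs (hm m)).trans (by gcongr)
  have hpow : Monotone fun x : ℝ≥0∞ => x ^ (2 : ℝ) := fun a b hab =>
    ENNReal.rpow_le_rpow hab (by norm_num)
  have hmono : ∀ t, Monotone fun m => ∫⁻ ξ, ∑ n ∈ Finset.range m, h n t ξ := fun t a b hab =>
    lintegral_mono fun ξ => Finset.sum_le_sum_of_subset (Finset.range_mono hab)
  have e : ∀ t, (∫⁻ ξ, ∑' n, h n t ξ) ^ (2 : ℝ) =
      ⨆ m, (∫⁻ ξ, ∑ n ∈ Finset.range m, h n t ξ) ^ (2 : ℝ) := by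
    intro t
    simp only [ENNReal.tsum_eq_iSup_nat]
    rw [lintegral_iSup]
    · exact hpow.map_iSup_of_continuousAt ENNReal.continuous_rpow_const.continuousAt (by simp)
    · exact fun m => Finset.measurable_fun_sum _ fun n _ => (hm n).of_uncurry_left
    · exact fun a b hab ξ => Finset.sum_le_sum_of_subset (Finset.range_mono hab)
  have h2 : mixNorm I (fun t ξ => ∑' n, h n t ξ) ^ (2 : ℝ) ≤ (∑' n, mixNorm I (h n)) ^ (2 : ℝ) := by
    rw [mixNorm_rpow_two]
    simp only [e]
    rw [lintegral_iSup]
    · refine iSup_le fun m => ?_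
      rw [← mixNorm_rpow_two]
      exact ENNReal.rpow_le_rpow (hfin m) (by norm_num)
    · intro m
      have hs : Measurable (Function.uncurry fun t ξ => ∑ n ∈ Finset.range m, h n t ξ) :=
        Finset.measurable_fun_sum _ fun n _ => hm n
      exact (Measurable.lintegral_prod_right' hs).pow_const _
    · exact fun a b hab t => hpow (hmono t hab)
  exact (ENNReal.rpow_le_rpow_iff (by norm_num)).1 h2

theorem lintegral_mul_le_mixNorm (I : Set ℝ) {h h' : ℝ → E3 → ℝ≥0∞}
    (hm : Measurable (Function.uncurry h)) (hm' : Measurable (Function.uncurry h')) :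
    ∫⁻ t in I, (∫⁻ ξ, h t ξ) * ∫⁻ ξ, h' t ξ ≤ mixNorm I h * mixNorm I h' :=
  ENNReal.lintegral_mul_le_Lp_mul_Lq (volume.restrict I) Real.HolderConjugate.two_two
    (Measurable.lintegral_prod_right' hm).aemeasurable
    (Measurable.lintegral_prod_right' hm').aemeasurable

theorem ae_lt_top_of_mixNorm {I : Set ℝ} {h : ℝ → E3 → ℝ≥0∞} (hm : Measurable (Function.uncurry h))
    (hf : mixNorm I h < ∞) : ∀ᵐ t ∂(volume.restrict I), ∫⁻ ξ, h t ξ < ∞ := by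
  have h2 : ∫⁻ t in I, (∫⁻ ξ, h t ξ) ^ (2 : ℝ) ≠ ∞ := by
    rw [← mixNorm_rpow_two]
    exact ENNReal.rpow_ne_top_of_nonneg (by norm_num) hf.ne
  have := ae_lt_top ((Measurable.lintegral_prod_right' hm).pow_const _) h2
  filter_upwards [this] with t ht
  exact (ENNReal.rpow_lt_top_iff_of_pos (by norm_num)).1 ht

/-! ### The Duhamel term -/

/-- The Duhamel term `∫₀ᵗ G(t-τ) (𝐏∇·(u ⊗ u), ∇·(u ⊗ ω))(τ) dτ` on the Fourier side. -/
def duhamel (w : ℝ → E3 → Vec) (t : ℝ) (ξ : E3) : Vec :=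
  ∫ τ in (0 : ℝ)..t, (symG (t - τ) ξ).mulVec (quad (w τ) ξ)

/-- The convolutions that control the difference of the quadratic terms of `w` and `w'`. -/
def lipConv (w w' : ℝ → E3 → Vec) (τ : ℝ) (ξ : E3) : ℝ≥0∞ :=
  absConv (w τ) (w τ - w' τ) ξ + absConv (w τ - w' τ) (w' τ) ξ

/-- The frequencies at which the Duhamel term converges absolutely at all times. -/
def IsGoodFreq (w : ℝ → E3 → Vec) (ξ : E3) : Prop :=
  ∫⁻ τ in Ioi (0 : ℝ), absConv (w τ) (w τ) ξ < ∞

theorem continuous_mulVec_uncurry : Continuous fun p :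
    Matrix (Fin 3 ⊕ Fin 3) (Fin 3 ⊕ Fin 3) ℂ × Vec => p.1.mulVec p.2 :=
  continuous_fst.matrix_mulVec continuous_snd

theorem measurable_symG_mulVec {X : Type*} [MeasurableSpace X] {t : X → ℝ} {ξ : X → E3}
    {v : X → Vec} (ht : Measurable t) (hξ : Measurable ξ) (hv : Measurable v) :
    Measurable fun x => (symG (t x) (ξ x)).mulVec (v x) := by
  have hG : ∀ i j, Measurable fun x => symG (t x) (ξ x) i j := fun i j =>
    ((continuous_symG.matrix_elem i j).measurable).comp (ht.prodMk hξ)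
  refine measurable_pi_iff.2 fun i => ?_
  simp only [Matrix.mulVec, dotProduct]
  exact Finset.measurable_fun_sum _ fun j _ => (hG i j).mul ((measurable_pi_apply j).comp hv)

theorem measurable_duhamel {w : ℝ → E3 → Vec} (hw : Measurable (Function.uncurry w)) :
    Measurable fun p : ℝ × E3 => duhamel w p.1 p.2 := by
  have hF : Measurable fun z : (ℝ × E3) × ℝ =>
      (symG (z.1.1 - z.2) z.1.2).mulVec (quad (w z.2) z.1.2) := by
    refine measurable_symG_mulVec (by fun_prop) (by fun_prop) ?_
    exact (measurable_quad hw).comp (f := fun z : (ℝ × E3) × ℝ => (z.2, z.1.2)) (by fun_prop)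
  have key : ∀ a b : ℝ × E3 → ℝ, Measurable a → Measurable b →
      Measurable fun p : ℝ × E3 => ∫ τ in Ioc (a p) (b p),
        (symG (p.1 - τ) p.2).mulVec (quad (w τ) p.2) := by
    intro a b ha hb
    have : ∀ p : ℝ × E3, ∫ τ in Ioc (a p) (b p), (symG (p.1 - τ) p.2).mulVec (quad (w τ) p.2) =
        ∫ τ, {z : (ℝ × E3) × ℝ | a z.1 < z.2 ∧ z.2 ≤ b z.1}.indicator (fun z =>
          (symG (z.1.1 - z.2) z.1.2).mulVec (quad (w z.2) z.1.2)) (p, τ) := by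
      intro p
      rw [← integral_indicator measurableSet_Ioc]
      rfl
    simp only [this]
    refine (StronglyMeasurable.integral_prod_right' ?_).measurable
    refine (hF.indicator ?_).stronglyMeasurable
    exact (measurableSet_lt (ha.comp measurable_fst) measurable_snd).inter
      (measurableSet_le measurable_snd (hb.comp measurable_fst))
  unfold duhamel intervalIntegral
  exact (key _ _ measurable_const measurable_fst).sub (key _ _ measurable_fst measurable_const)

section
variable {w w' : ℝ → E3 → Vec}

theorem measurable_uncurry_sub (hw : Measurable (Function.uncurry w))
    (hw' : Measurable (Function.uncurry w')) : Measurable (Function.uncurry (w - w')) := hw.sub hw'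

theorem measurable_absConv_time (hw : Measurable (Function.uncurry w))
    (hw' : Measurable (Function.uncurry w')) (ξ : E3) :
    Measurable fun τ => absConv (w τ) (w' τ) ξ :=
  Measurable.comp (g := fun p : ℝ × E3 => absConv (w p.1) (w' p.1) p.2) (f := fun τ => (τ, ξ))
    (measurable_absConv hw hw') (measurable_id.prodMk measurable_const)

theorem measurable_absConv_freq (hw : Measurable (Function.uncurry w))
    (hw' : Measurable (Function.uncurry w')) (τ : ℝ) :
    Measurable fun ξ => absConv (w τ) (w' τ) ξ :=
  Measurable.comp (g := fun p : ℝ × E3 => absConv (w p.1) (w' p.1) p.2) (f := fun ξ => (τ, ξ))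
    (measurable_absConv hw hw') (measurable_const.prodMk measurable_id)

theorem measurable_quad_time (hw : Measurable (Function.uncurry w)) (ξ : E3) :
    Measurable fun τ => quad (w τ) ξ :=
  Measurable.comp (g := fun p : ℝ × E3 => quad (w p.1) p.2) (f := fun τ => (τ, ξ))
    (measurable_quad hw) (measurable_id.prodMk measurable_const)

theorem measurable_lipConv (hw : Measurable (Function.uncurry w))
    (hw' : Measurable (Function.uncurry w')) :
    Measurable (Function.uncurry (lipConv w w')) := by
  obtain ⟨d, hd0⟩ : ∃ d : ℝ → E3 → Vec, d = w - w' := ⟨_, rfl⟩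
  have hd : Measurable (Function.uncurry d) := by rw [hd0]; exact hw.sub hw'
  have e : lipConv w w' = fun τ ξ => absConv (w τ) (d τ) ξ + absConv (d τ) (w' τ) ξ := by
    rw [hd0]; rfl
  rw [e]
  exact (measurable_absConv hw hd).add (measurable_absConv hd hw')

theorem measurable_lipConv_time (hw : Measurable (Function.uncurry w))
    (hw' : Measurable (Function.uncurry w')) (ξ : E3) : Measurable fun τ => lipConv w w' τ ξ :=
  Measurable.comp (g := Function.uncurry (lipConv w w')) (f := fun τ => (τ, ξ))
    (measurable_lipConv hw hw') (measurable_id.prodMk measurable_const)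

theorem lintegral_absConv_le (I : Set ℝ) (hw : Measurable (Function.uncurry w))
    (hw' : Measurable (Function.uncurry w')) :
    ∫⁻ τ in I, ∫⁻ ξ, absConv (w τ) (w' τ) ξ ≤ wNorm I w * wNorm I w' := by
  refine le_trans (le_of_eq ?_) (lintegral_mul_le_mixNorm I (h := fun t ξ => ‖w t ξ‖ₑ)
    (h' := fun t ξ => ‖w' t ξ‖ₑ) hw.enorm hw'.enorm)
  exact lintegral_congr fun τ => lintegral_absConv hw.of_uncurry_left hw'.of_uncurry_left

theorem lintegral_lipConv_le (I : Set ℝ) (hw : Measurable (Function.uncurry w))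
    (hw' : Measurable (Function.uncurry w')) :
    ∫⁻ τ in I, ∫⁻ ξ, lipConv w w' τ ξ ≤ wNorm I (w - w') * (wNorm I w + wNorm I w') := by
  set d : ℝ → E3 → Vec := w - w' with hd0
  have hd : Measurable (Function.uncurry d) := hw.sub hw'
  have e : ∀ τ, ∫⁻ ξ, lipConv w w' τ ξ = (∫⁻ ξ, absConv (w τ) (d τ) ξ) +
      ∫⁻ ξ, absConv (d τ) (w' τ) ξ := by
    intro τ
    exact lintegral_add_left (measurable_absConv_freq hw hd τ) _
  have hM : Measurable fun τ => ∫⁻ ξ, absConv (w τ) (d τ) ξ :=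
    Measurable.lintegral_prod_right' (measurable_absConv hw hd)
  simp only [e]
  rw [lintegral_add_left hM]
  calc _ ≤ wNorm I w * wNorm I d + wNorm I d * wNorm I w' :=
        add_le_add (lintegral_absConv_le I hw hd) (lintegral_absConv_le I hd hw')
    _ = _ := by ring

theorem ae_isGoodFreq (hw : Measurable (Function.uncurry w)) (hf : wNorm (Ioi 0) w < ∞) :
    ∀ᵐ ξ, IsGoodFreq w ξ := by
  have h := (lintegral_absConv_le (Ioi 0) hw hw).trans_lt (ENNReal.mul_lt_top hf hf)
  rw [lintegral_lintegral_swap (measurable_absConv hw hw).aemeasurable] at h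
  exact ae_lt_top (Measurable.lintegral_prod_left' (measurable_absConv hw hw)) h.ne

theorem IsGoodFreq.ae_lt_top {ξ : E3} (h : IsGoodFreq w ξ) (hw : Measurable (Function.uncurry w)) :
    ∀ᵐ τ ∂(volume.restrict (Ioi (0 : ℝ))), absConv (w τ) (w τ) ξ < ∞ :=
  MeasureTheory.ae_lt_top (measurable_absConv_time hw hw ξ) h.ne

theorem IsGoodFreq.lintegral_quad_lt_top {ξ : E3} (h : IsGoodFreq w ξ)
    (hw : Measurable (Function.uncurry w)) :
    ∫⁻ τ in Ioi (0 : ℝ), ‖quad (w τ) ξ‖ₑ < ∞ := by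
  have hm := measurable_absConv_time hw hw ξ
  calc _ ≤ ∫⁻ τ in Ioi (0 : ℝ), 12 * ‖ξ‖ₑ * absConv (w τ) (w τ) ξ := by
        refine lintegral_mono_ae ?_
        filter_upwards [h.ae_lt_top hw] with τ hτ
        exact enorm_quad_le hw.of_uncurry_left hτ
    _ = 12 * ‖ξ‖ₑ * ∫⁻ τ in Ioi (0 : ℝ), absConv (w τ) (w τ) ξ := lintegral_const_mul _ hm
    _ < ∞ := ENNReal.mul_lt_top (ENNReal.mul_lt_top (by simp) (by simp)) h

theorem enorm_symG_mulVec_le (ξ : E3) (v : Vec) {t : ℝ} (ht : 0 ≤ t) :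
    ‖(symG t ξ).mulVec v‖ₑ ≤ 3 * ENNReal.ofReal (Real.exp (-(t * ‖ξ‖ ^ 2 / 2))) * ‖v‖ₑ := by
  rw [← ofReal_norm, ← ofReal_norm, show (3 : ℝ≥0∞) = ENNReal.ofReal 3 by simp,
    ← ENNReal.ofReal_mul (by norm_num), ← ENNReal.ofReal_mul (by positivity)]
  exact ENNReal.ofReal_le_ofReal (norm_symG_mulVec_le ξ v ht)

theorem enorm_symG_mulVec_le' (ξ : E3) (v : Vec) {t : ℝ} (ht : 0 ≤ t) :
    ‖(symG t ξ).mulVec v‖ₑ ≤ 3 * ‖v‖ₑ := by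
  refine (enorm_symG_mulVec_le ξ v ht).trans ?_
  gcongr
  calc (3 : ℝ≥0∞) * ENNReal.ofReal (Real.exp (-(t * ‖ξ‖ ^ 2 / 2))) ≤ 3 * ENNReal.ofReal 1 := by
        gcongr
        rw [Real.exp_le_one_iff]
        have : 0 ≤ t * ‖ξ‖ ^ 2 / 2 := by positivity
        linarith
    _ = 3 := by simp

theorem IsGoodFreq.integrableOn_quad {ξ : E3} (h : IsGoodFreq w ξ)
    (hw : Measurable (Function.uncurry w)) : IntegrableOn (fun τ => quad (w τ) ξ) (Ioi 0) :=
  ⟨(measurable_quad_time hw ξ).aestronglyMeasurable,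
    h.lintegral_quad_lt_top hw⟩

theorem IsGoodFreq.intervalIntegrable {ξ : E3} (h : IsGoodFreq w ξ)
    (hw : Measurable (Function.uncurry w)) {t : ℝ} (ht : 0 ≤ t) :
    IntervalIntegrable (fun τ => (symG (t - τ) ξ).mulVec (quad (w τ) ξ)) volume 0 t := by
  rw [intervalIntegrable_iff_integrableOn_Ioc_of_le ht]
  refine ⟨(measurable_symG_mulVec (measurable_const.sub measurable_id) measurable_const
    (measurable_quad_time hw ξ)).aestronglyMeasurable, ?_⟩
  calc _ ≤ ∫⁻ τ in Ioc (0 : ℝ) t, 3 * ‖quad (w τ) ξ‖ₑ :=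
        setLIntegral_mono' measurableSet_Ioc fun τ hτ =>
          enorm_symG_mulVec_le' ξ _ (by linarith [hτ.2])
    _ = 3 * ∫⁻ τ in Ioc (0 : ℝ) t, ‖quad (w τ) ξ‖ₑ :=
        lintegral_const_mul _ (measurable_quad_time hw ξ).enorm
    _ ≤ 3 * ∫⁻ τ in Ioi (0 : ℝ), ‖quad (w τ) ξ‖ₑ := by
        gcongr
        exact Ioc_subset_Ioi_self
    _ < ∞ := ENNReal.mul_lt_top (by simp) (h.lintegral_quad_lt_top hw)

theorem IsGoodFreq.enorm_duhamel_sub_le {ξ : E3} (h : IsGoodFreq w ξ) (h' : IsGoodFreq w' ξ)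
    (hw : Measurable (Function.uncurry w)) (hw' : Measurable (Function.uncurry w')) {t : ℝ}
    (ht : 0 ≤ t) :
    ‖duhamel w t ξ - duhamel w' t ξ‖ₑ ≤
      ∫⁻ τ in Ioc 0 t, heatKer 2 ‖ξ‖ (t - τ) * (36 * lipConv w w' τ ξ) := by
  rw [duhamel, duhamel, ← intervalIntegral.integral_sub (h.intervalIntegrable hw ht)
    (h'.intervalIntegrable hw' ht), intervalIntegral.integral_of_le ht]
  refine (enorm_integral_le_lintegral_enorm _).trans (lintegral_mono_ae ?_)
  have hsub : Ioc 0 t ⊆ Ioi 0 := Ioc_subset_Ioi_self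
  filter_upwards [ae_restrict_of_ae_restrict_of_subset hsub (h.ae_lt_top hw),
    ae_restrict_of_ae_restrict_of_subset hsub (h'.ae_lt_top hw'),
    ae_restrict_mem measurableSet_Ioc] with τ h1 h2 hτ
  rw [← Matrix.mulVec_sub]
  have hs : 0 ≤ t - τ := by linarith [hτ.2]
  refine (enorm_symG_mulVec_le ξ _ hs).trans ?_
  rw [heatKer, if_pos hs, div_self two_ne_zero, Real.rpow_one, ENNReal.ofReal_mul (norm_nonneg _),
    ofReal_norm]
  calc _ ≤ 3 * ENNReal.ofReal (Real.exp (-((t - τ) * ‖ξ‖ ^ 2 / 2))) *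
        (12 * ‖ξ‖ₑ * lipConv w w' τ ξ) := by
        gcongr
        exact enorm_quad_sub_le hw.of_uncurry_left hw'.of_uncurry_left h1 h2
    _ = ‖ξ‖ₑ * ENNReal.ofReal (Real.exp (-((t - τ) * ‖ξ‖ ^ 2 / 2))) *
        (3 * 12 * lipConv w w' τ ξ) := by ring
    _ = _ := by norm_num

/-- The difference of two Duhamel terms in `L^q_t L¹_ξ` with the scaling-invariant weight
`|ξ|^{2/q-1}` and a further weight `ω`, which localizes to dyadic blocks. -/
theorem lintegral_duhamel_sub_rpow_le {I : Set ℝ} (hI : MeasurableSet I) (hI0 : I ⊆ Ioi 0)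
    (hI' : ∀ t ∈ I, Ioc 0 t ⊆ I)
    (hw : Measurable (Function.uncurry w)) (hw' : Measurable (Function.uncurry w'))
    (hf : wNorm (Ioi 0) w < ∞) (hf' : wNorm (Ioi 0) w' < ∞) {q : ℝ} (hq : 1 < q)
    {ω : E3 → ℝ≥0∞} (hω : Measurable ω) :
    ∫⁻ t in I, (∫⁻ ξ, ω ξ * (ENNReal.ofReal (‖ξ‖ ^ (2 / q - 1)) *
        ‖duhamel w t ξ - duhamel w' t ξ‖ₑ)) ^ q ≤
      2 * (36 * ∫⁻ τ in I, ∫⁻ ξ, ω ξ * lipConv w w' τ ξ) ^ q := by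
  set m : Measure (ℝ × E3) := (volume.restrict I).prod volume with hm
  have hlip := measurable_lipConv hw hw'
  have hh1 : Measurable fun x : ℝ × E3 => ω x.2 * lipConv w w' x.1 x.2 :=
    (hω.comp measurable_snd).mul hlip
  have hh := hh1.const_mul 36
  have key := lintegral_rpow_heatKer_le m hq (ρ := fun x => ‖x.2‖) (σ := Prod.fst)
    measurable_snd.norm (fun x => norm_nonneg _) measurable_fst hh
  have hk : ∀ t, Measurable fun x : ℝ × E3 => heatKer q ‖x.2‖ (t - x.1) := fun t =>
    (measurable_heatKer q).comp (measurable_snd.norm.prodMk (measurable_const.sub measurable_fst))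
  have hright : ∫⁻ x, 36 * (ω x.2 * lipConv w w' x.1 x.2) ∂m =
      36 * ∫⁻ τ in I, ∫⁻ ξ, ω ξ * lipConv w w' τ ξ := by
    rw [lintegral_const_mul _ hh1, hm, lintegral_prod _ hh1.aemeasurable]
  rw [hright] at key
  refine le_trans ?_ ((setLIntegral_le_lintegral I _).trans key)
  refine setLIntegral_mono' hI fun t ht => ENNReal.rpow_le_rpow ?_ (by linarith)
  have hkh : Measurable fun x : ℝ × E3 =>
      heatKer q ‖x.2‖ (t - x.1) * (36 * (ω x.2 * lipConv w w' x.1 x.2)) := (hk t).mul hh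
  rw [hm, lintegral_prod_symm _ hkh.aemeasurable]
  refine lintegral_mono_ae ?_
  have h0 : ∀ᵐ ξ : E3, ξ ≠ 0 := by
    simp [ae_iff]
  filter_upwards [ae_isGoodFreq hw hf, ae_isGoodFreq hw' hf', h0] with ξ h1 h2 hξ
  have hξ' : 0 < ‖ξ‖ := norm_pos_iff.2 hξ
  have hk2 : Measurable fun τ => heatKer 2 ‖ξ‖ (t - τ) * (36 * lipConv w w' τ ξ) :=
    ((measurable_heatKer 2).comp (measurable_const.prodMk (measurable_const.sub measurable_id))).mul
      ((measurable_lipConv_time hw hw' ξ).const_mul _)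
  -- the factor `|ξ|` in `heatKer 2` comes from the divergence in the quadratic term; together with the
  -- weight it is the power `|ξ|^{2/q}` that belongs to `L^q` in time
  have hkq : ∀ s, ENNReal.ofReal (‖ξ‖ ^ (2 / q - 1)) * heatKer 2 ‖ξ‖ s = heatKer q ‖ξ‖ s := by
    intro s
    unfold heatKer
    split_ifs
    · rw [← ENNReal.ofReal_mul (by positivity), ← mul_assoc, ← Real.rpow_add hξ']
      norm_num
    · simp
  calc _ ≤ ω ξ * (ENNReal.ofReal (‖ξ‖ ^ (2 / q - 1)) *
        ∫⁻ τ in I, heatKer 2 ‖ξ‖ (t - τ) * (36 * lipConv w w' τ ξ)) := by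
        gcongr
        exact (h1.enorm_duhamel_sub_le h2 hw hw' (mem_Ioi.1 (hI0 ht)).le).trans
          (lintegral_mono_set (hI' t ht))
    _ = ∫⁻ τ in I, ω ξ * (ENNReal.ofReal (‖ξ‖ ^ (2 / q - 1)) *
        (heatKer 2 ‖ξ‖ (t - τ) * (36 * lipConv w w' τ ξ))) := by
        rw [lintegral_const_mul _ (hk2.const_mul _), lintegral_const_mul _ hk2]
    _ = _ := by
        refine lintegral_congr fun τ => ?_
        rw [← hkq]
        ring

theorem wNorm_duhamel_sub_le_lintegral {I : Set ℝ} (hI : MeasurableSet I) (hI0 : I ⊆ Ioi 0)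
    (hI' : ∀ t ∈ I, Ioc 0 t ⊆ I)
    (hw : Measurable (Function.uncurry w)) (hw' : Measurable (Function.uncurry w'))
    (hf : wNorm (Ioi 0) w < ∞) (hf' : wNorm (Ioi 0) w' < ∞) :
    wNorm I (duhamel w - duhamel w') ≤ 72 * ∫⁻ τ in I, ∫⁻ ξ, lipConv w w' τ ξ := by
  have key := lintegral_duhamel_sub_rpow_le hI hI0 hI' hw hw' hf hf' one_lt_two
    (ω := fun _ => 1) measurable_const
  simp only [one_mul, div_self (two_ne_zero : (2 : ℝ) ≠ 0), sub_self, Real.rpow_zero,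
    ENNReal.ofReal_one] at key
  have h2 : wNorm I (duhamel w - duhamel w') ^ (2 : ℝ) ≤
      (72 * ∫⁻ τ in I, ∫⁻ ξ, lipConv w w' τ ξ) ^ (2 : ℝ) := by
    rw [wNorm, mixNorm_rpow_two]
    refine key.trans ?_
    calc _ ≤ (2 : ℝ≥0∞) ^ (2 : ℝ) * (36 * ∫⁻ τ in I, ∫⁻ ξ, lipConv w w' τ ξ) ^ (2 : ℝ) := by
          gcongr
          norm_num
      _ = _ := by
          rw [← ENNReal.mul_rpow_of_nonneg _ _ (by norm_num), ← mul_assoc]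
          norm_num
  exact (ENNReal.rpow_le_rpow_iff (by norm_num)).1 h2

/-- The bilinear estimate that closes the fixed point argument in `L²(I; L¹_ξ)`. -/
theorem wNorm_duhamel_sub_le {I : Set ℝ} (hI : MeasurableSet I) (hI0 : I ⊆ Ioi 0)
    (hI' : ∀ t ∈ I, Ioc 0 t ⊆ I)
    (hw : Measurable (Function.uncurry w)) (hw' : Measurable (Function.uncurry w'))
    (hf : wNorm (Ioi 0) w < ∞) (hf' : wNorm (Ioi 0) w' < ∞) :
    wNorm I (duhamel w - duhamel w') ≤ 72 * (wNorm I (w - w') * (wNorm I w + wNorm I w')) :=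
  (wNorm_duhamel_sub_le_lintegral hI hI0 hI' hw hw' hf hf').trans
    (by gcongr; exact lintegral_lipConv_le I hw hw')

theorem lipConv_zero_right (w : ℝ → E3 → Vec) (τ : ℝ) (ξ : E3) :
    lipConv w 0 τ ξ = absConv (w τ) (w τ) ξ := by
  simp [lipConv, absConv_zero_right]

@[simp] theorem duhamel_zero : duhamel 0 = 0 := by
  funext t ξ
  simp [duhamel]

@[simp] theorem wNorm_zero (I : Set ℝ) : wNorm I 0 = 0 := by simp [wNorm, mixNorm]

theorem wNorm_duhamel_le (hw : Measurable (Function.uncurry w)) (hf : wNorm (Ioi 0) w < ∞) :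
    wNorm (Ioi 0) (duhamel w) ≤ 72 * (wNorm (Ioi 0) w * wNorm (Ioi 0) w) := by
  simpa using wNorm_duhamel_sub_le (w' := 0) measurableSet_Ioi subset_rfl
    (fun t _ => Ioc_subset_Ioi_self) hw measurable_const hf (by simp)

/-- The difference of two Duhamel terms at a fixed frequency, uniformly in time. -/
theorem IsGoodFreq.enorm_duhamel_sub_le' {ξ : E3} (h : IsGoodFreq w ξ) (h' : IsGoodFreq w' ξ)
    (hw : Measurable (Function.uncurry w)) (hw' : Measurable (Function.uncurry w')) {t : ℝ}
    (ht : 0 ≤ t) :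
    ‖duhamel w t ξ - duhamel w' t ξ‖ₑ ≤
      ‖ξ‖ₑ * (36 * ∫⁻ τ in Ioi (0 : ℝ), lipConv w w' τ ξ) := by
  have hm := measurable_lipConv_time hw hw' ξ
  calc _ ≤ _ := h.enorm_duhamel_sub_le h' hw hw' ht
    _ ≤ ∫⁻ τ in Ioc 0 t, ‖ξ‖ₑ * (36 * lipConv w w' τ ξ) := by
        refine lintegral_mono fun τ => ?_
        gcongr
        unfold heatKer
        split_ifs with hs
        · rw [← ofReal_norm]
          refine ENNReal.ofReal_le_ofReal ?_
          rw [div_self two_ne_zero, Real.rpow_one]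
          refine mul_le_of_le_one_right (norm_nonneg _) (Real.exp_le_one_iff.2 ?_)
          have : 0 ≤ (t - τ) * ‖ξ‖ ^ 2 / 2 := by positivity
          linarith
        · exact zero_le
    _ ≤ ∫⁻ τ in Ioi (0 : ℝ), ‖ξ‖ₑ * (36 * lipConv w w' τ ξ) :=
        lintegral_mono_set Ioc_subset_Ioi_self
    _ = _ := by rw [lintegral_const_mul _ (hm.const_mul _), lintegral_const_mul _ hm]

theorem IsGoodFreq.continuousOn_duhamel {ξ : E3} (h : IsGoodFreq w ξ)
    (hw : Measurable (Function.uncurry w)) :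
    ContinuousOn (fun t => duhamel w t ξ) (Ici 0) := by
  set F : ℝ → Vec := fun τ => (symG (-τ) ξ).mulVec (quad (w τ) ξ) with hF
  have hG : Continuous fun t => symG t ξ :=
    continuous_symG.comp (continuous_id.prodMk continuous_const)
  have hm : AEStronglyMeasurable F volume :=
    (measurable_symG_mulVec measurable_id.neg measurable_const
      (measurable_quad_time hw ξ)).aestronglyMeasurable
  -- `G(t-τ) = G(t) G(-τ)`, so that the dependence on `t` comes out of the integral
  have hFi : ∀ T, 0 ≤ T → IntegrableOn F (Icc 0 T) := by
    intro T hT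
    have hb := IsCompact.exists_bound_of_continuousOn (isCompact_Icc (a := (0 : ℝ)) (b := T))
      (f := fun τ => (fun i j => symG (-τ) ξ i j : Fin 3 ⊕ Fin 3 → Vec)) (by
        have : Continuous fun τ => symG (-τ) ξ := hG.comp continuous_neg
        exact (continuous_pi fun i => continuous_pi fun j => this.matrix_elem i j).continuousOn)
    obtain ⟨C, hC⟩ := hb
    have hi : IntegrableOn (fun τ => quad (w τ) ξ) (Icc 0 T) := by
      rw [integrableOn_Icc_iff_integrableOn_Ioc]
      exact (h.integrableOn_quad hw).mono_set Ioc_subset_Ioi_self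
    refine Integrable.mono' (g := fun τ => 6 * C * ‖quad (w τ) ξ‖) (hi.norm.const_mul _)
      hm.restrict ?_
    filter_upwards [ae_restrict_mem measurableSet_Icc] with τ hτ
    have hC0 : 0 ≤ C := (norm_nonneg _).trans (hC τ hτ)
    rw [pi_norm_le_iff_of_nonneg (by positivity)]
    intro i
    change ‖∑ j, symG (-τ) ξ i j * quad (w τ) ξ j‖ ≤ _
    refine (norm_sum_le _ _).trans ?_
    calc _ ≤ ∑ _j : Fin 3 ⊕ Fin 3, C * ‖quad (w τ) ξ‖ := by
          refine Finset.sum_le_sum fun j _ => ?_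
          rw [norm_mul]
          gcongr
          · exact (norm_le_pi_norm (fun j => symG (-τ) ξ i j : Vec) j).trans
              ((norm_le_pi_norm (fun i j => symG (-τ) ξ i j : Fin 3 ⊕ Fin 3 → Vec) i).trans (hC τ hτ))
          · exact norm_le_pi_norm _ j
      _ = _ := by simp; ring
  have e : ∀ t, 0 ≤ t → duhamel w t ξ = (symG t ξ).mulVec (∫ τ in (0 : ℝ)..t, F τ) := by
    intro t ht
    have hii : IntervalIntegrable F volume 0 t :=
      (intervalIntegrable_iff_integrableOn_Icc_of_le ht).2 (hFi t ht)
    have := (Matrix.mulVecLin (symG t ξ)).toContinuousLinearMap.intervalIntegral_comp_comm hii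
    simp only [LinearMap.coe_toContinuousLinearMap', Matrix.mulVecLin_apply] at this
    rw [← this, duhamel]
    refine intervalIntegral.integral_congr fun τ _ => ?_
    simp only [hF]
    rw [Matrix.mulVec_mulVec, ← symG_add, sub_eq_add_neg]
  have hc : ContinuousOn (fun t => ∫ τ in (0 : ℝ)..t, F τ) (Ici 0) := by
    intro t ht
    have h1 := intervalIntegral.continuousOn_primitive_interval (a := 0) (b := t + 1) (μ := volume)
      (f := F) (by
        rw [uIcc_of_le (by linarith [mem_Ici.1 ht])]
        exact hFi _ (by linarith [mem_Ici.1 ht]))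
    rw [uIcc_of_le (by linarith [mem_Ici.1 ht])] at h1
    refine (h1 t ⟨ht, by linarith⟩).mono_of_mem_nhdsWithin ?_
    exact mem_nhdsWithin.2 ⟨Iio (t + 1), isOpen_Iio, by simp, fun x hx => ⟨hx.2, hx.1.le⟩⟩
  refine ContinuousOn.congr ?_ fun t ht => e t ht
  exact continuous_mulVec_uncurry.comp_continuousOn (hG.continuousOn.prodMk hc)

end

/-! ### Global solutions for small data and uniqueness -/

/-- The Fourier transform of the linear evolution of the datum with the Fourier transform `g`. -/
def linFlow (g : E3 → Vec) : ℝ → E3 → Vec := fun t ξ => (symG t ξ).mulVec (g ξ)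

/-- `w` is the Fourier transform of a mild solution in the class `L²(0,∞; L¹_ξ)`, normalized so
that the integral equation holds at every time and every frequency. -/
structure IsFourierSol (g : E3 → Vec) (w : ℝ → E3 → Vec) : Prop where
  measurable : Measurable (Function.uncurry w)
  finite : wNorm (Ioi 0) w < ∞
  eq : ∀ t, 0 ≤ t → ∀ ξ, w t ξ = linFlow g t ξ - duhamel w t ξ

theorem measurable_linFlow {g : E3 → Vec} (hg : Measurable g) :
    Measurable (Function.uncurry (linFlow g)) :=
  measurable_symG_mulVec measurable_fst measurable_snd (hg.comp measurable_snd)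

theorem measurable_uncurry_duhamel {w : ℝ → E3 → Vec} (hw : Measurable (Function.uncurry w)) :
    Measurable (Function.uncurry (duhamel w)) := measurable_duhamel hw

section
variable {w w' : ℝ → E3 → Vec} {I : Set ℝ}

theorem wNorm_add_le (hw : Measurable (Function.uncurry w))
    (hw' : Measurable (Function.uncurry w')) : wNorm I (w + w') ≤ wNorm I w + wNorm I w' :=
  (mixNorm_mono fun t ξ => enorm_add_le (w t ξ) (w' t ξ)).trans
    (mixNorm_add_le I (h := fun t ξ => ‖w t ξ‖ₑ) (h' := fun t ξ => ‖w' t ξ‖ₑ) hw.enorm hw'.enorm)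

theorem wNorm_sub_le (hw : Measurable (Function.uncurry w))
    (hw' : Measurable (Function.uncurry w')) : wNorm I (w - w') ≤ wNorm I w + wNorm I w' :=
  (mixNorm_mono fun t ξ => enorm_sub_le (a := w t ξ) (b := w' t ξ)).trans
    (mixNorm_add_le I (h := fun t ξ => ‖w t ξ‖ₑ) (h' := fun t ξ => ‖w' t ξ‖ₑ) hw.enorm hw'.enorm)

theorem wNorm_congr (h : ∀ᵐ t ∂(volume.restrict I), w t =ᵐ[volume] w' t) :
    wNorm I w = wNorm I w' := by
  refine le_antisymm (mixNorm_mono_ae ?_) (mixNorm_mono_ae ?_) <;>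
  · filter_upwards [h] with t ht
    filter_upwards [ht] with ξ hξ
    rw [hξ]

theorem wNorm_sub_comm (w w' : ℝ → E3 → Vec) : wNorm I (w - w') = wNorm I (w' - w) := by
  unfold wNorm
  congr 1
  funext t ξ
  exact enorm_sub_rev (w t ξ) (w' t ξ)

theorem ae_eq_of_wNorm_sub (hw : Measurable (Function.uncurry w))
    (hw' : Measurable (Function.uncurry w')) (h : wNorm I (w - w') = 0) :
    ∀ᵐ t ∂(volume.restrict I), w t =ᵐ[volume] w' t := by
  have hd : Measurable fun p : ℝ × E3 => ‖w p.1 p.2 - w' p.1 p.2‖ₑ := (hw.sub hw').enorm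
  have h2 : ∫⁻ t in I, (∫⁻ ξ, ‖w t ξ - w' t ξ‖ₑ) ^ (2 : ℝ) = 0 := by
    have := mixNorm_rpow_two I fun t ξ => ‖(w - w') t ξ‖ₑ
    rw [← wNorm, h, ENNReal.zero_rpow_of_pos (by norm_num)] at this
    exact this.symm
  have hM : Measurable fun t => ∫⁻ ξ, ‖w t ξ - w' t ξ‖ₑ := Measurable.lintegral_prod_right' hd
  rw [lintegral_eq_zero_iff (hM.pow_const _)] at h2
  filter_upwards [h2] with t ht
  have ht' : ∫⁻ ξ, ‖w t ξ - w' t ξ‖ₑ = 0 := by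
    simpa using ht
  have hdt : Measurable fun ξ => ‖w t ξ - w' t ξ‖ₑ :=
    (hw.of_uncurry_left.sub hw'.of_uncurry_left).enorm
  rw [lintegral_eq_zero_iff hdt] at ht'
  filter_upwards [ht'] with ξ hξ
  simpa [sub_eq_zero] using hξ

theorem duhamel_congr (h : ∀ᵐ τ ∂(volume.restrict (Ioi (0 : ℝ))), w τ =ᵐ[volume] w' τ) {t : ℝ}
    (ht : 0 ≤ t) (ξ : E3) : duhamel w t ξ = duhamel w' t ξ := by
  unfold duhamel
  rw [intervalIntegral.integral_of_le ht, intervalIntegral.integral_of_le ht]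
  refine integral_congr_ae ?_
  filter_upwards [ae_restrict_of_ae_restrict_of_subset Ioc_subset_Ioi_self h] with τ hτ
  rw [quad_congr hτ]

end

/-- A function that solves the integral equation almost everywhere is turned into a solution everywhere
by one application of the integral operator. -/
theorem IsFourierSol.of_ae {g : E3 → Vec} {w : ℝ → E3 → Vec} (hg : Measurable g)
    (hw : Measurable (Function.uncurry w)) (hf : wNorm (Ioi 0) w < ∞)
    (h : ∀ᵐ t ∂(volume.restrict (Ioi (0 : ℝ))), w t =ᵐ[volume] (linFlow g - duhamel w) t) :
    IsFourierSol g (linFlow g - duhamel w) where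
  measurable := (measurable_linFlow hg).sub (measurable_uncurry_duhamel hw)
  finite := by rwa [← wNorm_congr h]
  eq t ht ξ := by rw [← duhamel_congr h ht]; rfl

/-- Uniqueness in `L²(0,∞; L¹_ξ)`: the difference of two solutions vanishes on successive time
intervals of a length on which the `L²`-norms of both solutions are small. -/
theorem IsFourierSol.unique {g : E3 → Vec} {w w' : ℝ → E3 → Vec} (h : IsFourierSol g w)
    (h' : IsFourierSol g w') {t : ℝ} (ht : 0 ≤ t) : w t =ᵐ[volume] w' t := by
  have hw := h.measurable
  have hw' := h'.measurable
  have hdiff : ∀ t, 0 ≤ t → ∀ ξ, (w - w') t ξ = -(duhamel w - duhamel w') t ξ := by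
    intro t ht ξ
    simp only [Pi.sub_apply]
    rw [h.eq t ht, h'.eq t ht]
    abel
  have hnorm : ∀ I : Set ℝ, MeasurableSet I → I ⊆ Ioi 0 →
      wNorm I (w - w') = wNorm I (duhamel w - duhamel w') := by
    intro I hI hI0
    refine le_antisymm (mixNorm_mono_ae ?_) (mixNorm_mono_ae ?_) <;>
    · filter_upwards [ae_restrict_mem hI] with t ht
      refine ae_of_all _ fun ξ => ?_
      rw [hdiff t (mem_Ioi.1 (hI0 ht)).le, enorm_neg]
  have hfin : wNorm (Ioi 0) (w - w') < ∞ :=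
    (wNorm_sub_le hw hw').trans_lt (ENNReal.add_lt_top.2 ⟨h.finite, h'.finite⟩)
  -- an interval length on which both norms are small
  obtain ⟨δ, hδ0, hδ⟩ : ∃ δ : ℝ, 0 < δ ∧ ∀ a : ℝ, 0 ≤ a →
      wNorm (Ioo a (a + δ)) w + wNorm (Ioo a (a + δ)) w' ≤ 1 / 144 := by
    have key : ∀ v : ℝ → E3 → Vec, Measurable (Function.uncurry v) → wNorm (Ioi 0) v < ∞ →
        ∃ δ : ℝ, 0 < δ ∧ ∀ a : ℝ, 0 ≤ a → ∀ b, b ≤ a + δ → wNorm (Ioo a b) v ≤ 1 / 288 := by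
      intro v hv hvf
      have h2 : ∫⁻ t in Ioi 0, (∫⁻ ξ, ‖v t ξ‖ₑ) ^ (2 : ℝ) ≠ ∞ := by
        rw [← mixNorm_rpow_two]
        exact ENNReal.rpow_ne_top_of_nonneg (by norm_num) hvf.ne
      obtain ⟨δ, hδ, hs⟩ := exists_pos_setLIntegral_lt_of_measure_lt h2
        (ε := (1 / 288 : ℝ≥0∞) ^ (2 : ℝ)) (by simp)
      obtain ⟨δ', hδ', hlt⟩ : ∃ δ' : ℝ, 0 < δ' ∧ ENNReal.ofReal δ' < δ := by
        rcases eq_or_ne δ ∞ with rfl | hne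
        · exact ⟨1, one_pos, ENNReal.ofReal_lt_top⟩
        · refine ⟨δ.toReal / 2, half_pos (ENNReal.toReal_pos hδ.ne' hne), ?_⟩
          rw [ENNReal.ofReal_lt_iff_lt_toReal (by positivity) hne]
          exact half_lt_self (ENNReal.toReal_pos hδ.ne' hne)
      refine ⟨δ', hδ', fun a ha b hb => ?_⟩
      refine (ENNReal.rpow_le_rpow_iff (z := (2 : ℝ)) (by norm_num)).1 ?_
      rw [wNorm, mixNorm_rpow_two]
      have hsub : Ioo a b ⊆ Ioi 0 := fun x hx => lt_of_le_of_lt ha hx.1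
      have := hs (Ioo a b) (by
        refine (Measure.restrict_apply_le _ _).trans_lt ?_
        rw [Real.volume_Ioo]
        exact (ENNReal.ofReal_le_ofReal (by linarith)).trans_lt hlt)
      rw [Measure.restrict_restrict measurableSet_Ioo, inter_eq_left.2 hsub] at this
      exact this.le
    obtain ⟨δ₁, h₁, k₁⟩ := key w hw h.finite
    obtain ⟨δ₂, h₂, k₂⟩ := key w' hw' h'.finite
    refine ⟨min δ₁ δ₂, lt_min h₁ h₂, fun a ha => ?_⟩
    calc _ ≤ (1 / 288 : ℝ≥0∞) + 1 / 288 := by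
          refine add_le_add (k₁ a ha _ ?_) (k₂ a ha _ ?_)
          · linarith [min_le_left δ₁ δ₂]
          · linarith [min_le_right δ₁ δ₂]
      _ = 1 / 144 := by
          rw [← ENNReal.toReal_eq_toReal_iff' (by finiteness) (by finiteness),
            ENNReal.toReal_add (by finiteness) (by finiteness)]
          norm_num
  -- if the difference `D` vanishes up to the time `n δ`, then up to `(n + 1) δ` it obeys `D ≤ D / 2`
  have hstep : ∀ n : ℕ, wNorm (Ioo 0 (n * δ)) (w - w') = 0 := by
    intro n
    induction n with
    | zero => simp [wNorm, mixNorm]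
    | succ n ih =>
      set a : ℝ := n * δ with ha
      have ha0 : 0 ≤ a := by positivity
      have hb : ((n + 1 : ℕ) : ℝ) * δ = a + δ := by push_cast; ring
      rw [hb]
      set D := wNorm (Ioo 0 (a + δ)) (w - w') with hD
      have hDf : D < ∞ := (mixNorm_mono_set Ioo_subset_Ioi_self _).trans_lt hfin
      have hle : D ≤ 72 * ∫⁻ τ in Ioo 0 (a + δ), ∫⁻ ξ, lipConv w w' τ ξ := by
        rw [hD, hnorm _ measurableSet_Ioo Ioo_subset_Ioi_self]
        exact wNorm_duhamel_sub_le_lintegral measurableSet_Ioo Ioo_subset_Ioi_self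
          (fun t ht x hx => ⟨hx.1, hx.2.trans_lt ht.2⟩) hw hw' h.finite h'.finite
      have hsplit : ∫⁻ τ in Ioo 0 (a + δ), ∫⁻ ξ, lipConv w w' τ ξ ≤
          ∫⁻ τ in Ioo a (a + δ), ∫⁻ ξ, lipConv w w' τ ξ := by
        have hsub : (Ioo 0 (a + δ) : Set ℝ) ⊆ Ioc 0 a ∪ Ioo a (a + δ) := fun x hx => by
          rcases le_or_gt x a with hxa | hxa
          · exact Or.inl ⟨hx.1, hxa⟩
          · exact Or.inr ⟨hxa, hx.2⟩
        refine (lintegral_mono_set hsub).trans ((lintegral_union_le _ _ _).trans ?_)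
        have hz : ∫⁻ τ in Ioc 0 a, ∫⁻ ξ, lipConv w w' τ ξ = 0 := by
          rw [setLIntegral_congr Ioo_ae_eq_Ioc.symm]
          refine le_antisymm ((lintegral_lipConv_le _ hw hw').trans ?_) (zero_le)
          rw [ih, zero_mul]
        rw [hz, zero_add]
      have hhalf : D ≤ 72 * (D * (1 / 144)) := by
        refine (hle.trans (mul_le_mul_right (hsplit.trans (lintegral_lipConv_le _ hw hw')) 72)).trans ?_
        gcongr
        · exact mixNorm_mono_set (Ioo_subset_Ioo_left ha0) _
        · exact hδ a ha0
      have hr := ENNReal.toReal_mono (by finiteness) hhalf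
      rw [ENNReal.toReal_mul, ENNReal.toReal_mul] at hr
      norm_num at hr
      have h0 : 0 ≤ D.toReal := ENNReal.toReal_nonneg
      have : D.toReal = 0 := by linarith
      exact ((ENNReal.toReal_eq_zero_iff _).1 this).resolve_right hDf.ne
  have hzero : wNorm (Ioi 0) (w - w') = 0 := by
    have hae : ∀ᵐ t ∂(volume.restrict (Ioi (0 : ℝ))), w t =ᵐ[volume] w' t := by
      have hU : (Ioi (0 : ℝ)) ⊆ ⋃ n : ℕ, Ioo 0 (n * δ) := by
        intro x hx
        obtain ⟨n, hn⟩ := exists_nat_gt (x / δ)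
        exact mem_iUnion.2 ⟨n, hx, by rwa [div_lt_iff₀ hδ0] at hn⟩
      refine ae_restrict_of_ae_restrict_of_subset hU ?_
      rw [ae_restrict_iUnion_iff]
      exact fun n => ae_eq_of_wNorm_sub hw hw' (hstep n)
    have := wNorm_congr (w := w - w') (w' := 0) (I := Ioi 0) (by
      filter_upwards [hae] with t ht
      filter_upwards [ht] with ξ hξ
      simp [hξ])
    rw [this, wNorm_zero]
  have hlip : ∫⁻ τ in Ioi (0 : ℝ), ∫⁻ ξ, lipConv w w' τ ξ = 0 := by
    refine le_antisymm ((lintegral_lipConv_le _ hw hw').trans ?_) zero_le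
    rw [hzero, zero_mul]
  have hm := measurable_lipConv hw hw'
  have hM : Measurable fun ξ => ∫⁻ τ in Ioi (0 : ℝ), lipConv w w' τ ξ :=
    Measurable.lintegral_prod_left' hm
  rw [lintegral_lintegral_swap hm.aemeasurable, lintegral_eq_zero_iff hM] at hlip
  filter_upwards [hlip, ae_isGoodFreq hw h.finite, ae_isGoodFreq hw' h'.finite] with ξ h0 h1 h2
  have := h1.enorm_duhamel_sub_le' h2 hw hw' ht
  have h0' : ∫⁻ τ in Ioi (0 : ℝ), lipConv w w' τ ξ = 0 := h0
  rw [h0', mul_zero, mul_zero, nonpos_iff_eq_zero] at this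
  have h3 := hdiff t ht ξ
  rw [Pi.sub_apply, Pi.sub_apply, Pi.sub_apply, Pi.sub_apply, enorm_eq_zero.1 this, neg_zero] at h3
  exact sub_eq_zero.1 h3

/-- Picard iteration in `L²(0,∞; L¹_ξ)`. -/
theorem exists_isFourierSol {g : E3 → Vec} (hg : Measurable g) {δ : ℝ≥0∞}
    (hδ : wNorm (Ioi 0) (linFlow g) ≤ δ) (hδ' : δ ≤ 1 / 800) :
    ∃ w, IsFourierSol g w ∧ wNorm (Ioi 0) w ≤ 3 * δ := by
  have hδf : δ < ∞ := hδ'.trans_lt (by finiteness)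
  set L := linFlow g with hL
  have hLm : Measurable (Function.uncurry L) := measurable_linFlow hg
  -- the Picard iterates
  set W : ℕ → ℝ → E3 → Vec := fun n => (fun v => L - duhamel v)^[n] L with hW
  have hW0 : W 0 = L := rfl
  have hWs : ∀ n, W (n + 1) = L - duhamel (W n) := fun n => by
    simp only [hW, Function.iterate_succ_apply']
  have hWm : ∀ n, Measurable (Function.uncurry (W n)) := by
    intro n
    induction n with
    | zero => exact hLm
    | succ n ih => rw [hWs]; exact hLm.sub (measurable_uncurry_duhamel ih)
  have hreal : ∀ {c x : ℝ≥0∞} {k : ℝ}, 0 ≤ k → c = ENNReal.ofReal k → k * (1 / 800) ≤ 1 →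
      c * δ * x ≤ x := by
    intro c x k hk hc hk1
    calc c * δ * x ≤ 1 * x := by
          gcongr
          calc c * δ ≤ c * (1 / 800) := by gcongr
            _ = ENNReal.ofReal (k * (1 / 800)) := by
              rw [hc, ENNReal.ofReal_mul hk]; congr 1
              rw [ENNReal.ofReal_div_of_pos (by norm_num)]; simp
            _ ≤ ENNReal.ofReal 1 := ENNReal.ofReal_le_ofReal hk1
            _ = 1 := by simp
      _ = x := one_mul x
  have hWb : ∀ n, wNorm (Ioi 0) (W n) ≤ 2 * δ := by
    intro n
    induction n with
    | zero => exact hδ.trans (by rw [two_mul]; exact le_self_add)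
    | succ n ih =>
      rw [hWs]
      refine (wNorm_sub_le hLm (measurable_uncurry_duhamel (hWm n))).trans ?_
      rw [two_mul]
      refine add_le_add hδ ((wNorm_duhamel_le (hWm n)
        (ih.trans_lt (ENNReal.mul_lt_top (by simp) hδf))).trans ?_)
      calc 72 * (wNorm (Ioi 0) (W n) * wNorm (Ioi 0) (W n)) ≤ 72 * (2 * δ * (2 * δ)) := by gcongr
        _ = 288 * δ * δ := by ring
        _ ≤ δ := hreal (k := 288) (by norm_num) (by simp) (by norm_num)
  have hWf : ∀ n, wNorm (Ioi 0) (W n) < ∞ := fun n =>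
    (hWb n).trans_lt (ENNReal.mul_lt_top (by simp) hδf)
  set d : ℕ → ℝ → E3 → ℝ≥0∞ := fun n t ξ => ‖(W (n + 1) - W n) t ξ‖ₑ with hd
  have hdm : ∀ n, Measurable (Function.uncurry (d n)) := fun n => ((hWm (n + 1)).sub (hWm n)).enorm
  have hdd : ∀ n, mixNorm (Ioi 0) (d n) = wNorm (Ioi 0) (W (n + 1) - W n) := fun n => rfl
  have hdb : ∀ n, mixNorm (Ioi 0) (d n) ≤ (2⁻¹ : ℝ≥0∞) ^ n * δ := by
    intro n
    induction n with
    | zero =>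
      rw [hdd, hWs 0, hW0, wNorm_sub_comm, sub_sub_cancel, pow_zero, one_mul]
      refine (wNorm_duhamel_le hLm (hδ.trans_lt hδf)).trans ?_
      calc 72 * (wNorm (Ioi 0) L * wNorm (Ioi 0) L) ≤ 72 * (δ * δ) := by gcongr
        _ = 72 * δ * δ := by ring
        _ ≤ δ := hreal (k := 72) (by norm_num) (by simp) (by norm_num)
    | succ n ih =>
      rw [hdd] at ih ⊢
      have e : W (n + 1 + 1) - W (n + 1) = duhamel (W n) - duhamel (W (n + 1)) := by
        rw [hWs (n + 1), hWs n, sub_sub_sub_cancel_left]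
      rw [e]
      refine (wNorm_duhamel_sub_le measurableSet_Ioi subset_rfl (fun t _ => Ioc_subset_Ioi_self)
        (hWm n) (hWm (n + 1)) (hWf n) (hWf (n + 1))).trans ?_
      rw [wNorm_sub_comm]
      calc _ ≤ 72 * ((2⁻¹ : ℝ≥0∞) ^ n * δ * (2 * δ + 2 * δ)) := by
            gcongr
            · exact hWb n
            · exact hWb (n + 1)
        _ = 288 * δ * ((2⁻¹ : ℝ≥0∞) ^ n * δ) := by ring
        _ = 2⁻¹ * (576 * δ * ((2⁻¹ : ℝ≥0∞) ^ n * δ)) := by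
            have h2 : (2⁻¹ : ℝ≥0∞) * 576 = 288 := by
              rw [show (576 : ℝ≥0∞) = 2 * 288 by norm_num, ← mul_assoc,
                ENNReal.inv_mul_cancel (by simp) (by simp), one_mul]
            rw [← h2]; ring
        _ ≤ 2⁻¹ * ((2⁻¹ : ℝ≥0∞) ^ n * δ) := by
            exact mul_le_mul_right (hreal (k := 576) (by norm_num) (by simp) (by norm_num)) _
        _ = _ := by rw [pow_succ]; ring
  have hgeom : ∀ n, ∑' k, mixNorm (Ioi 0) (d (n + k)) ≤ 2 * ((2⁻¹ : ℝ≥0∞) ^ n * δ) := by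
    intro n
    calc _ ≤ ∑' k, (2⁻¹ : ℝ≥0∞) ^ k * ((2⁻¹ : ℝ≥0∞) ^ n * δ) := by
          refine ENNReal.tsum_le_tsum fun k => (hdb _).trans (le_of_eq ?_)
          rw [pow_add]; ring
      _ = _ := by
          rw [ENNReal.tsum_mul_right, ENNReal.tsum_geometric, ENNReal.one_sub_inv_two, inv_inv]
  -- The iterates converge where the sum `S` of the increments is finite, that is almost everywhere.
  -- Elsewhere they are replaced by zero, which gives a measurable limit.
  set S : ℝ → E3 → ℝ≥0∞ := fun t ξ => ∑' n, d n t ξ with hS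
  have hSm : Measurable (Function.uncurry S) := Measurable.tsum hdm
  have hSf : ∀ᵐ t ∂(volume.restrict (Ioi (0 : ℝ))), ∀ᵐ ξ, S t ξ < ∞ := by
    have : mixNorm (Ioi 0) S < ∞ := by
      refine (mixNorm_tsum_le _ hdm).trans_lt ?_
      have := hgeom 0
      simp only [zero_add] at this
      exact this.trans_lt (by finiteness)
    filter_upwards [ae_lt_top_of_mixNorm hSm this] with t ht
    exact ae_lt_top hSm.of_uncurry_left ht.ne
  set V : ℕ → ℝ → E3 → Vec := fun n t ξ => if S t ξ < ∞ then W n t ξ else 0 with hV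
  have hVm : ∀ n, Measurable (Function.uncurry (V n)) := fun n =>
    Measurable.ite (hSm measurableSet_Iio) (hWm n) measurable_const
  have hlim : ∀ t ξ, ∃ v, Tendsto (fun n => V n t ξ) atTop (𝓝 v) := by
    intro t ξ
    by_cases hs : S t ξ < ∞
    · simp only [hV, if_pos hs]
      refine cauchySeq_tendsto_of_complete (cauchySeq_of_edist_le_of_tsum_ne_top (fun n => d n t ξ)
        (fun n => ?_) hs.ne)
      rw [edist_comm, edist_eq_enorm_sub]
      rfl
    · simp only [hV, if_neg hs]
      exact ⟨0, tendsto_const_nhds⟩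
  choose w hwlim using hlim
  have hwm : Measurable (Function.uncurry w) :=
    measurable_of_tendsto_metrizable hVm (tendsto_pi_nhds.2 fun p => hwlim p.1 p.2)
  have hwW : ∀ n, wNorm (Ioi 0) (w - W n) ≤ 2 * ((2⁻¹ : ℝ≥0∞) ^ n * δ) := by
    intro n
    refine le_trans ?_ ((mixNorm_tsum_le (Ioi 0) fun k => hdm (n + k)).trans (hgeom n))
    refine mixNorm_mono_ae ?_
    filter_upwards [hSf] with t ht
    filter_upwards [ht] with ξ hs
    have hl := hwlim t ξ
    simp only [hV, if_pos hs] at hl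
    have := edist_le_tsum_of_edist_le_of_tendsto (fun n => d n t ξ) (fun n => by
      rw [edist_comm, edist_eq_enorm_sub]; rfl) hl n
    rw [edist_comm, edist_eq_enorm_sub] at this
    exact this
  have hwb : wNorm (Ioi 0) w ≤ 3 * δ := by
    calc _ = wNorm (Ioi 0) (W 0 + (w - W 0)) := by rw [add_sub_cancel]
      _ ≤ _ := wNorm_add_le (hWm 0) (measurable_uncurry_sub hwm (hWm 0))
      _ ≤ δ + 2 * ((2⁻¹ : ℝ≥0∞) ^ 0 * δ) := add_le_add hδ (hwW 0)
      _ = 3 * δ := by ring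
  have hwf : wNorm (Ioi 0) w < ∞ := hwb.trans_lt (by finiteness)
  have hz : wNorm (Ioi 0) (w - (L - duhamel w)) = 0 := by
    have hb : ∀ n, wNorm (Ioi 0) (w - (L - duhamel w)) ≤ 4 * ((2⁻¹ : ℝ≥0∞) ^ n * δ) := by
      intro n
      have e : w - (L - duhamel w) = (w - W (n + 1)) + (duhamel w - duhamel (W n)) := by
        rw [hWs]; abel
      rw [e]
      refine (wNorm_add_le (measurable_uncurry_sub hwm (hWm _))
        (measurable_uncurry_sub (measurable_uncurry_duhamel hwm)
        (measurable_uncurry_duhamel (hWm n)))).trans ?_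
      calc _ ≤ 2 * ((2⁻¹ : ℝ≥0∞) ^ (n + 1) * δ) +
            72 * ((2 * ((2⁻¹ : ℝ≥0∞) ^ n * δ)) * (3 * δ + 2 * δ)) := by
            refine add_le_add (hwW (n + 1)) ((wNorm_duhamel_sub_le measurableSet_Ioi subset_rfl
              (fun t _ => Ioc_subset_Ioi_self) hwm (hWm n) hwf (hWf n)).trans ?_)
            gcongr
            · exact hwW n
            · exact hWb n
        _ ≤ 2 * ((2⁻¹ : ℝ≥0∞) ^ n * δ) + 2 * ((2⁻¹ : ℝ≥0∞) ^ n * δ) := by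
            gcongr ?_ + ?_
            · gcongr 2 * (?_ * δ)
              exact pow_le_pow_right_of_le_one' (by simp) (Nat.le_succ n)
            · calc _ = 360 * δ * (2 * ((2⁻¹ : ℝ≥0∞) ^ n * δ)) := by ring
                _ ≤ _ := hreal (k := 360) (by norm_num) (by simp) (by norm_num)
        _ = _ := by ring
    have ht : Tendsto (fun n : ℕ => 4 * ((2⁻¹ : ℝ≥0∞) ^ n * δ)) atTop (𝓝 0) := by
      have h1 : Tendsto (fun n : ℕ => (2⁻¹ : ℝ≥0∞) ^ n) atTop (𝓝 0) :=
        ENNReal.tendsto_pow_atTop_nhds_zero_of_lt_one (by simp)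
      have h2 := ENNReal.Tendsto.mul_const (b := δ) h1 (Or.inr hδf.ne)
      have h3 := ENNReal.Tendsto.const_mul (a := 4) h2 (Or.inr (by simp))
      simpa using h3
    exact le_antisymm (ge_of_tendsto' ht hb) zero_le
  have hae := ae_eq_of_wNorm_sub hwm (measurable_uncurry_sub hLm
    (measurable_uncurry_duhamel hwm)) hz
  refine ⟨L - duhamel w, IsFourierSol.of_ae hg hwm hwf hae, ?_⟩
  rwa [← wNorm_congr hae]

/-! ### Distributions and their Fourier densities -/

theorem HasFourierDensity.apply {u : VField} {g : E3 → C3} (h : HasFourierDensity u g)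
    (φ : 𝓢(E3, ℂ)) : u φ = ∫ ζ : E3, (𝓕⁻ φ) ζ • g ((2 * Real.pi) • ζ) := by
  rw [← h.fourier_eq (𝓕⁻ φ)]
  simp

theorem HasFourierDensity.sub {u v : VField} {g h : E3 → C3} (hu : HasFourierDensity u g)
    (hv : HasFourierDensity v h) : HasFourierDensity (u - v) (g - h) where
  locallyIntegrable := hu.locallyIntegrable.sub hv.locallyIntegrable
  integrable φ := by
    simpa [smul_sub] using! (hu.integrable φ).sub (hv.integrable φ)
  fourier_eq φ := by
    have e : (𝓕 (u - v) : VField) φ = (𝓕 u : VField) φ - (𝓕 v : VField) φ := rfl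
    rw [e, hu.fourier_eq, hv.fourier_eq, ← integral_sub (hu.integrable φ) (hv.integrable φ)]
    simp [smul_sub]

theorem HasFourierDensity.congr {u : VField} {g h : E3 → C3} (hu : HasFourierDensity u g)
    (hgh : g =ᵐ[volume] h) : HasFourierDensity u h := by
  have h2 : ∀ᵐ ζ : E3, g ((2 * Real.pi) • ζ) = h ((2 * Real.pi) • ζ) := by
    have : Measure.QuasiMeasurePreserving (fun ζ : E3 => (2 * Real.pi) • ζ) volume volume :=
      Measure.quasiMeasurePreserving_smul _ (r := 2 * Real.pi) (by positivity)
    exact this.ae_eq_comp hgh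
  refine ⟨hu.locallyIntegrable.congr hgh, fun φ => ?_, fun φ => ?_⟩
  · refine (hu.integrable φ).congr ?_
    filter_upwards [h2] with ζ hζ
    rw [hζ]
  · rw [hu.fourier_eq]
    refine integral_congr_ae ?_
    filter_upwards [h2] with ζ hζ
    rw [hζ]

theorem HasFourierDensity.unique {u : VField} {g h : E3 → C3} (hg : HasFourierDensity u g)
    (hh : HasFourierDensity u h) : g =ᵐ[volume] h := by
  refine ae_eq_of_integral_contDiff_smul_eq hg.locallyIntegrable hh.locallyIntegrable
    fun θ θs θc => ?_
  have hc : (2 * Real.pi) ≠ 0 := by positivity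
  set Θ : E3 → ℂ := fun ζ => (θ ((2 * Real.pi) • ζ) : ℂ) with hΘ
  have h1 : HasCompactSupport Θ := by
    have : HasCompactSupport fun ζ : E3 => θ ((2 * Real.pi) • ζ) :=
      θc.comp_homeomorph (Homeomorph.smulOfNeZero (2 * Real.pi) hc)
    exact this.comp_left (g := fun x : ℝ => (x : ℂ)) (by simp)
  have h2 : ContDiff ℝ ((⊤ : ℕ∞) : WithTop ℕ∞) Θ :=
    Complex.ofRealCLM.contDiff.comp (θs.comp (contDiff_const_smul (2 * Real.pi)))
  have key : ∀ {f : E3 → C3}, HasFourierDensity u f →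
      ∫ ξ, θ ξ • f ξ = |((2 * Real.pi) ^ Module.finrank ℝ E3)⁻¹|⁻¹ •
        (𝓕 u : VField) (h1.toSchwartzMap h2) := by
    intro f hf
    have := Measure.integral_comp_smul (volume : Measure E3) (fun ξ => θ ξ • f ξ) (2 * Real.pi)
    rw [hf.fourier_eq]
    have e : ∀ ζ : E3, h1.toSchwartzMap h2 ζ • f ((2 * Real.pi) • ζ) =
        θ ((2 * Real.pi) • ζ) • f ((2 * Real.pi) • ζ) := fun ζ => by
      change (θ ((2 * Real.pi) • ζ) : ℂ) • _ = _
      exact Complex.coe_smul _ _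
    simp only [e]
    rw [this, smul_smul, inv_mul_cancel₀, one_smul]
    positivity
  rw [key hg, key hh]

theorem HasFourierDensity.ext {u v : VField} {g : E3 → C3} (hu : HasFourierDensity u g)
    (hv : HasFourierDensity v g) : u = v := by
  ext φ : 1
  rw [hu.apply, hv.apply]

/-- `∫ |ξ|⁻¹ |g(ξ)| dξ`, which is the norm of `FḂ^{-1}_{1,1}` for `g = û`. -/
def weightNorm {V : Type*} [ENorm V] (g : E3 → V) : ℝ≥0∞ := ∫⁻ ξ, ‖ξ‖ₑ⁻¹ * ‖g ξ‖ₑ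

theorem ae_ne_zero : ∀ᵐ ξ : E3, ξ ≠ 0 := by simp [ae_iff]

/-- The pairing with `g` is continuous on Schwartz functions, as `|φ(ξ)| ≤ C |ξ|⁻¹` for a seminorm `C`
of `φ`. -/
theorem exists_hasFourierDensity {g : E3 → C3} (hg : Measurable g) (hf : weightNorm g < ∞) :
    ∃ u, HasFourierDensity u g := by
  have hint : Integrable fun ξ : E3 => ‖ξ‖⁻¹ * ‖g ξ‖ := by
    refine ⟨(measurable_norm.inv.mul hg.norm).aestronglyMeasurable, ?_⟩
    refine lt_of_le_of_lt (lintegral_mono_ae ?_) hf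
    filter_upwards [ae_ne_zero] with ξ hξ
    rw [enorm_mul, enorm_inv (norm_ne_zero_iff.2 hξ), enorm_norm, enorm_norm]
  have hint2 : Integrable fun ζ : E3 => ‖ζ‖⁻¹ * ‖g ((2 * Real.pi) • ζ)‖ := by
    have h1 := (hint.comp_smul (R := 2 * Real.pi) (by positivity)).const_mul (2 * Real.pi)
    refine h1.congr (ae_of_all _ fun ζ => ?_)
    simp only [norm_smul, Real.norm_eq_abs, abs_of_pos (show (0 : ℝ) < 2 * Real.pi by positivity)]
    rw [mul_inv, ← mul_assoc, ← mul_assoc, mul_inv_cancel₀ (by positivity), one_mul]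
  have hgm : Measurable fun ζ : E3 => g ((2 * Real.pi) • ζ) := hg.comp (by fun_prop)
  have hb : ∀ φ : 𝓢(E3, ℂ), ∀ᵐ ζ : E3, ‖φ ζ • g ((2 * Real.pi) • ζ)‖ ≤
      SchwartzMap.seminorm ℂ 1 0 φ * (‖ζ‖⁻¹ * ‖g ((2 * Real.pi) • ζ)‖) := by
    intro φ
    filter_upwards [ae_ne_zero] with ζ hζ
    have h1 := SchwartzMap.norm_pow_mul_le_seminorm ℂ φ 1 ζ
    rw [pow_one] at h1
    rw [norm_smul, ← mul_assoc]
    gcongr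
    rw [← div_eq_mul_inv, le_div_iff₀ (norm_pos_iff.2 hζ), mul_comm]
    exact h1
  have hi : ∀ φ : 𝓢(E3, ℂ), Integrable (fun ζ : E3 => φ ζ • g ((2 * Real.pi) • ζ)) := fun φ =>
    Integrable.mono' (hint2.const_mul _)
      ((φ.continuous.measurable.smul hgm).aestronglyMeasurable) (hb φ)
  set A : 𝓢(E3, ℂ) →L[ℂ] C3 := SchwartzMap.mkCLMtoNormedSpace
    (fun φ => ∫ ζ : E3, φ ζ • g ((2 * Real.pi) • ζ))
    (fun φ θ => by
      rw [← integral_add (hi φ) (hi θ)]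
      simp [add_smul])
    (fun c φ => by
      simp only [RingHom.id_apply]
      rw [← integral_smul]
      simp [mul_smul])
    ⟨{(1, 0)}, ∫ ζ : E3, ‖ζ‖⁻¹ * ‖g ((2 * Real.pi) • ζ)‖,
      integral_nonneg fun ζ => by positivity, fun φ => by
        simp only [Finset.sup_singleton, SchwartzMap.schwartzSeminormFamily_apply]
        rw [mul_comm (∫ ζ : E3, _), ← integral_const_mul]
        exact norm_integral_le_of_norm_le (hint2.const_mul _) (hb φ)⟩ with hA
  refine ⟨𝓕⁻ (ContinuousLinearMap.toPointwiseConvergenceCLM _ _ _ _ A : VField), ?_, hi, fun φ => ?_⟩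
  · refine (locallyIntegrable_iff).2 fun K hK => ?_
    obtain ⟨R, hR⟩ := hK.isBounded.exists_norm_le
    refine Integrable.mono' ((hint.const_mul R).integrableOn) hg.aestronglyMeasurable.restrict ?_
    filter_upwards [ae_restrict_mem hK.measurableSet, ae_restrict_of_ae ae_ne_zero] with ξ hξ h0
    rw [← mul_assoc]
    refine le_mul_of_one_le_left (norm_nonneg _) ?_
    rw [← div_eq_mul_inv, one_le_div (norm_pos_iff.2 h0)]
    exact hR ξ hξ
  · rw [FourierTransform.fourier_fourierInv_eq]
    rfl

open Classical in
/-- The tempered distribution with the Fourier density `g` (zero if there is none). -/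
def ofDensity (g : E3 → C3) : VField :=
  if h : ∃ u, HasFourierDensity u g then h.choose else 0

theorem hasFourierDensity_ofDensity {g : E3 → C3} (hg : Measurable g) (hf : weightNorm g < ∞) :
    HasFourierDensity (ofDensity g) g := by
  have h := exists_hasFourierDensity hg hf
  rw [ofDensity, dif_pos h]
  exact h.choose_spec

theorem HasFourierDensity.isRealField {u : VField} {g : E3 → C3} (h : HasFourierDensity u g)
    (hg : ∀ᵐ ξ, ∀ i, g (-ξ) i = starRingEnd ℂ (g ξ i)) : IsRealField u := by
  intro φ hφ i
  rw [h.apply, ← Complex.conj_eq_iff_im]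
  have e : ∀ ζ, (𝓕⁻ φ : 𝓢(E3, ℂ)) (-ζ) = starRingEnd ℂ ((𝓕⁻ φ : 𝓢(E3, ℂ)) ζ) := by
    intro ζ
    rw [SchwartzMap.fourierInv_coe, Real.fourierInv_eq, Real.fourierInv_eq, ← integral_conj]
    congr 1
    funext v
    simp only [Circle.smul_def, smul_eq_mul, map_mul, Complex.conj_eq_iff_im.2 (hφ v)]
    rw [← Circle.coe_inv_eq_conj, inner_neg_right, AddChar.map_neg_eq_inv]
  have hi := h.integrable (𝓕⁻ φ)
  have h1 : ∀ f : E3 → C3, Integrable f → (∫ ζ, f ζ) i = ∫ ζ, f ζ i := fun f hf =>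
    ((EuclideanSpace.proj i : C3 →L[ℂ] ℂ).integral_comp_comm hf).symm
  rw [h1 _ hi, ← integral_conj, ← integral_neg_eq_self]
  refine integral_congr_ae ?_
  have h2 : ∀ᵐ ζ : E3, ∀ i, g (-((2 * Real.pi) • ζ)) i = starRingEnd ℂ (g ((2 * Real.pi) • ζ) i) :=
    (Measure.quasiMeasurePreserving_smul (volume : Measure E3) (r := 2 * Real.pi)
      (by positivity)).ae hg
  filter_upwards [h2] with ζ hζ
  simp only [smul_neg, PiLp.smul_apply, smul_eq_mul, map_mul, e, hζ, Complex.conj_conj]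

theorem smulLeftCLM_coord_apply (k : Fin 3) (θ : 𝓢(E3, ℂ)) (ζ : E3) :
    SchwartzMap.smulLeftCLM ℂ (fun x : E3 => inner ℝ x (EuclideanSpace.single k 1)) θ ζ =
      (ζ k : ℂ) * θ ζ := by
  have ht : (fun x : E3 => inner ℝ x (EuclideanSpace.single k 1)).HasTemperateGrowth := by
    fun_prop
  rw [SchwartzMap.smulLeftCLM_apply_apply ht, EuclideanSpace.inner_single_right]
  simp

theorem HasFourierDensity.isDivFree {u : VField} {g : E3 → C3} (h : HasFourierDensity u g)
    (hg : ∀ᵐ ξ : E3, ∑ k : Fin 3, (ξ k : ℂ) * g ξ k = 0) : IsDivFree u := by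
  intro φ
  have h1 : ∀ (i : Fin 3) (f : E3 → C3), Integrable f → (∫ ζ, f ζ) i = ∫ ζ, f ζ i := fun i f hf =>
    ((EuclideanSpace.proj i : C3 →L[ℂ] ℂ).integral_comp_comm hf).symm
  have e : ∀ k : Fin 3, ((∂_{(EuclideanSpace.single k 1 : E3)} u : VField) φ) k =
      ∫ ζ : E3, (2 * Real.pi * Complex.I * ζ k * (𝓕⁻ φ : 𝓢(E3, ℂ)) ζ) *
        g ((2 * Real.pi) • ζ) k := by
    intro k
    rw [TemperedDistribution.lineDerivOp_apply_apply, h.apply, h1 k _ (h.integrable _)]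
    refine integral_congr_ae (ae_of_all _ fun ζ => ?_)
    simp only [PiLp.smul_apply, smul_eq_mul]
    congr 1
    have h3 : (𝓕⁻ (-∂_{(EuclideanSpace.single k 1 : E3)} φ) : 𝓢(E3, ℂ)) =
        -(𝓕⁻ (∂_{(EuclideanSpace.single k 1 : E3)} φ) : 𝓢(E3, ℂ)) := 
      map_neg (FourierTransform.fourierCLE ℂ 𝓢(E3, ℂ)).symm _
    rw [h3, SchwartzMap.fourierInv_lineDerivOp_eq]
    rw [neg_apply, smul_apply, smulLeftCLM_coord_apply, smul_eq_mul]
    ring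
  have hi : ∀ k : Fin 3, Integrable fun ζ : E3 =>
      (2 * Real.pi * Complex.I * ζ k * (𝓕⁻ φ : 𝓢(E3, ℂ)) ζ) * g ((2 * Real.pi) • ζ) k := by
    intro k
    have := ((EuclideanSpace.proj k : C3 →L[ℂ] ℂ).integrable_comp
      (h.integrable (SchwartzMap.smulLeftCLM ℂ
        (fun x : E3 => inner ℝ x (EuclideanSpace.single k 1)) (𝓕⁻ φ)))).const_mul
      (2 * Real.pi * Complex.I)
    refine this.congr (ae_of_all _ fun ζ => ?_)
    simp only [smulLeftCLM_coord_apply, PiLp.proj_apply, PiLp.smul_apply, smul_eq_mul]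
    ring
  simp only [e]
  rw [← integral_finsetSum _ fun k _ => hi k]
  refine integral_eq_zero_of_ae ?_
  have h2 : ∀ᵐ ζ : E3, ∑ k : Fin 3, (((2 * Real.pi) • ζ : E3) k : ℂ) * g ((2 * Real.pi) • ζ) k = 0 :=
    (Measure.quasiMeasurePreserving_smul (volume : Measure E3) (r := 2 * Real.pi)
      (by positivity)).ae hg
  filter_upwards [h2] with ζ hζ
  simp only [PiLp.smul_apply, smul_eq_mul, Complex.ofReal_mul, Complex.ofReal_ofNat,
    Pi.zero_apply] at hζ ⊢
  calc _ = (Complex.I * (𝓕⁻ φ : 𝓢(E3, ℂ)) ζ) *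
        ∑ k : Fin 3, 2 * Real.pi * (ζ k : ℂ) * g ((2 * Real.pi) • ζ) k := by
        rw [Finset.mul_sum]
        exact Finset.sum_congr rfl fun k _ => by ring
    _ = 0 := by rw [hζ, mul_zero]

/-! ### Dyadic blocks and Fourier-Besov norms -/

/-- The weight `ψ(2^{-j} ξ)` of the `j`-th dyadic block. -/
def blockWeight (P : DyadicPartition) (j : ℤ) (ξ : E3) : ℝ≥0∞ :=
  ENNReal.ofReal (P.ψ (((2 : ℝ) ^ (-j)) • ξ))

section
variable (P : DyadicPartition)

theorem measurable_blockWeight (j : ℤ) : Measurable (blockWeight P j) :=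
  (P.ψ.continuous.comp (continuous_const_smul _)).measurable.ennreal_ofReal

theorem tsum_blockWeight {ξ : E3} (hξ : ξ ≠ 0) : ∑' j, blockWeight P j ξ = 1 := by
  have h := P.sum_ψ ξ hξ
  unfold blockWeight
  rw [← ENNReal.ofReal_tsum_of_nonneg (fun j => P.ψ_nonneg _) h.summable, h.tsum_eq]
  simp

theorem blockWeight_le_one (j : ℤ) {ξ : E3} (hξ : ξ ≠ 0) : blockWeight P j ξ ≤ 1 := by
  rw [← tsum_blockWeight P hξ]
  exact ENNReal.le_tsum j

theorem bounds_of_blockWeight_ne_zero {j : ℤ} {ξ : E3} (h : blockWeight P j ξ ≠ 0) :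
    3 / 4 * (2 : ℝ) ^ j ≤ ‖ξ‖ ∧ ‖ξ‖ ≤ 8 / 3 * (2 : ℝ) ^ j := by
  have h1 : ((2 : ℝ) ^ (-j)) • ξ ∈ Function.support P.ψ := fun h0 =>
    h (by rw [blockWeight, h0, ENNReal.ofReal_zero])
  have h2 := P.ψ_supp h1
  have hp : (0 : ℝ) < 2 ^ j := by positivity
  simp only [mem_ofPred_eq, norm_smul, Real.norm_eq_abs, zpow_neg, abs_inv, abs_of_pos hp] at h2
  constructor
  · have := h2.1
    rwa [← div_eq_inv_mul, le_div_iff₀ hp] at this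
  · have := h2.2
    rwa [← div_eq_inv_mul, div_le_iff₀ hp] at this

/-- On the `j`-th block, `2^{js}` is comparable to `|ξ|^s`. -/
theorem two_rpow_mul_blockWeight_le {s : ℝ} (hs : |s| ≤ 1) (j : ℤ) (ξ : E3) :
    (2 : ℝ≥0∞) ^ ((j : ℝ) * s) * blockWeight P j ξ ≤
      3 * (ENNReal.ofReal (‖ξ‖ ^ s) * blockWeight P j ξ) := by
  by_cases h : blockWeight P j ξ = 0
  · simp [h]
  obtain ⟨h1, h2⟩ := bounds_of_blockWeight_ne_zero P h
  have hp : (0 : ℝ) < 2 ^ j := by positivity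
  have hξ : 0 < ‖ξ‖ := lt_of_lt_of_le (by positivity) h1
  have e : (2 : ℝ≥0∞) ^ ((j : ℝ) * s) = ENNReal.ofReal (((2 : ℝ) ^ j) ^ s) := by
    rw [← Real.rpow_intCast, ← Real.rpow_mul (by norm_num), ← ENNReal.ofReal_rpow_of_pos (by norm_num)]
    simp
  rw [e, ← mul_assoc, show (3 : ℝ≥0∞) = ENNReal.ofReal 3 by simp, ← ENNReal.ofReal_mul (by norm_num)]
  gcongr
  rcases abs_le.1 hs with ⟨hs1, hs2⟩
  rcases le_total 0 s with h0 | h0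
  · calc ((2 : ℝ) ^ j) ^ s ≤ (3 * ‖ξ‖) ^ s := by gcongr; linarith
      _ = 3 ^ s * ‖ξ‖ ^ s := Real.mul_rpow (by norm_num) hξ.le
      _ ≤ 3 ^ (1 : ℝ) * ‖ξ‖ ^ s := by gcongr; norm_num
      _ = _ := by simp
  · calc ((2 : ℝ) ^ j) ^ s ≤ (3⁻¹ * ‖ξ‖) ^ s :=
          Real.rpow_le_rpow_of_nonpos (by positivity) (by linarith) h0
      _ = 3⁻¹ ^ s * ‖ξ‖ ^ s := Real.mul_rpow (by norm_num) hξ.le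
      _ ≤ 3⁻¹ ^ (-1 : ℝ) * ‖ξ‖ ^ s := by
          gcongr ?_ * _
          exact Real.rpow_le_rpow_of_exponent_ge (by norm_num) (by norm_num) hs1
      _ = _ := by rw [Real.rpow_neg_one, inv_inv]

theorem HasFourierDensity.blockNorm_eq {u : VField} {g : E3 → C3} (h : HasFourierDensity u g)
    (j : ℤ) : blockNorm P 1 j u = ∫⁻ ξ, blockWeight P j ξ * ‖g ξ‖ₑ := by
  have key : ∀ g' : E3 → C3, HasFourierDensity u g' →
      eLpNorm (fun ξ : E3 => P.ψ (((2 : ℝ) ^ (-j)) • ξ) • g' ξ) 1 volume =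
        ∫⁻ ξ, blockWeight P j ξ * ‖g ξ‖ₑ := by
    intro g' hg'
    rw [eLpNorm_one_eq_lintegral_enorm]
    refine lintegral_congr_ae ?_
    filter_upwards [hg'.unique h] with ξ hξ
    rw [enorm_smul, hξ, Real.enorm_of_nonneg (P.ψ_nonneg _)]
    rfl
  unfold blockNorm
  refine le_antisymm (iInf₂_le_of_le g h (key g h).le) (le_iInf₂ fun g' hg' => (key g' hg').ge)

theorem seqNorm_two_le_tsum (a : ℤ → ℝ≥0∞) : seqNorm 2 a ≤ ∑' j, a j := by
  rw [seqNorm, if_neg (by simp)]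
  have h2 : ∑' j, a j ^ (2 : ℝ) ≤ (∑' j, a j) ^ (2 : ℝ) := by
    calc ∑' j, a j ^ (2 : ℝ) ≤ ∑' j, a j * ∑' i, a i := by
          refine ENNReal.tsum_le_tsum fun j => ?_
          rw [ENNReal.rpow_two, sq]
          gcongr
          exact ENNReal.le_tsum j
      _ = _ := by rw [ENNReal.tsum_mul_right, ENNReal.rpow_two, sq]
  calc _ ≤ ((∑' j, a j) ^ (2 : ℝ)) ^ (1 / 2 : ℝ) := by
        simp only [ENNReal.toReal_ofNat]
        gcongr
    _ = _ := by rw [← ENNReal.rpow_mul]; norm_num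

theorem le_seqNorm {r : ℝ≥0∞} (hr : r ≠ 0) (a : ℤ → ℝ≥0∞) (j : ℤ) : a j ≤ seqNorm r a := by
  unfold seqNorm
  split_ifs with h
  · exact le_iSup a j
  · have hr0 : 0 < r.toReal := ENNReal.toReal_pos hr h
    calc a j = (a j ^ r.toReal) ^ (1 / r.toReal) := by
          rw [← ENNReal.rpow_mul, mul_one_div_cancel hr0.ne', ENNReal.rpow_one]
      _ ≤ _ := by
          gcongr
          exact ENNReal.le_tsum (f := fun j => a j ^ r.toReal) j

/-- Interpolation of `ℓ^r` between `ℓ¹` and `ℓ^∞`. -/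
theorem seqNorm_le_interpolate {r : ℝ≥0∞} (hr1 : 1 < r) (hr : r ≠ ∞) {a : ℤ → ℝ≥0∞} {A : ℝ≥0∞}
    (hA : ∀ j, a j ≤ A) :
    seqNorm r a ≤ (A ^ (r.toReal - 1) * ∑' j, a j) ^ (1 / r.toReal) := by
  have hr1' : 1 < r.toReal := by
    rwa [← ENNReal.toReal_one, ENNReal.toReal_lt_toReal (by simp) hr]
  rw [seqNorm, if_neg hr]
  gcongr
  rw [← ENNReal.tsum_mul_left]
  refine ENNReal.tsum_le_tsum fun j => ?_
  calc a j ^ r.toReal = a j ^ (r.toReal - 1) * a j := by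
        conv_rhs => enter [2]; rw [← ENNReal.rpow_one (a j)]
        rw [← ENNReal.rpow_add_of_nonneg _ _ (by linarith) zero_le_one]
        congr 1; ring
    _ ≤ _ := mul_le_mul_left (ENNReal.rpow_le_rpow (hA j) (by linarith)) _

theorem ofReal_norm_rpow_neg_one {ξ : E3} (hξ : ξ ≠ 0) :
    ENNReal.ofReal (‖ξ‖ ^ (-1 : ℝ)) = ‖ξ‖ₑ⁻¹ := by
  rw [Real.rpow_neg_one, ENNReal.ofReal_inv_of_pos (norm_pos_iff.2 hξ), ofReal_norm]

theorem two_rpow_neg_mul_lintegral_le (j : ℤ) {V : Type*} [MeasurableSpace V] [NormedAddCommGroup V]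
    [OpensMeasurableSpace V] {g : E3 → V} (hg : Measurable g) :
    (2 : ℝ≥0∞) ^ ((j : ℝ) * (-1)) * ∫⁻ ξ, blockWeight P j ξ * ‖g ξ‖ₑ ≤
      3 * ∫⁻ ξ, blockWeight P j ξ * (‖ξ‖ₑ⁻¹ * ‖g ξ‖ₑ) := by
  have hm : Measurable fun ξ => blockWeight P j ξ * ‖g ξ‖ₑ := (measurable_blockWeight P j).mul hg.enorm
  have hm2 : Measurable fun ξ : E3 => blockWeight P j ξ * (‖ξ‖ₑ⁻¹ * ‖g ξ‖ₑ) :=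
    (measurable_blockWeight P j).mul (measurable_enorm.inv.mul hg.enorm)
  rw [← lintegral_const_mul _ hm, ← lintegral_const_mul _ hm2]
  refine lintegral_mono_ae ?_
  filter_upwards [ae_ne_zero] with ξ hξ
  rw [← mul_assoc]
  calc _ ≤ 3 * (ENNReal.ofReal (‖ξ‖ ^ (-1 : ℝ)) * blockWeight P j ξ) * ‖g ξ‖ₑ := by
        exact mul_le_mul_left (two_rpow_mul_blockWeight_le P (s := -1) (by norm_num) j ξ) _
    _ = _ := by rw [ofReal_norm_rpow_neg_one hξ]; ring

theorem tsum_lintegral_blockWeight {h : E3 → ℝ≥0∞} (hh : Measurable h) :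
    ∑' j, ∫⁻ ξ, blockWeight P j ξ * h ξ = ∫⁻ ξ, h ξ := by
  have hm : ∀ j, AEMeasurable (fun ξ => blockWeight P j ξ * h ξ) := fun j =>
    ((measurable_blockWeight P j).mul hh).aemeasurable
  rw [← lintegral_tsum hm]
  refine lintegral_congr_ae ?_
  filter_upwards [ae_ne_zero] with ξ hξ
  rw [ENNReal.tsum_mul_right, tsum_blockWeight P hξ, one_mul]

theorem HasFourierDensity.fbNorm_two_le {u : VField} {g : E3 → C3} (h : HasFourierDensity u g)
    (hg : Measurable g) : fbNorm P (-1) 1 2 u ≤ 3 * weightNorm g := by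
  unfold fbNorm
  refine (seqNorm_two_le_tsum _).trans ?_
  calc _ ≤ ∑' j, 3 * ∫⁻ ξ, blockWeight P j ξ * (‖ξ‖ₑ⁻¹ * ‖g ξ‖ₑ) := by
        refine ENNReal.tsum_le_tsum fun j => ?_
        rw [h.blockNorm_eq]
        exact two_rpow_neg_mul_lintegral_le P j hg
    _ = _ := by
        have hm : Measurable fun ξ : E3 => ‖ξ‖ₑ⁻¹ * ‖g ξ‖ₑ := measurable_enorm.inv.mul hg.enorm
        rw [ENNReal.tsum_mul_left, tsum_lintegral_blockWeight P hm]
        rfl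

theorem HasFourierDensity.le_fbNorm {u : VField} {g : E3 → C3} (h : HasFourierDensity u g)
    {r : ℝ≥0∞} (hr : r ≠ 0) (s : ℝ) (j : ℤ) :
    (2 : ℝ≥0∞) ^ ((j : ℝ) * s) * ∫⁻ ξ, blockWeight P j ξ * ‖g ξ‖ₑ ≤ fbNorm P s 1 r u := by
  rw [← h.blockNorm_eq]
  exact le_seqNorm hr (fun j => (2 : ℝ≥0∞) ^ ((j : ℝ) * s) * blockNorm P 1 j u) j

end

theorem norm_vel_le (v : Vec) : ‖vel v‖ ≤ 2 * ‖v‖ := by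
  rw [EuclideanSpace.norm_eq]
  refine Real.sqrt_le_iff.2 ⟨by positivity, ?_⟩
  calc _ ≤ ∑ _i : Fin 3, ‖v‖ ^ 2 := by
        gcongr with i
        exact norm_le_pi_norm v _
    _ ≤ _ := by simp; nlinarith [sq_nonneg ‖v‖]

theorem norm_rot_le (v : Vec) : ‖rot v‖ ≤ 2 * ‖v‖ := by
  rw [EuclideanSpace.norm_eq]
  refine Real.sqrt_le_iff.2 ⟨by positivity, ?_⟩
  calc _ ≤ ∑ _i : Fin 3, ‖v‖ ^ 2 := by
        gcongr with i
        exact norm_le_pi_norm v _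
    _ ≤ _ := by simp; nlinarith [sq_nonneg ‖v‖]

theorem enorm_le_two_mul {V W : Type*} [SeminormedAddGroup V] [SeminormedAddGroup W] {v : V} {w : W}
    (h : ‖v‖ ≤ 2 * ‖w‖) : ‖v‖ₑ ≤ 2 * ‖w‖ₑ := by
  rw [← ofReal_norm, ← ofReal_norm, show (2 : ℝ≥0∞) = ENNReal.ofReal 2 by simp,
    ← ENNReal.ofReal_mul (by norm_num)]
  exact ENNReal.ofReal_le_ofReal h

theorem enorm_vel_le (v : Vec) : ‖vel v‖ₑ ≤ 2 * ‖v‖ₑ := enorm_le_two_mul (norm_vel_le v)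
theorem enorm_rot_le (v : Vec) : ‖rot v‖ₑ ≤ 2 * ‖v‖ₑ := enorm_le_two_mul (norm_rot_le v)

theorem norm_le_vel_add_rot (v : Vec) : ‖v‖ ≤ ‖vel v‖ + ‖rot v‖ := by
  rw [pi_norm_le_iff_of_nonneg (by positivity)]
  rintro (i | i)
  · exact (PiLp.norm_apply_le (vel v) i).trans (by linarith [norm_nonneg (rot v)])
  · exact (PiLp.norm_apply_le (rot v) i).trans (by linarith [norm_nonneg (vel v)])

theorem enorm_le_vel_add_rot (v : Vec) : ‖v‖ₑ ≤ ‖vel v‖ₑ + ‖rot v‖ₑ := by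
  rw [← ofReal_norm, ← ofReal_norm, ← ofReal_norm,
    ← ENNReal.ofReal_add (by positivity) (by positivity)]
  exact ENNReal.ofReal_le_ofReal (norm_le_vel_add_rot v)

theorem measurable_vel : Measurable vel :=
  (PiLp.continuous_toLp 2 _).measurable.comp (measurable_pi_iff.2 fun _ => measurable_pi_apply _)

theorem measurable_rot : Measurable rot :=
  (PiLp.continuous_toLp 2 _).measurable.comp (measurable_pi_iff.2 fun _ => measurable_pi_apply _)

/-- The pair of fields whose Fourier transform is `g`. -/
def stateOf (g : E3 → Vec) : State := (ofDensity (vel ∘ g), ofDensity (rot ∘ g))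

section
variable {g : E3 → Vec}

theorem weightNorm_vel_le (g : E3 → Vec) : weightNorm (vel ∘ g) ≤ 2 * weightNorm g := by
  unfold weightNorm
  rw [← lintegral_const_mul' _ _ (by simp)]
  refine lintegral_mono fun ξ => ?_
  calc _ ≤ ‖ξ‖ₑ⁻¹ * (2 * ‖g ξ‖ₑ) := by gcongr; exact enorm_vel_le _
    _ = _ := by ring

theorem weightNorm_rot_le (g : E3 → Vec) : weightNorm (rot ∘ g) ≤ 2 * weightNorm g := by
  unfold weightNorm
  rw [← lintegral_const_mul' _ _ (by simp)]
  refine lintegral_mono fun ξ => ?_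
  calc _ ≤ ‖ξ‖ₑ⁻¹ * (2 * ‖g ξ‖ₑ) := by gcongr; exact enorm_rot_le _
    _ = _ := by ring

theorem stateOf_fst (hg : Measurable g) (hf : weightNorm g < ∞) :
    HasFourierDensity (stateOf g).1 (vel ∘ g) :=
  hasFourierDensity_ofDensity (measurable_vel.comp hg)
    ((weightNorm_vel_le g).trans_lt (ENNReal.mul_lt_top (by simp) hf))

theorem stateOf_snd (hg : Measurable g) (hf : weightNorm g < ∞) :
    HasFourierDensity (stateOf g).2 (rot ∘ g) :=
  hasFourierDensity_ofDensity (measurable_rot.comp hg)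
    ((weightNorm_rot_le g).trans_lt (ENNReal.mul_lt_top (by simp) hf))

theorem stateNorm_two_le (P : DyadicPartition) {U : State} (hg : Measurable g)
    (h1 : HasFourierDensity U.1 (vel ∘ g)) (h2 : HasFourierDensity U.2 (rot ∘ g)) :
    stateNorm P (-1) 1 2 U ≤ 12 * weightNorm g := by
  calc _ ≤ 3 * (2 * weightNorm g) + 3 * (2 * weightNorm g) := by
        refine add_le_add ((h1.fbNorm_two_le P (measurable_vel.comp hg)).trans ?_)
          ((h2.fbNorm_two_le P (measurable_rot.comp hg)).trans ?_)
        · gcongr; exact weightNorm_vel_le g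
        · gcongr; exact weightNorm_rot_le g
    _ = _ := by ring

end

/-! ### Solutions on the Fourier side are global mild solutions -/

section
variable {g : E3 → Vec} {w : ℝ → E3 → Vec}

theorem IsFourierSol.measurable_slice (h : IsFourierSol g w) (t : ℝ) : Measurable (w t) :=
  h.measurable.of_uncurry_left

theorem IsFourierSol.zero_eq (h : IsFourierSol g w) : w 0 = g := by
  funext ξ
  rw [h.eq 0 le_rfl]
  simp [linFlow, duhamel, symG_zero]

/-- A majorant of `|ξ|⁻¹ |w(t, ξ)|` that does not depend on the time. -/
def timeMajorant (g : E3 → Vec) (w : ℝ → E3 → Vec) (ξ : E3) : ℝ≥0∞ :=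
  3 * (‖ξ‖ₑ⁻¹ * ‖g ξ‖ₑ) + 36 * ∫⁻ τ in Ioi (0 : ℝ), absConv (w τ) (w τ) ξ

theorem isGoodFreq_zero (ξ : E3) : IsGoodFreq 0 ξ := by simp [IsGoodFreq, absConv]

theorem IsFourierSol.ae_le_timeMajorant (h : IsFourierSol g w) :
    ∀ᵐ ξ, ∀ t, 0 ≤ t → ‖ξ‖ₑ⁻¹ * ‖w t ξ‖ₑ ≤ timeMajorant g w ξ := by
  filter_upwards [ae_isGoodFreq h.measurable h.finite, ae_ne_zero] with ξ hξ h0 t ht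
  rw [h.eq t ht]
  have h1 := hξ.enorm_duhamel_sub_le' (isGoodFreq_zero ξ) h.measurable measurable_const ht
  simp only [duhamel_zero, Pi.zero_apply, sub_zero, lipConv_zero_right] at h1
  calc _ ≤ ‖ξ‖ₑ⁻¹ * (‖linFlow g t ξ‖ₑ + ‖duhamel w t ξ‖ₑ) := by gcongr; exact enorm_sub_le
    _ ≤ ‖ξ‖ₑ⁻¹ * (3 * ‖g ξ‖ₑ + ‖ξ‖ₑ * (36 * ∫⁻ τ in Ioi (0 : ℝ), absConv (w τ) (w τ) ξ)) := by
        gcongr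
        exact enorm_symG_mulVec_le' ξ _ ht
    _ = _ := by
        have : ‖ξ‖ₑ⁻¹ * ‖ξ‖ₑ = 1 := ENNReal.inv_mul_cancel (by simpa using h0) (by simp)
        rw [mul_add, ← mul_assoc _ ‖ξ‖ₑ, this, one_mul, timeMajorant]
        ring

theorem IsFourierSol.lintegral_timeMajorant_lt_top (h : IsFourierSol g w) (hg : Measurable g)
    (hf : weightNorm g < ∞) : ∫⁻ ξ, timeMajorant g w ξ < ∞ := by
  have hm1 : Measurable fun ξ : E3 => ‖ξ‖ₑ⁻¹ * ‖g ξ‖ₑ := measurable_enorm.inv.mul hg.enorm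
  have hm2 := measurable_absConv h.measurable h.measurable
  have hm3 : Measurable fun ξ => ∫⁻ τ in Ioi (0 : ℝ), absConv (w τ) (w τ) ξ :=
    Measurable.lintegral_prod_left' hm2
  unfold timeMajorant
  rw [lintegral_add_left (hm1.const_mul _), lintegral_const_mul _ hm1, lintegral_const_mul _ hm3,
    ← lintegral_lintegral_swap hm2.aemeasurable]
  refine ENNReal.add_lt_top.2 ⟨ENNReal.mul_lt_top (by simp) hf, ENNReal.mul_lt_top (by simp) ?_⟩
  exact (lintegral_absConv_le _ h.measurable h.measurable).trans_lt
    (ENNReal.mul_lt_top h.finite h.finite)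

theorem IsFourierSol.weightNorm_lt_top (h : IsFourierSol g w) (hg : Measurable g)
    (hf : weightNorm g < ∞) {t : ℝ} (ht : 0 ≤ t) : weightNorm (w t) < ∞ := by
  refine lt_of_le_of_lt (lintegral_mono_ae ?_) (h.lintegral_timeMajorant_lt_top hg hf)
  filter_upwards [h.ae_le_timeMajorant] with ξ hξ
  exact hξ t ht

theorem IsFourierSol.isMildSolution (h : IsFourierSol g w) (hg : Measurable g)
    (hf : weightNorm g < ∞) : IsMildSolution (stateOf g) fun t => stateOf (w t) := by
  refine ⟨congrArg stateOf h.zero_eq, fun t ξ => vel (w t ξ), fun t ξ => rot (w t ξ),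
    (measurable_vel.comp h.measurable).aestronglyMeasurable,
    (measurable_rot.comp h.measurable).aestronglyMeasurable, fun t ht =>
      ⟨stateOf_fst (h.measurable_slice t) (h.weightNorm_lt_top hg hf ht),
        stateOf_snd (h.measurable_slice t) (h.weightNorm_lt_top hg hf ht)⟩, ?_, ?_⟩
  · have hw := h.measurable
    have h1 := (lintegral_absConv_le (Ioi 0) hw hw).trans_lt (ENNReal.mul_lt_top h.finite h.finite)
    have hM : Measurable fun τ => ∫⁻ ξ, absConv (w τ) (w τ) ξ :=
      Measurable.lintegral_prod_right' (measurable_absConv hw hw)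
    filter_upwards [ae_lt_top hM h1.ne] with τ hτ
    filter_upwards [ae_lt_top (measurable_absConv_freq hw hw τ) hτ.ne] with ξ hξ k l
    exact ⟨integrable_of_absConv (h.measurable_slice τ) (h.measurable_slice τ) hξ (.inl k) (.inl l),
      integrable_of_absConv (h.measurable_slice τ) (h.measurable_slice τ) hξ (.inl k) (.inr l)⟩
  · intro t ht
    filter_upwards [ae_isGoodFreq h.measurable h.finite] with ξ hξ
    refine ⟨hξ.intervalIntegrable h.measurable ht, ?_⟩
    simp only [join_vel_rot, h.zero_eq]
    exact h.eq t ht ξ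

theorem IsFourierSol.stateOf_sub (h : IsFourierSol g w) (hg : Measurable g)
    (hf : weightNorm g < ∞) (P : DyadicPartition) {t s : ℝ} (ht : 0 ≤ t) (hs : 0 ≤ s) :
    stateNorm P (-1) 1 2 (stateOf (w t) - stateOf (w s)) ≤ 12 * weightNorm (w t - w s) :=
  stateNorm_two_le P ((h.measurable_slice t).sub (h.measurable_slice s))
    ((stateOf_fst (h.measurable_slice t) (h.weightNorm_lt_top hg hf ht)).sub
      (stateOf_fst (h.measurable_slice s) (h.weightNorm_lt_top hg hf hs)))
    ((stateOf_snd (h.measurable_slice t) (h.weightNorm_lt_top hg hf ht)).sub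
      (stateOf_snd (h.measurable_slice s) (h.weightNorm_lt_top hg hf hs)))

/-- Continuity in time, by dominated convergence for the weighted densities. -/
theorem IsFourierSol.isContinuousIn (h : IsFourierSol g w) (hg : Measurable g)
    (hf : weightNorm g < ∞) (P : DyadicPartition) :
    IsContinuousIn P (-1) 1 2 fun t => stateOf (w t) := by
  refine ⟨fun t ht => ?_, fun t₀ ht₀ => ?_⟩
  · have hwt := h.weightNorm_lt_top hg hf ht
    exact (stateNorm_two_le P (h.measurable_slice t) (stateOf_fst (h.measurable_slice t) hwt)
      (stateOf_snd (h.measurable_slice t) hwt)).trans_lt (ENNReal.mul_lt_top (by simp) hwt)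
  · have hlim : Tendsto (fun t => weightNorm (w t - w t₀)) (𝓝[Ici 0] t₀) (𝓝 0) := by
      have := tendsto_lintegral_filter_of_dominated_convergence (μ := (volume : Measure E3))
        (l := 𝓝[Ici 0] t₀) (F := fun t ξ => ‖ξ‖ₑ⁻¹ * ‖(w t - w t₀) ξ‖ₑ) (f := fun _ => 0)
        (fun ξ => 2 * timeMajorant g w ξ) (Eventually.of_forall fun t =>
          (measurable_enorm.inv.mul ((h.measurable_slice t).sub (h.measurable_slice t₀)).enorm))
        ?_ ?_ ?_
      · simpa [weightNorm] using this
      · filter_upwards [self_mem_nhdsWithin] with t ht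
        filter_upwards [h.ae_le_timeMajorant] with ξ hξ
        calc _ ≤ ‖ξ‖ₑ⁻¹ * (‖w t ξ‖ₑ + ‖w t₀ ξ‖ₑ) := by gcongr; exact enorm_sub_le
          _ ≤ timeMajorant g w ξ + timeMajorant g w ξ := by
              rw [mul_add]
              exact add_le_add (hξ t ht) (hξ t₀ ht₀)
          _ = _ := (two_mul _).symm
      · rw [lintegral_const_mul' _ _ (by simp)]
        exact ENNReal.mul_ne_top (by simp) (h.lintegral_timeMajorant_lt_top hg hf).ne
      · filter_upwards [ae_isGoodFreq h.measurable h.finite, ae_ne_zero] with ξ hξ h0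
        have hc : ContinuousOn (fun t => w t ξ) (Ici 0) := by
          have hG : Continuous fun t => linFlow g t ξ := by
            have : Continuous fun t => symG t ξ :=
              continuous_symG.comp (continuous_id.prodMk continuous_const)
            exact this.matrix_mulVec continuous_const
          exact (hG.continuousOn.sub (hξ.continuousOn_duhamel h.measurable)).congr fun t ht =>
            h.eq t ht ξ
        have h1 : Tendsto (fun t => w t ξ - w t₀ ξ) (𝓝[Ici 0] t₀) (𝓝 0) := by
          simpa using (hc t₀ ht₀).sub_const (w t₀ ξ)
        have h2 := (continuous_enorm.tendsto (0 : Vec)).comp h1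
        rw [enorm_zero] at h2
        have h3 := ENNReal.Tendsto.const_mul (a := ‖ξ‖ₑ⁻¹) h2
          (Or.inr (ENNReal.inv_ne_top.2 (by simpa using h0)))
        simpa using! h3
    have h12 := ENNReal.Tendsto.const_mul (a := 12) hlim (Or.inr (by simp))
    rw [mul_zero] at h12
    refine tendsto_of_tendsto_of_tendsto_of_le_of_le' tendsto_const_nhds h12
      (Eventually.of_forall fun _ => zero_le) ?_
    filter_upwards [self_mem_nhdsWithin] with t ht
    exact h.stateOf_sub hg hf P ht ht₀

/-- The linear evolution in the weighted spaces `L^q_t L¹_ξ`, localized by a weight `ω`. -/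
theorem lintegral_linFlow_rpow_le (hg : Measurable g) {q : ℝ} (hq : 1 < q) {ω : E3 → ℝ≥0∞}
    (hω : Measurable ω) :
    ∫⁻ t in Ioi (0 : ℝ), (∫⁻ ξ, ω ξ * (ENNReal.ofReal (‖ξ‖ ^ (2 / q - 1)) * ‖linFlow g t ξ‖ₑ)) ^ q ≤
      2 * (3 * ∫⁻ ξ, ω ξ * (‖ξ‖ₑ⁻¹ * ‖g ξ‖ₑ)) ^ q := by
  have hm1 : Measurable fun ξ : E3 => ω ξ * (‖ξ‖ₑ⁻¹ * ‖g ξ‖ₑ) :=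
    hω.mul (measurable_enorm.inv.mul hg.enorm)
  have key := lintegral_rpow_heatKer_le (volume : Measure E3) hq (ρ := fun ξ => ‖ξ‖)
    (σ := fun _ => 0) measurable_norm (fun _ => norm_nonneg _) measurable_const (hm1.const_mul 3)
  rw [lintegral_const_mul _ hm1] at key
  refine le_trans ?_ ((setLIntegral_le_lintegral (Ioi 0) _).trans key)
  refine setLIntegral_mono' measurableSet_Ioi fun t ht => ENNReal.rpow_le_rpow ?_ (by linarith)
  refine lintegral_mono_ae ?_
  filter_upwards [ae_ne_zero] with ξ hξ
  have hξ' : 0 < ‖ξ‖ := norm_pos_iff.2 hξ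
  have ht0 : (0 : ℝ) ≤ t := (mem_Ioi.1 ht).le
  rw [sub_zero, heatKer, if_pos ht0]
  calc _ ≤ ω ξ * (ENNReal.ofReal (‖ξ‖ ^ (2 / q - 1)) *
        (3 * ENNReal.ofReal (Real.exp (-(t * ‖ξ‖ ^ 2 / 2))) * ‖g ξ‖ₑ)) := by
        gcongr
        exact enorm_symG_mulVec_le ξ _ ht0
    _ = _ := by
        rw [← ofReal_norm_rpow_neg_one hξ, ENNReal.ofReal_mul (by positivity), sub_eq_add_neg,
          Real.rpow_add hξ', ENNReal.ofReal_mul (by positivity)]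
        ring

/-- Block by block, a solution lies in `L^q_t L¹_ξ` for all `q > 1`, with a bound that is summable
over the blocks. -/
theorem IsFourierSol.two_rpow_mul_blockNorm_le (h : IsFourierSol g w) (hg : Measurable g)
    (P : DyadicPartition) {q : ℝ} (hq : 1 < q)
    (hs : |2 / q - 1| ≤ 1) (j : ℤ) {u : ℝ → VField} {F : Vec → C3} (hF : Measurable F)
    (hF2 : ∀ v, ‖F v‖ₑ ≤ 2 * ‖v‖ₑ)
    (hu : ∀ t, 0 ≤ t → HasFourierDensity (u t) (F ∘ w t)) :
    (2 : ℝ≥0∞) ^ ((j : ℝ) * (2 / q - 1)) * eLpNorm (fun t : ℝ => blockNorm P 1 j (u t))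
        (ENNReal.ofReal q) (volume.restrict (Ioi 0)) ≤
      12 * ((3 * ∫⁻ ξ, blockWeight P j ξ * (‖ξ‖ₑ⁻¹ * ‖g ξ‖ₑ)) +
        36 * ∫⁻ ξ, blockWeight P j ξ * ∫⁻ τ in Ioi (0 : ℝ), absConv (w τ) (w τ) ξ) := by
  have hq0 : 0 < q := by linarith
  set s := 2 / q - 1 with hs'
  set A : ℝ → ℝ≥0∞ := fun t =>
    ∫⁻ ξ, blockWeight P j ξ * (ENNReal.ofReal (‖ξ‖ ^ s) * ‖linFlow g t ξ‖ₑ) with hA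
  set B : ℝ → ℝ≥0∞ := fun t =>
    ∫⁻ ξ, blockWeight P j ξ * (ENNReal.ofReal (‖ξ‖ ^ s) * ‖duhamel w t ξ‖ₑ) with hB
  have hpow : Measurable fun ξ : E3 => ENNReal.ofReal (‖ξ‖ ^ s) :=
    (measurable_norm.pow_const s).ennreal_ofReal
  have hmA : Measurable fun p : ℝ × E3 =>
      blockWeight P j p.2 * (ENNReal.ofReal (‖p.2‖ ^ s) * ‖linFlow g p.1 p.2‖ₑ) :=
    ((measurable_blockWeight P j).comp measurable_snd).mul
      ((hpow.comp measurable_snd).mul (measurable_linFlow hg).enorm)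
  have hmB : Measurable fun p : ℝ × E3 =>
      blockWeight P j p.2 * (ENNReal.ofReal (‖p.2‖ ^ s) * ‖duhamel w p.1 p.2‖ₑ) :=
    ((measurable_blockWeight P j).comp measurable_snd).mul
      ((hpow.comp measurable_snd).mul (measurable_duhamel h.measurable).enorm)
  have hAm : Measurable A := Measurable.lintegral_prod_right' hmA
  have hBm : Measurable B := Measurable.lintegral_prod_right' hmB
  have hpt : ∀ t ∈ Ioi (0 : ℝ), (2 : ℝ≥0∞) ^ ((j : ℝ) * s) * blockNorm P 1 j (u t) ≤
      6 * (A t + B t) := by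
    intro t ht
    have ht0 : 0 ≤ t := (mem_Ioi.1 ht).le
    have hmA' : Measurable fun ξ =>
        blockWeight P j ξ * (ENNReal.ofReal (‖ξ‖ ^ s) * ‖linFlow g t ξ‖ₑ) :=
      hmA.comp (measurable_const.prodMk measurable_id)
    have hmF : Measurable fun ξ => blockWeight P j ξ * ‖(F ∘ w t) ξ‖ₑ :=
      (measurable_blockWeight P j).mul (hF.comp (h.measurable_slice t)).enorm
    rw [(hu t ht0).blockNorm_eq, hA, hB]
    simp only
    rw [← lintegral_add_left hmA', ← lintegral_const_mul _ hmF,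
      ← lintegral_const_mul' _ _ (by simp)]
    refine lintegral_mono fun ξ => ?_
    calc _ ≤ (2 : ℝ≥0∞) ^ ((j : ℝ) * s) * (blockWeight P j ξ * (2 * ‖w t ξ‖ₑ)) := by
          gcongr
          exact hF2 _
      _ = (2 : ℝ≥0∞) ^ ((j : ℝ) * s) * blockWeight P j ξ * (2 * ‖w t ξ‖ₑ) := by ring
      _ ≤ 3 * (ENNReal.ofReal (‖ξ‖ ^ s) * blockWeight P j ξ) *
          (2 * (‖linFlow g t ξ‖ₑ + ‖duhamel w t ξ‖ₑ)) := by
          refine mul_le_mul' (two_rpow_mul_blockWeight_le P hs j ξ) ?_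
          gcongr
          rw [h.eq t ht0]
          exact enorm_sub_le
      _ = 6 * (blockWeight P j ξ * (ENNReal.ofReal (‖ξ‖ ^ s) * ‖linFlow g t ξ‖ₑ) +
            blockWeight P j ξ * (ENNReal.ofReal (‖ξ‖ ^ s) * ‖duhamel w t ξ‖ₑ)) := by ring
  have hroot : ∀ {C X : ℝ≥0∞}, C ≤ 2 * X ^ q → C ^ (1 / q) ≤ 2 * X := by
    intro C X hC
    calc C ^ (1 / q) ≤ ((2 : ℝ≥0∞) ^ q * X ^ q) ^ (1 / q) := by
          gcongr
          refine hC.trans ?_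
          gcongr
          calc (2 : ℝ≥0∞) = 2 ^ (1 : ℝ) := (ENNReal.rpow_one 2).symm
            _ ≤ _ := ENNReal.rpow_le_rpow_of_exponent_le (by norm_num) hq.le
      _ = 2 * X := by
          rw [← ENNReal.mul_rpow_of_nonneg _ _ hq0.le, ← ENNReal.rpow_mul,
            mul_one_div_cancel hq0.ne', ENNReal.rpow_one]
  have hA2 := hroot (lintegral_linFlow_rpow_le hg hq (measurable_blockWeight P j))
  have hB1 := lintegral_duhamel_sub_rpow_le (w' := 0) measurableSet_Ioi subset_rfl
    (fun t _ => Ioc_subset_Ioi_self) h.measurable measurable_const h.finite (by simp) hq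
    (measurable_blockWeight P j)
  simp only [duhamel_zero, Pi.zero_apply, sub_zero, lipConv_zero_right] at hB1
  have hB2 := hroot hB1
  rw [eLpNorm_eq_lintegral_rpow_enorm_toReal (by simpa using hq0) (by simp), ENNReal.toReal_ofReal hq0.le]
  simp only [enorm_eq_self]
  have hmul : (2 : ℝ≥0∞) ^ ((j : ℝ) * s) = (((2 : ℝ≥0∞) ^ ((j : ℝ) * s)) ^ q) ^ (1 / q) := by
    rw [← ENNReal.rpow_mul, mul_one_div_cancel hq0.ne', ENNReal.rpow_one]
  have hne : ((2 : ℝ≥0∞) ^ ((j : ℝ) * s)) ^ q ≠ ∞ :=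
    ENNReal.rpow_ne_top_of_nonneg hq0.le (ENNReal.rpow_ne_top_of_ne_zero (by simp) (by simp))
  rw [hmul, ← ENNReal.mul_rpow_of_nonneg _ _ (by positivity), ← lintegral_const_mul' _ _ hne]
  have hswap : ∫⁻ τ in Ioi (0 : ℝ), ∫⁻ ξ, blockWeight P j ξ * absConv (w τ) (w τ) ξ =
      ∫⁻ ξ, blockWeight P j ξ * ∫⁻ τ in Ioi (0 : ℝ), absConv (w τ) (w τ) ξ := by
    have hm : Measurable fun p : ℝ × E3 => blockWeight P j p.2 * absConv (w p.1) (w p.1) p.2 :=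
      ((measurable_blockWeight P j).comp measurable_snd).mul
        (measurable_absConv h.measurable h.measurable)
    rw [lintegral_lintegral_swap hm.aemeasurable]
    refine lintegral_congr fun ξ => ?_
    rw [lintegral_const_mul _ (measurable_absConv_time h.measurable h.measurable ξ)]
  rw [hswap] at hB2
  calc _ ≤ (∫⁻ t in Ioi (0 : ℝ), (6 : ℝ≥0∞) ^ q * (A t + B t) ^ q) ^ (1 / q) := by
        refine ENNReal.rpow_le_rpow (setLIntegral_mono' measurableSet_Ioi fun t ht => ?_)
          (by positivity)
        rw [← ENNReal.mul_rpow_of_nonneg _ _ hq0.le, ← ENNReal.mul_rpow_of_nonneg _ _ hq0.le]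
        exact ENNReal.rpow_le_rpow (hpt t ht) hq0.le
    _ = 6 * (∫⁻ t in Ioi (0 : ℝ), (A t + B t) ^ q) ^ (1 / q) := by
        rw [lintegral_const_mul' _ _ (ENNReal.rpow_ne_top_of_nonneg hq0.le (by simp)),
          ENNReal.mul_rpow_of_nonneg _ _ (by positivity), ← ENNReal.rpow_mul,
          mul_one_div_cancel hq0.ne', ENNReal.rpow_one]
    _ ≤ 6 * ((∫⁻ t in Ioi (0 : ℝ), A t ^ q) ^ (1 / q) + (∫⁻ t in Ioi (0 : ℝ), B t ^ q) ^ (1 / q)) := by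
        gcongr
        exact ENNReal.lintegral_Lp_add_le hAm.aemeasurable hBm.aemeasurable hq.le
    _ ≤ 6 * (2 * (3 * ∫⁻ ξ, blockWeight P j ξ * (‖ξ‖ₑ⁻¹ * ‖g ξ‖ₑ)) +
        2 * (36 * ∫⁻ ξ, blockWeight P j ξ * ∫⁻ τ in Ioi (0 : ℝ), absConv (w τ) (w τ) ξ)) := by
        gcongr
    _ = _ := by ring

theorem IsFourierSol.chNorm_lt_top (h : IsFourierSol g w) (hg : Measurable g)
    (hf : weightNorm g < ∞) (P : DyadicPartition) {q : ℝ} (hq : 1 < q)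
    (hs : |2 / q - 1| ≤ 1) {u : ℝ → VField} {F : Vec → C3} (hF : Measurable F)
    (hF2 : ∀ v, ‖F v‖ₑ ≤ 2 * ‖v‖ₑ)
    (hu : ∀ t, 0 ≤ t → HasFourierDensity (u t) (F ∘ w t)) :
    chNorm P (ENNReal.ofReal q) (2 / q - 1) 1 2 u < ∞ := by
  unfold chNorm
  refine (seqNorm_two_le_tsum _).trans_lt (lt_of_le_of_lt (ENNReal.tsum_le_tsum fun j =>
    h.two_rpow_mul_blockNorm_le hg P hq hs j hF hF2 hu) ?_)
  have hm2 := measurable_absConv h.measurable h.measurable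
  have hm3 : Measurable fun ξ => ∫⁻ τ in Ioi (0 : ℝ), absConv (w τ) (w τ) ξ :=
    Measurable.lintegral_prod_left' hm2
  have hm1 : Measurable fun ξ : E3 => ‖ξ‖ₑ⁻¹ * ‖g ξ‖ₑ := measurable_enorm.inv.mul hg.enorm
  rw [ENNReal.tsum_mul_left, ENNReal.tsum_add, ENNReal.tsum_mul_left, ENNReal.tsum_mul_left,
    tsum_lintegral_blockWeight P hm1, tsum_lintegral_blockWeight P hm3,
    ← lintegral_lintegral_swap hm2.aemeasurable]
  refine ENNReal.mul_lt_top (by simp) (ENNReal.add_lt_top.2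
    ⟨ENNReal.mul_lt_top (by simp) hf, ENNReal.mul_lt_top (by simp) ?_⟩)
  exact (lintegral_absConv_le _ h.measurable h.measurable).trans_lt
    (ENNReal.mul_lt_top h.finite h.finite)

theorem IsFourierSol.isGlobalSolution (h : IsFourierSol g w) (hg : Measurable g)
    (hf : weightNorm g < ∞) (P : DyadicPartition) {α : ℝ} (hα : α ∈ Ioo (0 : ℝ) 1) :
    IsGlobalSolution P α (stateOf g) fun t => stateOf (w t) := by
  obtain ⟨h0, h1⟩ := hα
  have hmem : ∀ s : ℝ, |s| < 1 → MemCh P (ENNReal.ofReal (2 / (1 + s))) s 1 2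
      fun t => stateOf (w t) := by
    intro s hs
    obtain ⟨hs1, hs2⟩ := abs_lt.1 hs
    have hpos : 0 < 1 + s := by linarith
    have e : 2 / (2 / (1 + s)) - 1 = s := by field_simp; ring
    have hq : 1 < 2 / (1 + s) := by rw [lt_div_iff₀ hpos]; linarith
    have hs' : |2 / (2 / (1 + s)) - 1| ≤ 1 := by rw [e]; exact hs.le
    constructor
    · have := h.chNorm_lt_top hg hf P hq hs' (u := fun t => (stateOf (w t)).1) measurable_vel
        enorm_vel_le fun t ht => stateOf_fst (h.measurable_slice t) (h.weightNorm_lt_top hg hf ht)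
      rwa [e] at this
    · have := h.chNorm_lt_top hg hf P hq hs' (u := fun t => (stateOf (w t)).2) measurable_rot
        enorm_rot_le fun t ht => stateOf_snd (h.measurable_slice t) (h.weightNorm_lt_top hg hf ht)
      rwa [e] at this
  exact ⟨h.isMildSolution hg hf, h.isContinuousIn hg hf P, hmem α (by rw [abs_of_pos h0]; exact h1),
    by simpa [sub_eq_add_neg] using hmem (-α) (by rw [abs_neg, abs_of_pos h0]; exact h1)⟩

end

/-! ### Symmetries of the solutions: real-valued and divergence-free fields -/

section
variable {g : E3 → Vec} {w : ℝ → E3 → Vec}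

theorem star_symG_mulVec (t : ℝ) (ξ : E3) (v : Vec) :
    star ((symG t (-ξ)).mulVec v) = (symG t ξ).mulVec (star v) := by
  rw [starRingEnd_symG]
  funext i
  simp [Matrix.mulVec, dotProduct]

/-- Complex conjugation in physical space maps solutions to solutions. -/
theorem IsFourierSol.conj (h : IsFourierSol g w) (hg : ∀ ξ, g (-ξ) = star (g ξ)) :
    IsFourierSol g fun t ξ => star (w t (-ξ)) where
  measurable := by
    have h1 : Measurable fun p : ℝ × E3 => w p.1 (-p.2) :=
      h.measurable.comp (f := fun p : ℝ × E3 => (p.1, -p.2)) (by fun_prop)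
    exact continuous_star.measurable.comp h1
  finite := by
    refine lt_of_le_of_lt (le_of_eq ?_) h.finite
    unfold wNorm mixNorm
    congr 1
    refine lintegral_congr fun t => ?_
    congr 1
    rw [← lintegral_neg_eq_self (fun ξ => ‖w t ξ‖ₑ)]
    refine lintegral_congr fun ξ => ?_
    change ‖star (w t (-ξ))‖ₑ = ‖w t (-ξ)‖ₑ
    rw [← ofReal_norm, ← ofReal_norm, norm_star]
  eq t ht ξ := by
    rw [h.eq t ht (-ξ), star_sub, linFlow, linFlow, star_symG_mulVec, hg, star_star]
    congr 1
    unfold duhamel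
    rw [intervalIntegral.integral_of_le ht, intervalIntegral.integral_of_le ht]
    have := (starL' ℝ : Vec ≃L[ℝ] Vec).integral_comp_comm (μ := volume.restrict (Ioc 0 t))
      (fun τ => (symG (t - τ) (-ξ)).mulVec (quad (w τ) (-ξ)))
    simp only [starL'_apply] at this
    rw [← this]
    refine integral_congr_ae (ae_of_all _ fun τ => ?_)
    simp only
    rw [star_symG_mulVec, quad_star]

/-- By uniqueness, the solution inherits the symmetry of the datum. -/
theorem IsFourierSol.neg_eq_star (h : IsFourierSol g w) (hg : ∀ ξ, g (-ξ) = star (g ξ)) {t : ℝ}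
    (ht : 0 ≤ t) : ∀ᵐ ξ, w t (-ξ) = star (w t ξ) := by
  filter_upwards [h.unique (h.conj hg) ht] with ξ hξ
  rw [hξ, star_star]

theorem IsFourierSol.longitudinal (h : IsFourierSol g w)
    (hg : ∀ ξ, ∑ i : Fin 3, (ξ i : ℂ) * g ξ (.inl i) = 0) {t : ℝ} (ht : 0 ≤ t) :
    ∀ᵐ ξ, ∑ i : Fin 3, (ξ i : ℂ) * w t ξ (.inl i) = 0 := by
  filter_upwards [ae_isGoodFreq h.measurable h.finite] with ξ hξ
  set L : Vec →L[ℂ] ℂ := ∑ i : Fin 3, (ξ i : ℂ) • ContinuousLinearMap.proj (Sum.inl i) with hL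
  have hLa : ∀ v : Vec, ∑ i : Fin 3, (ξ i : ℂ) * v (.inl i) = L v := fun v => by simp [hL]
  rw [hLa, h.eq t ht, map_sub, ← hLa, linFlow, symG_mulVec_longitudinal _ _ _ (hg ξ), zero_sub,
    neg_eq_zero, duhamel, ← L.intervalIntegral_comp_comm (hξ.intervalIntegrable h.measurable ht)]
  refine intervalIntegral.integral_zero_ae (ae_of_all _ fun τ _ => ?_)
  rw [← hLa, symG_mulVec_longitudinal _ _ _ (quad_longitudinal _ _)]

theorem isRealField_stateOf (hg : Measurable g) (hf : weightNorm g < ∞)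
    (hs : ∀ᵐ ξ, g (-ξ) = star (g ξ)) : IsRealField (stateOf g).1 ∧ IsRealField (stateOf g).2 := by
  refine ⟨(stateOf_fst hg hf).isRealField ?_, (stateOf_snd hg hf).isRealField ?_⟩ <;>
  · filter_upwards [hs] with ξ hξ i
    simp [hξ]

theorem isDivFree_stateOf (hg : Measurable g) (hf : weightNorm g < ∞)
    (hs : ∀ᵐ ξ : E3, ∑ i : Fin 3, (ξ i : ℂ) * g ξ (.inl i) = 0) : IsDivFree (stateOf g).1 :=
  (stateOf_fst hg hf).isDivFree (by filter_upwards [hs] with ξ hξ; exact hξ)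

end

theorem hasFourierDensity_zero : HasFourierDensity 0 0 where
  locallyIntegrable := locallyIntegrable_zero
  integrable φ := by simp
  fourier_eq φ := by
    simp

theorem stateOf_zero : stateOf 0 = 0 := by
  have hf : weightNorm (0 : E3 → Vec) < ∞ := by simp [weightNorm]
  have hv : vel ∘ (0 : E3 → Vec) = 0 := by funext ξ; ext i; simp
  have hr : rot ∘ (0 : E3 → Vec) = 0 := by funext ξ; ext i; simp
  refine Prod.ext ?_ ?_
  · have := stateOf_fst measurable_zero hf
    rw [hv] at this
    exact this.ext hasFourierDensity_zero
  · have := stateOf_snd measurable_zero hf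
    rw [hr] at this
    exact this.ext hasFourierDensity_zero

theorem isFourierSol_zero : IsFourierSol 0 0 where
  measurable := measurable_const
  finite := by simp
  eq t ht ξ := by simp [linFlow]

/-! ### The well-posedness class is contained in `L²(0,∞; L¹_ξ)` -/

theorem tsum_two_rpow_neg_abs_lt_top {α : ℝ} (hα : 0 < α) :
    ∑' n : ℤ, (2 : ℝ≥0∞) ^ (-(|(n : ℝ)| * α)) < ∞ := by
  have e : ∀ n : ℤ, (2 : ℝ≥0∞) ^ (-(|(n : ℝ)| * α)) = ENNReal.ofReal (2 ^ (-(|(n : ℝ)| * α))) := by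
    intro n
    rw [← ENNReal.ofReal_rpow_of_pos (by norm_num)]
    simp
  have hg : ∀ f : ℕ → ℤ, (∀ n, |((f n : ℤ) : ℝ)| = n) →
      Summable fun n : ℕ => (2 : ℝ) ^ (-(|((f n : ℤ) : ℝ)| * α)) := by
    intro f hf
    have : ∀ n : ℕ, (2 : ℝ) ^ (-(|((f n : ℤ) : ℝ)| * α)) = ((2 : ℝ) ^ (-α)) ^ n := by
      intro n
      rw [hf, ← Real.rpow_natCast, ← Real.rpow_mul (by norm_num)]
      congr 1; ring
    simp only [this]
    refine summable_geometric_of_lt_one (by positivity) ?_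
    exact Real.rpow_lt_one_of_one_lt_of_neg (by norm_num) (by linarith)
  simp only [e]
  refine (Summable.tsum_ofReal_lt_top ?_)
  exact Summable.of_nat_of_neg (hg (fun n => n) fun n => by simp) (hg (fun n => -n) fun n => by simp)

/-- The interpolation `L̃^{2/(1+α)} FḂ^α ∩ L̃^{2/(1-α)} FḂ^{-α} ⊂ L² FḂ^0_{1,1}` for the sequence `v`
of the `L¹`-norms of the dyadic blocks. In the product `(∑ v_j)²` the interaction of the blocks `j`
and `k` is bounded by Hölder's inequality, in the order that gains a factor `2^{-α|j-k|}`. -/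
theorem lintegral_tsum_sq_lt_top {α : ℝ} (h0 : 0 < α) (h1 : α < 1) {v : ℤ → ℝ → ℝ≥0∞}
    (hv : ∀ j, AEMeasurable (v j) (volume.restrict (Ioi 0)))
    (hA : ∑' j : ℤ, ((2 : ℝ≥0∞) ^ ((j : ℝ) * α) *
      (∫⁻ t in Ioi (0 : ℝ), v j t ^ (2 / (1 + α))) ^ (1 / (2 / (1 + α)))) ^ (2 : ℝ) < ∞)
    (hB : ∑' j : ℤ, ((2 : ℝ≥0∞) ^ ((j : ℝ) * (-α)) *
      (∫⁻ t in Ioi (0 : ℝ), v j t ^ (2 / (1 - α))) ^ (1 / (2 / (1 - α)))) ^ (2 : ℝ) < ∞) :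
    ∫⁻ t in Ioi (0 : ℝ), (∑' j, v j t) ^ (2 : ℝ) < ∞ := by
  set p := 2 / (1 + α) with hp
  set q := 2 / (1 - α) with hq
  have hpq : p.HolderConjugate q := by
    refine Real.holderConjugate_iff.2 ⟨?_, ?_⟩
    · rw [hp, lt_div_iff₀ (by linarith)]; linarith
    · rw [hp, hq]; field_simp; ring
  set X : ℤ → ℝ≥0∞ := fun j => (∫⁻ t in Ioi (0 : ℝ), v j t ^ p) ^ (1 / p) with hX
  set Y : ℤ → ℝ≥0∞ := fun j => (∫⁻ t in Ioi (0 : ℝ), v j t ^ q) ^ (1 / q) with hY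
  set A : ℤ → ℝ≥0∞ := fun j => (2 : ℝ≥0∞) ^ ((j : ℝ) * α) * X j with hAd
  set B : ℤ → ℝ≥0∞ := fun j => (2 : ℝ≥0∞) ^ ((j : ℝ) * (-α)) * Y j with hBd
  set C : ℤ → ℝ≥0∞ := fun j => A j ^ (2 : ℝ) + B j ^ (2 : ℝ) with hC
  have hCf : ∑' j, C j < ∞ := by
    rw [hC, ENNReal.tsum_add]
    exact ENNReal.add_lt_top.2 ⟨hA, hB⟩
  set θ : ℤ → ℝ≥0∞ := fun n => (2 : ℝ≥0∞) ^ (-(|(n : ℝ)| * α)) with hθ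
  have h2 : ∀ x y : ℝ, (2 : ℝ≥0∞) ^ x * (2 : ℝ≥0∞) ^ y = (2 : ℝ≥0∞) ^ (x + y) := fun x y =>
    (ENNReal.rpow_add _ _ (by simp) (by simp)).symm
  have hxy : ∀ x y : ℝ≥0∞, x * y ≤ x ^ (2 : ℝ) + y ^ (2 : ℝ) := by
    intro x y
    rw [ENNReal.rpow_two, ENNReal.rpow_two, sq, sq]
    rcases le_total x y with h | h
    · exact (mul_le_mul_left h y).trans le_add_self
    · exact (mul_le_mul_right h x).trans le_self_add
  have hle : ∀ j k : ℤ, ∫⁻ t in Ioi (0 : ℝ), v j t * v k t ≤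
      (2 : ℝ≥0∞) ^ (((k : ℝ) - j) * α) * (C j + C k) := by
    intro j k
    calc _ ≤ X j * Y k := ENNReal.lintegral_mul_le_Lp_mul_Lq _ hpq (hv j) (hv k)
      _ = (2 : ℝ≥0∞) ^ (((k : ℝ) - j) * α) * (A j * B k) := by
          have e : (2 : ℝ≥0∞) ^ (((k : ℝ) - j) * α) * ((2 : ℝ≥0∞) ^ ((j : ℝ) * α) *
              (2 : ℝ≥0∞) ^ ((k : ℝ) * (-α))) = 1 := by
            rw [h2, h2, ← ENNReal.rpow_zero (x := 2)]
            congr 1; ring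
          calc X j * Y k = 1 * (X j * Y k) := (one_mul _).symm
            _ = _ := by rw [← e]; simp only [hAd, hBd]; ring
      _ ≤ _ := by
          gcongr
          exact (hxy _ _).trans (add_le_add le_self_add le_add_self)
  -- the exponents are exchanged if `j ≤ k`, so that the power of two is always at most one
  have hle' : ∀ j k : ℤ, ∫⁻ t in Ioi (0 : ℝ), v j t * v k t ≤ θ (j - k) * (C j + C k) := by
    intro j k
    rcases le_total j k with h | h
    · have := hle k j
      simp only [mul_comm (v k _)] at this
      rw [add_comm (C k)] at this
      refine this.trans (le_of_eq ?_)
      have h' : (j : ℝ) ≤ k := by exact_mod_cast h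
      simp only [hθ]
      congr 2
      push_cast
      rw [abs_of_nonpos (by linarith)]; ring
    · refine (hle j k).trans (le_of_eq ?_)
      have h' : (k : ℝ) ≤ j := by exact_mod_cast h
      simp only [hθ]
      congr 2
      push_cast
      rw [abs_of_nonneg (by linarith)]; ring
  have hsq : ∀ t, (∑' j, v j t) ^ (2 : ℝ) = ∑' j, ∑' k, v j t * v k t := by
    intro t
    simp only [ENNReal.tsum_mul_left, ENNReal.tsum_mul_right]
    rw [ENNReal.rpow_two, sq]
  simp only [hsq]
  have hvv : ∀ j k, AEMeasurable (fun t => v j t * v k t) (volume.restrict (Ioi 0)) := fun j k =>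
    (hv j).mul (hv k)
  rw [lintegral_tsum fun j => AEMeasurable.tsum fun k => hvv j k]
  have hin : ∀ j, ∫⁻ t in Ioi (0 : ℝ), ∑' k, v j t * v k t =
      ∑' k, ∫⁻ t in Ioi (0 : ℝ), v j t * v k t := fun j =>
    lintegral_tsum fun k => hvv j k
  simp only [hin]
  have hΘ := tsum_two_rpow_neg_abs_lt_top h0
  have hs1 : ∀ j : ℤ, ∑' k : ℤ, θ (j - k) = ∑' n, θ n := fun j => (Equiv.subLeft j).tsum_eq θ
  have hs2 : ∀ k : ℤ, ∑' j : ℤ, θ (j - k) = ∑' n, θ n := fun k => (Equiv.subRight k).tsum_eq θ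
  calc _ ≤ ∑' j, ∑' k, θ (j - k) * (C j + C k) :=
        ENNReal.tsum_le_tsum fun j => ENNReal.tsum_le_tsum fun k => hle' j k
    _ = (∑' j, ∑' k, θ (j - k) * C j) + ∑' k, ∑' j, θ (j - k) * C k := by
        rw [ENNReal.tsum_comm (f := fun k j => θ (j - k) * C k), ← ENNReal.tsum_add]
        simp only [← ENNReal.tsum_add, mul_add]
    _ = (∑' n, θ n) * (∑' j, C j) + (∑' n, θ n) * ∑' j, C j := by
        simp only [ENNReal.tsum_mul_right, hs1, hs2, ENNReal.tsum_mul_left]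
    _ < ∞ := ENNReal.add_lt_top.2 ⟨ENNReal.mul_lt_top hΘ hCf, ENNReal.mul_lt_top hΘ hCf⟩

section
variable {P : DyadicPartition} {α : ℝ}

/-- A field in `L̃^{2/(1+α)} FḂ^α_{1,2} ∩ L̃^{2/(1-α)} FḂ^{-α}_{1,2}` has a Fourier transform in
`L²_t L¹_ξ`. -/
theorem mixNorm_lt_top_of_chNorm (h0 : 0 < α) (h1 : α < 1) {u : ℝ → VField} {a : ℝ → E3 → C3}
    {h : ℝ → E3 → ℝ≥0∞} (hh : Measurable (Function.uncurry h))
    (hu : ∀ t, 0 ≤ t → HasFourierDensity (u t) (a t))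
    (hah : ∀ᵐ t ∂(volume.restrict (Ioi (0 : ℝ))), ∀ᵐ ξ, ‖a t ξ‖ₑ = h t ξ)
    (hA : chNorm P (ENNReal.ofReal (2 / (1 + α))) α 1 2 u < ∞)
    (hB : chNorm P (ENNReal.ofReal (2 / (1 - α))) (-α) 1 2 u < ∞) :
    mixNorm (Ioi 0) h < ∞ := by
  set v : ℤ → ℝ → ℝ≥0∞ := fun j t => ∫⁻ ξ, blockWeight P j ξ * h t ξ with hv
  have hvm : ∀ j, Measurable (v j) := fun j => by
    have : Measurable fun p : ℝ × E3 => blockWeight P j p.2 * h p.1 p.2 :=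
      ((measurable_blockWeight P j).comp measurable_snd).mul hh
    exact Measurable.lintegral_prod_right' this
  have hbv : ∀ j, (fun t => blockNorm P 1 j (u t)) =ᵐ[volume.restrict (Ioi 0)] v j := by
    intro j
    filter_upwards [hah, ae_restrict_mem measurableSet_Ioi] with t ht ht0
    rw [(hu t (mem_Ioi.1 ht0).le).blockNorm_eq]
    refine lintegral_congr_ae ?_
    filter_upwards [ht] with ξ hξ
    rw [hξ]
  have key : ∀ {q s : ℝ}, 0 < q → chNorm P (ENNReal.ofReal q) s 1 2 u < ∞ →
      ∑' j : ℤ, ((2 : ℝ≥0∞) ^ ((j : ℝ) * s) *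
        (∫⁻ t in Ioi (0 : ℝ), v j t ^ q) ^ (1 / q)) ^ (2 : ℝ) < ∞ := by
    intro q s hq hc
    rw [chNorm, seqNorm, if_neg (by simp), ENNReal.rpow_lt_top_iff_of_pos (by simp)] at hc
    refine lt_of_le_of_lt (le_of_eq ?_) hc
    refine tsum_congr fun j => ?_
    rw [eLpNorm_congr_ae (hbv j), eLpNorm_eq_lintegral_rpow_enorm_toReal (by simpa using hq)
      (by simp), ENNReal.toReal_ofReal hq.le]
    simp
  have := lintegral_tsum_sq_lt_top h0 h1 (fun j => (hvm j).aemeasurable)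
    (key (by have : 0 < 1 + α := by linarith
             positivity) hA) (key (by have : 0 < 1 - α := by linarith
                                      positivity) hB)
  refine (ENNReal.rpow_lt_top_iff_of_pos (y := (2 : ℝ)) (by norm_num)).1 ?_
  rw [mixNorm_rpow_two]
  refine lt_of_le_of_lt (le_of_eq ?_) this
  refine lintegral_congr fun t => ?_
  rw [tsum_lintegral_blockWeight P hh.of_uncurry_left]

theorem nonlin_congr {a a' b b' : E3 → C3} (ha : a =ᵐ[volume] a') (hb : b =ᵐ[volume] b') (ξ : E3) :
    nonlin a b ξ = nonlin a' b' ξ := by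
  have h := quad_congr (w := fun η => join (a η) (b η)) (w' := fun η => join (a' η) (b' η)) (by
    filter_upwards [ha, hb] with η h1 h2
    rw [h1, h2]) ξ
  exact h

/-- The Fourier transform of a mild solution in the well-posedness class is, up to null sets, a solution
in `L²(0,∞; L¹_ξ)`. -/
theorem IsGlobalSolution.exists_isFourierSol {g : E3 → Vec} {V : ℝ → State} (hg : Measurable g)
    (hf : weightNorm g < ∞) (hα : α ∈ Ioo (0 : ℝ) 1) (hV : IsGlobalSolution P α (stateOf g) V) :
    ∃ w, IsFourierSol g w ∧ ∀ t, 0 ≤ t →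
      HasFourierDensity (V t).1 (vel ∘ w t) ∧ HasFourierDensity (V t).2 (rot ∘ w t) := by
  obtain ⟨hV0, a, b, ham, hbm, hd, -, heq⟩ := hV.mild
  set m : ℝ → E3 → Vec := fun t ξ => join (ham.mk _ (t, ξ)) (hbm.mk _ (t, ξ)) with hm
  have hmm : Measurable (Function.uncurry m) := by
    refine measurable_pi_iff.2 fun i => ?_
    rcases i with i | i
    · have : Measurable fun z : ℝ × E3 => ham.mk _ z i :=
        (EuclideanSpace.proj i : C3 →L[ℂ] ℂ).continuous.measurable.comp
          ham.stronglyMeasurable_mk.measurable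
      exact this
    · have : Measurable fun z : ℝ × E3 => hbm.mk _ z i :=
        (EuclideanSpace.proj i : C3 →L[ℂ] ℂ).continuous.measurable.comp
          hbm.stronglyMeasurable_mk.measurable
      exact this
  have hae : ∀ᵐ t ∂(volume.restrict (Ioi (0 : ℝ))), a t =ᵐ[volume] (vel ∘ m t) := by
    filter_upwards [Measure.ae_ae_of_ae_prod ham.ae_eq_mk] with t ht
    filter_upwards [ht] with ξ hξ
    rw [hξ]; rfl
  have hbe : ∀ᵐ t ∂(volume.restrict (Ioi (0 : ℝ))), b t =ᵐ[volume] (rot ∘ m t) := by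
    filter_upwards [Measure.ae_ae_of_ae_prod hbm.ae_eq_mk] with t ht
    filter_upwards [ht] with ξ hξ
    rw [hξ]; rfl
  have hfin : wNorm (Ioi 0) m < ∞ := by
    have hm1 : Measurable (Function.uncurry fun t ξ => ‖vel (m t ξ)‖ₑ) :=
      (measurable_vel.comp hmm).enorm
    have hm2 : Measurable (Function.uncurry fun t ξ => ‖rot (m t ξ)‖ₑ) :=
      (measurable_rot.comp hmm).enorm
    refine lt_of_le_of_lt ((mixNorm_mono fun t ξ => enorm_le_vel_add_rot (m t ξ)).trans
      (mixNorm_add_le (Ioi 0) hm1 hm2)) (ENNReal.add_lt_top.2 ⟨?_, ?_⟩)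
    · refine mixNorm_lt_top_of_chNorm hα.1 hα.2 hm1 (fun t ht => (hd t ht).1) ?_ hV.memCh_pos.1
        hV.memCh_neg.1
      filter_upwards [hae] with t ht
      filter_upwards [ht] with ξ hξ
      rw [hξ]; rfl
    · refine mixNorm_lt_top_of_chNorm hα.1 hα.2 hm2 (fun t ht => (hd t ht).2) ?_ hV.memCh_pos.2
        hV.memCh_neg.2
      filter_upwards [hbe] with t ht
      filter_upwards [ht] with ξ hξ
      rw [hξ]; rfl
  -- the densities of the initial value
  have h0 : ∀ᵐ ξ, join (a 0 ξ) (b 0 ξ) = g ξ := by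
    have h1 := hd 0 le_rfl
    rw [hV0] at h1
    filter_upwards [h1.1.unique (stateOf_fst hg hf), h1.2.unique (stateOf_snd hg hf)] with ξ e1 e2
    rw [e1, e2]
    exact join_vel_rot _
  have hw : ∀ t, 0 ≤ t → ∀ᵐ ξ, join (a t ξ) (b t ξ) = (linFlow g - duhamel m) t ξ := by
    intro t ht
    filter_upwards [heq t ht, h0] with ξ h1 h2
    rw [h1.2, h2]
    change _ = linFlow g t ξ - duhamel m t ξ
    congr 1
    unfold duhamel
    rw [intervalIntegral.integral_of_le ht, intervalIntegral.integral_of_le ht]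
    refine integral_congr_ae ?_
    filter_upwards [ae_restrict_of_ae_restrict_of_subset Ioc_subset_Ioi_self hae,
      ae_restrict_of_ae_restrict_of_subset Ioc_subset_Ioi_self hbe] with τ e1 e2
    rw [nonlin_congr e1 e2]
    rfl
  refine ⟨linFlow g - duhamel m, IsFourierSol.of_ae hg hmm hfin ?_, fun t ht => ⟨?_, ?_⟩⟩
  · filter_upwards [hae, hbe, ae_restrict_mem measurableSet_Ioi] with t h1 h2 ht
    filter_upwards [h1, h2, hw t (mem_Ioi.1 ht).le] with ξ e1 e2 e3
    rw [← e3, e1, e2]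
    exact (join_vel_rot _).symm
  · refine (hd t ht).1.congr ?_
    filter_upwards [hw t ht] with ξ hξ
    simp only [Function.comp_apply, ← hξ]
    rfl
  · refine (hd t ht).2.congr ?_
    filter_upwards [hw t ht] with ξ hξ
    simp only [Function.comp_apply, ← hξ]
    rfl

/-- Uniqueness in the well-posedness class, from uniqueness in `L²(0,∞; L¹_ξ)`. -/
theorem IsFourierSol.eq_stateOf {g : E3 → Vec} {w : ℝ → E3 → Vec} {V : ℝ → State}
    (h : IsFourierSol g w) (hg : Measurable g) (hf : weightNorm g < ∞) (hα : α ∈ Ioo (0 : ℝ) 1)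
    (hV : IsGlobalSolution P α (stateOf g) V) {t : ℝ} (ht : 0 ≤ t) : V t = stateOf (w t) := by
  obtain ⟨w', h', hd⟩ := hV.exists_isFourierSol hg hf hα
  have he := h'.unique h ht
  have hm := h.measurable_slice t
  have hwt := h.weightNorm_lt_top hg hf ht
  refine Prod.ext (HasFourierDensity.ext ((hd t ht).1.congr ?_) (stateOf_fst hm hwt))
    (HasFourierDensity.ext ((hd t ht).2.congr ?_) (stateOf_snd hm hwt)) <;>
  · filter_upwards [he] with ξ hξ
    simp [hξ]

end

/-! ### Lacunary initial data -/

/-- The first family of frequencies: near `± M^{k+1} e₀` for `k < K`. -/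
def nearSet (M : ℝ) (K : ℕ) : Set E3 :=
  {ξ | (∃ k < K, |(|ξ 0| - M ^ (k + 1))| ≤ 1 / 8) ∧ |ξ 1| ≤ 1 / 8 ∧ |ξ 2| ≤ 1 / 8}

/-- The second family of frequencies: near `± M^{k+1} e₀ ± e₁` for `k < K`. -/
def shiftSet (M : ℝ) (K : ℕ) : Set E3 :=
  {ξ | (∃ k < K, |(|ξ 0| - M ^ (k + 1))| ≤ 1 / 8) ∧ |(|ξ 1| - 1)| ≤ 1 / 8 ∧ |ξ 2| ≤ 1 / 8}

/-- The part of the frequency space at the scale `M^{k+1}` that contains the above frequencies. -/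
def shell (M : ℝ) (k : ℕ) : Set E3 :=
  {ξ | |(|ξ 0| - M ^ (k + 1))| ≤ 1 / 8 ∧ |ξ 1| ≤ 2 ∧ |ξ 2| ≤ 1 / 8}

/-- The indicator function of `nearSet M K`. -/
def nearInd (M : ℝ) (K : ℕ) : E3 → ℝ := (nearSet M K).indicator 1

/-- The indicator function of `shiftSet M K`. -/
def shiftInd (M : ℝ) (K : ℕ) : E3 → ℝ := (shiftSet M K).indicator 1

/-- The polarization of the data: `ξ × e₂` on the first and `ξ × e₁` on the second family of
frequencies. -/
def polar (M : ℝ) (K : ℕ) (ξ : E3) : Fin 3 → ℝ :=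
  ![nearInd M K ξ * ξ 1 - shiftInd M K ξ * ξ 2, -(nearInd M K ξ * ξ 0), shiftInd M K ξ * ξ 0]

/-- The Fourier transform of the initial data: linear and micro-rotation velocity are both equal to
`i c` times the polarization. -/
def lacunary (c M : ℝ) (K : ℕ) (ξ : E3) : Vec :=
  Sum.elim (fun i => Complex.I * c * polar M K ξ i) fun i => Complex.I * c * polar M K ξ i

theorem measurable_coord (i : Fin 3) : Measurable fun ξ : E3 => ξ i :=
  (EuclideanSpace.proj i : E3 →L[ℝ] ℝ).continuous.measurable

theorem measurableSet_scales (M : ℝ) (K : ℕ) :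
    MeasurableSet {ξ : E3 | ∃ k < K, |(|ξ 0| - M ^ (k + 1))| ≤ 1 / 8} := by
  have : {ξ : E3 | ∃ k < K, |(|ξ 0| - M ^ (k + 1))| ≤ 1 / 8} =
      ⋃ k, ⋃ _ : k < K, {ξ : E3 | |(|ξ 0| - M ^ (k + 1))| ≤ 1 / 8} := by
    ext ξ; simp
  rw [this]
  refine MeasurableSet.iUnion fun k => MeasurableSet.iUnion fun _ => ?_
  exact measurableSet_le (((measurable_coord 0).abs.sub_const _).abs) measurable_const

theorem measurableSet_nearSet (M : ℝ) (K : ℕ) : MeasurableSet (nearSet M K) :=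
  (measurableSet_scales M K).inter ((measurableSet_le (measurable_coord 1).abs measurable_const).inter
    (measurableSet_le (measurable_coord 2).abs measurable_const))

theorem measurableSet_shiftSet (M : ℝ) (K : ℕ) : MeasurableSet (shiftSet M K) :=
  (measurableSet_scales M K).inter
    ((measurableSet_le (((measurable_coord 1).abs.sub_const _).abs) measurable_const).inter
    (measurableSet_le (measurable_coord 2).abs measurable_const))

theorem measurableSet_shell (M : ℝ) (k : ℕ) : MeasurableSet (shell M k) :=
  (measurableSet_le (((measurable_coord 0).abs.sub_const _).abs) measurable_const).inter
    ((measurableSet_le (measurable_coord 1).abs measurable_const).inter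
    (measurableSet_le (measurable_coord 2).abs measurable_const))

theorem measurable_nearInd (M : ℝ) (K : ℕ) : Measurable (nearInd M K) :=
  measurable_one.indicator (measurableSet_nearSet M K)

theorem measurable_shiftInd (M : ℝ) (K : ℕ) : Measurable (shiftInd M K) :=
  measurable_one.indicator (measurableSet_shiftSet M K)

theorem nearInd_neg (M : ℝ) (K : ℕ) (ξ : E3) : nearInd M K (-ξ) = nearInd M K ξ := by
  have : -ξ ∈ nearSet M K ↔ ξ ∈ nearSet M K := by simp [nearSet]
  by_cases h : ξ ∈ nearSet M K
  · simp [nearInd, indicator_of_mem h, indicator_of_mem (this.2 h)]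
  · simp [nearInd, indicator_of_notMem h, indicator_of_notMem (this.not.2 h)]

theorem shiftInd_neg (M : ℝ) (K : ℕ) (ξ : E3) : shiftInd M K (-ξ) = shiftInd M K ξ := by
  have : -ξ ∈ shiftSet M K ↔ ξ ∈ shiftSet M K := by simp [shiftSet]
  by_cases h : ξ ∈ shiftSet M K
  · simp [shiftInd, indicator_of_mem h, indicator_of_mem (this.2 h)]
  · simp [shiftInd, indicator_of_notMem h, indicator_of_notMem (this.not.2 h)]

theorem nearInd_nonneg (M : ℝ) (K : ℕ) (ξ : E3) : 0 ≤ nearInd M K ξ :=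
  indicator_nonneg (fun _ _ => zero_le_one) ξ

theorem shiftInd_nonneg (M : ℝ) (K : ℕ) (ξ : E3) : 0 ≤ shiftInd M K ξ :=
  indicator_nonneg (fun _ _ => zero_le_one) ξ

theorem nearInd_le_one (M : ℝ) (K : ℕ) (ξ : E3) : nearInd M K ξ ≤ 1 :=
  indicator_le_self' (fun _ _ => zero_le_one) ξ

theorem shiftInd_le_one (M : ℝ) (K : ℕ) (ξ : E3) : shiftInd M K ξ ≤ 1 :=
  indicator_le_self' (fun _ _ => zero_le_one) ξ

section
variable {c M : ℝ} {K : ℕ}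

theorem measurable_polar (M : ℝ) (K : ℕ) (i : Fin 3) : Measurable fun ξ => polar M K ξ i := by
  have h1 := measurable_nearInd M K
  have h2 := measurable_shiftInd M K
  fin_cases i
  · exact (h1.mul (measurable_coord 1)).sub (h2.mul (measurable_coord 2))
  · exact (h1.mul (measurable_coord 0)).neg
  · exact h2.mul (measurable_coord 0)

theorem measurable_lacunary (c M : ℝ) (K : ℕ) : Measurable (lacunary c M K) := by
  refine measurable_pi_iff.2 fun i => ?_
  rcases i with i | i
  all_goals exact (Complex.measurable_ofReal.comp (measurable_polar M K i)).const_mul _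

theorem polar_neg (M : ℝ) (K : ℕ) (ξ : E3) (i : Fin 3) : polar M K (-ξ) i = -polar M K ξ i := by
  fin_cases i <;> simp [polar, nearInd_neg, shiftInd_neg]
  ring

theorem lacunary_neg (c M : ℝ) (K : ℕ) (ξ : E3) :
    lacunary c M K (-ξ) = star (lacunary c M K ξ) := by
  funext i
  rcases i with i | i <;> simp [lacunary, polar_neg]

theorem lacunary_longitudinal (c M : ℝ) (K : ℕ) (ξ : E3) :
    ∑ i : Fin 3, (ξ i : ℂ) * lacunary c M K ξ (.inl i) = 0 := by
  simp [lacunary, polar, Fin.sum_univ_three]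
  ring

theorem abs_polar_le (M : ℝ) (K : ℕ) (ξ : E3) (i : Fin 3) : |polar M K ξ i| ≤ 2 * ‖ξ‖ := by
  have h : ∀ {x : ℝ} {j : Fin 3}, 0 ≤ x → x ≤ 1 → |x * ξ j| ≤ ‖ξ‖ := by
    intro x j h0 h1
    rw [abs_mul, abs_of_nonneg h0]
    exact (mul_le_of_le_one_left (abs_nonneg _) h1).trans (abs_apply_le_norm ξ j)
  have n1 : ∀ j, |nearInd M K ξ * ξ j| ≤ ‖ξ‖ := fun j => h (nearInd_nonneg _ _ _) (nearInd_le_one _ _ _)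
  have n2 : ∀ j, |shiftInd M K ξ * ξ j| ≤ ‖ξ‖ := fun j =>
    h (shiftInd_nonneg _ _ _) (shiftInd_le_one _ _ _)
  have := norm_nonneg ξ
  fin_cases i
  · exact (abs_sub _ _).trans (by linarith [n1 1, n2 2])
  · change |-(nearInd M K ξ * ξ 0)| ≤ _
    rw [abs_neg]
    linarith [n1 0]
  · change |shiftInd M K ξ * ξ 0| ≤ _
    linarith [n2 0]

theorem norm_lacunary_le (hc : 0 ≤ c) (M : ℝ) (K : ℕ) (ξ : E3) :
    ‖lacunary c M K ξ‖ ≤ 2 * c * ‖ξ‖ := by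
  rw [pi_norm_le_iff_of_nonneg (by positivity)]
  have : ∀ i, ‖Complex.I * c * polar M K ξ i‖ ≤ 2 * c * ‖ξ‖ := by
    intro i
    rw [norm_mul, norm_mul, Complex.norm_I, one_mul, Complex.norm_real, Complex.norm_real,
      Real.norm_eq_abs, Real.norm_eq_abs, abs_of_nonneg hc]
    nlinarith [abs_polar_le M K ξ i]
  rintro (i | i) <;> exact this i

theorem exists_mem_shell_of_lacunary_ne_zero {ξ : E3} (h : lacunary c M K ξ ≠ 0) :
    ∃ k < K, ξ ∈ shell M k := by
  by_cases h1 : ξ ∈ nearSet M K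
  · obtain ⟨⟨k, hk, h0⟩, h1, h2⟩ := h1
    exact ⟨k, hk, h0, h1.trans (by norm_num), h2⟩
  by_cases h2 : ξ ∈ shiftSet M K
  · obtain ⟨⟨k, hk, h0⟩, h1, h2⟩ := h2
    refine ⟨k, hk, h0, ?_, h2⟩
    have := (abs_le.1 h1).2
    linarith
  · refine absurd ?_ h
    funext i
    rcases i with i | i <;> fin_cases i <;>
      simp [lacunary, polar, nearInd, shiftInd, indicator_of_notMem h1, indicator_of_notMem h2]

theorem norm_le_of_mem_shell (hM : 16 ≤ M) {k : ℕ} {ξ : E3} (h : ξ ∈ shell M k) :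
    M ^ (k + 1) / 2 ≤ ‖ξ‖ ∧ ‖ξ‖ ≤ 2 * M ^ (k + 1) := by
  obtain ⟨h0, h1, h2⟩ := h
  have hm : 16 ≤ M ^ (k + 1) := hM.trans (le_self_pow₀ (by linarith) (by simp))
  obtain ⟨h0a, h0b⟩ := abs_le.1 h0
  constructor
  · linarith [abs_apply_le_norm ξ 0]
  · have h3 : ‖ξ‖ ≤ |ξ 0| + |ξ 1| + |ξ 2| := by
      refine abs_le_of_sq_le_sq' ?_ (by positivity) |>.2
      rw [norm_sq_eq, ← sq_abs (ξ 0), ← sq_abs (ξ 1), ← sq_abs (ξ 2)]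
      nlinarith [abs_nonneg (ξ 0), abs_nonneg (ξ 1), abs_nonneg (ξ 2),
        mul_nonneg (abs_nonneg (ξ 0)) (abs_nonneg (ξ 1)),
        mul_nonneg (abs_nonneg (ξ 0)) (abs_nonneg (ξ 2)),
        mul_nonneg (abs_nonneg (ξ 1)) (abs_nonneg (ξ 2))]
    linarith

/-- An upper bound for the volume of the shells. -/
def shellVol : ℝ := 2 * (volume (Metric.ball (0 : E3) 4)).toReal

theorem shellVol_nonneg : 0 ≤ shellVol := by unfold shellVol; positivity

theorem volume_shell_le (M : ℝ) (k : ℕ) : volume (shell M k) ≤ ENNReal.ofReal shellVol := by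
  set p : E3 := EuclideanSpace.single 0 (M ^ (k + 1)) with hp
  have hsub : shell M k ⊆ Metric.ball p 4 ∪ Metric.ball (-p) 4 := by
    rintro ξ ⟨h0, h1, h2⟩
    have key : ∀ q : E3, |ξ 0 - q 0| ≤ 1 / 8 → q 1 = 0 → q 2 = 0 → ξ ∈ Metric.ball q 4 := by
      intro q e0 e1 e2
      rw [mem_ball_iff_norm]
      refine abs_lt_of_sq_lt_sq' ?_ (by norm_num) |>.2
      rw [norm_sq_eq]
      simp only [PiLp.sub_apply, e1, e2, sub_zero]
      have a0 := sq_le_sq' (abs_le.1 e0).1 (abs_le.1 e0).2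
      have a1 := sq_le_sq' (abs_le.1 h1).1 (abs_le.1 h1).2
      have a2 := sq_le_sq' (abs_le.1 h2).1 (abs_le.1 h2).2
      linarith
    rcases le_total 0 (ξ 0) with hs | hs
    · rw [abs_of_nonneg hs] at h0
      exact Or.inl (key p (by simpa [hp] using h0) (by simp [hp]) (by simp [hp]))
    · rw [abs_of_nonpos hs] at h0
      refine Or.inr (key (-p) ?_ (by simp [hp]) (by simp [hp]))
      rw [← abs_neg]
      simp only [hp, PiLp.neg_apply, PiLp.single_apply, if_true]
      convert h0 using 2
      ring
  have hb : ∀ q : E3, volume (Metric.ball q 4) = ENNReal.ofReal (volume (Metric.ball (0 : E3) 4)).toReal := by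
    intro q
    rw [ENNReal.ofReal_toReal measure_ball_lt_top.ne, Measure.addHaar_ball_center]
  refine (measure_mono hsub).trans ((measure_union_le _ _).trans (le_of_eq ?_))
  rw [hb p, hb (-p), ← ENNReal.ofReal_add (by positivity) (by positivity), shellVol, two_mul]

/-- The data are bounded by a sum over the scales. -/
theorem mul_enorm_lacunary_le (hc : 0 ≤ c) (φ : E3 → ℝ≥0∞) (ξ : E3) :
    φ ξ * ‖lacunary c M K ξ‖ₑ ≤
      ∑ k ∈ Finset.range K, (shell M k).indicator (fun ξ => φ ξ * ENNReal.ofReal (2 * c * ‖ξ‖)) ξ := by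
  by_cases h : lacunary c M K ξ = 0
  · simp [h]
  obtain ⟨k, hk, hm⟩ := exists_mem_shell_of_lacunary_ne_zero h
  refine le_trans ?_ (Finset.single_le_sum (f := fun k => (shell M k).indicator
    (fun ξ => φ ξ * ENNReal.ofReal (2 * c * ‖ξ‖)) ξ) (fun _ _ => zero_le) (Finset.mem_range.2 hk))
  simp only [indicator_of_mem hm]
  gcongr
  rw [← ofReal_norm]
  exact ENNReal.ofReal_le_ofReal (norm_lacunary_le hc M K ξ)

theorem lintegral_mul_lacunary_le (hc : 0 ≤ c) {φ : E3 → ℝ≥0∞} (hφ : Measurable φ) :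
    ∫⁻ ξ, φ ξ * ‖lacunary c M K ξ‖ₑ ≤
      ∑ k ∈ Finset.range K, ∫⁻ ξ in shell M k, φ ξ * ENNReal.ofReal (2 * c * ‖ξ‖) := by
  have hm : Measurable fun ξ : E3 => φ ξ * ENNReal.ofReal (2 * c * ‖ξ‖) :=
    hφ.mul (by fun_prop)
  refine (lintegral_mono (mul_enorm_lacunary_le hc φ)).trans (le_of_eq ?_)
  rw [lintegral_finsetSum _ fun k _ => hm.indicator (measurableSet_shell M k)]
  exact Finset.sum_congr rfl fun k _ => lintegral_indicator (measurableSet_shell M k) _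

/-- The square of a sum of terms with lacunary bounds is controlled by its diagonal part, since the
terms before `G k` sum up to at most `M^{k+1}`. -/
theorem sq_sum_le_of_lacunary (hM : 2 ≤ M) {G : ℕ → ℝ} (h0 : ∀ k, 0 ≤ G k)
    (h1 : ∀ k, G k ≤ M ^ (k + 1)) (K : ℕ) :
    (∑ k ∈ Finset.range K, G k) ^ 2 ≤ 3 * ∑ k ∈ Finset.range K, M ^ (k + 1) * G k := by
  have hs : ∀ K, ∑ k ∈ Finset.range K, G k ≤ M ^ (K + 1) := by
    intro K
    induction K with
    | zero => simp; linarith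
    | succ K ih =>
      rw [Finset.sum_range_succ]
      have : 0 ≤ M ^ (K + 1) := by positivity
      calc _ ≤ M ^ (K + 1) + M ^ (K + 1) := add_le_add ih (h1 K)
        _ ≤ M ^ (K + 1 + 1) := by rw [pow_succ M (K + 1)]; nlinarith
  induction K with
  | zero => simp
  | succ K ih =>
    rw [Finset.sum_range_succ, Finset.sum_range_succ]
    nlinarith [h0 K, h1 K, hs K, mul_le_mul_of_nonneg_right (hs K) (h0 K),
      mul_le_mul_of_nonneg_right (h1 K) (h0 K)]

/-- The heat evolution of the data in `L²_t L¹_ξ`: since the scales are lacunary, the squares of the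
contributions of the `K` scales add up. -/
theorem mixNorm_heat_lacunary_le (hc : 0 ≤ c) (hM : 16 ≤ M) :
    mixNorm (Ioi 0) (fun t ξ => ENNReal.ofReal (Real.exp (-(t * ‖ξ‖ ^ 2 / 4))) *
      ‖lacunary c M K ξ‖ₑ) ≤ ENNReal.ofReal (28 * shellVol * (c * √K)) := by
  have hv := shellVol_nonneg
  set G : ℝ → ℕ → ℝ := fun t k => M ^ (k + 1) * Real.exp (-(t * (M ^ (k + 1)) ^ 2 / 16)) with hG
  have hm : ∀ k, 0 < M ^ (k + 1) := fun k => by positivity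
  have hin : ∀ t ∈ Ioi (0 : ℝ), (∫⁻ ξ, ENNReal.ofReal (Real.exp (-(t * ‖ξ‖ ^ 2 / 4))) *
      ‖lacunary c M K ξ‖ₑ) ^ (2 : ℝ) ≤
      ∑ k ∈ Finset.range K, ENNReal.ofReal (48 * (c * shellVol) ^ 2 * (M ^ (k + 1)) ^ 2) *
        ENNReal.ofReal (Real.exp (-((M ^ (k + 1)) ^ 2 / 16 * t))) := by
    intro t ht
    have ht0 : 0 < t := ht
    have h1 : ∫⁻ ξ, ENNReal.ofReal (Real.exp (-(t * ‖ξ‖ ^ 2 / 4))) * ‖lacunary c M K ξ‖ₑ ≤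
        ENNReal.ofReal (4 * c * shellVol * ∑ k ∈ Finset.range K, G t k) := by
      refine (lintegral_mul_lacunary_le hc (by fun_prop)).trans ?_
      rw [Finset.mul_sum, ENNReal.ofReal_sum_of_nonneg fun k _ => by positivity]
      refine Finset.sum_le_sum fun k _ => ?_
      calc _ ≤ ∫⁻ ξ in shell M k, ENNReal.ofReal (4 * c * G t k) := by
            refine setLIntegral_mono' (measurableSet_shell M k) fun ξ hξ => ?_
            obtain ⟨h2, h3⟩ := norm_le_of_mem_shell hM hξ
            rw [← ENNReal.ofReal_mul (by positivity)]
            refine ENNReal.ofReal_le_ofReal ?_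
            calc _ ≤ Real.exp (-(t * (M ^ (k + 1)) ^ 2 / 16)) * (2 * c * (2 * M ^ (k + 1))) := by
                  refine mul_le_mul (Real.exp_le_exp.2 ?_) (by gcongr) (by positivity)
                    (Real.exp_nonneg _)
                  have h4 : (M ^ (k + 1) / 2) ^ 2 ≤ ‖ξ‖ ^ 2 := by gcongr
                  have h5 := mul_le_mul_of_nonneg_left h4 ht0.le
                  linarith
              _ = _ := by simp only [hG]; ring
        _ ≤ ENNReal.ofReal (4 * c * G t k) * ENNReal.ofReal shellVol := by
            rw [setLIntegral_const]
            gcongr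
            exact volume_shell_le M k
        _ = _ := by
            rw [← ENNReal.ofReal_mul (by positivity)]
            congr 1; ring
    have h2 := sq_sum_le_of_lacunary (M := M) (by linarith) (G := G t) (fun k => by positivity)
      (fun k => mul_le_of_le_one_right (hm k).le (Real.exp_le_one_iff.2 (by
        have : 0 ≤ t * (M ^ (k + 1)) ^ 2 / 16 := by positivity
        linarith))) K
    calc _ ≤ (ENNReal.ofReal (4 * c * shellVol * ∑ k ∈ Finset.range K, G t k)) ^ (2 : ℝ) :=
          ENNReal.rpow_le_rpow h1 (by norm_num)
      _ = ENNReal.ofReal ((4 * c * shellVol) ^ 2 * (∑ k ∈ Finset.range K, G t k) ^ 2) := by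
          rw [ENNReal.rpow_two, ← ENNReal.ofReal_pow (by
            have : 0 ≤ ∑ k ∈ Finset.range K, G t k := Finset.sum_nonneg fun k _ => by positivity
            positivity), mul_pow]
      _ ≤ ENNReal.ofReal (∑ k ∈ Finset.range K, 48 * (c * shellVol) ^ 2 * (M ^ (k + 1)) ^ 2 *
            Real.exp (-((M ^ (k + 1)) ^ 2 / 16 * t))) := by
          refine ENNReal.ofReal_le_ofReal ?_
          calc _ ≤ (4 * c * shellVol) ^ 2 * (3 * ∑ k ∈ Finset.range K, M ^ (k + 1) * G t k) := by
                gcongr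
            _ = _ := by
                rw [Finset.mul_sum, Finset.mul_sum]
                refine Finset.sum_congr rfl fun k _ => ?_
                simp only [hG]
                rw [show -((M ^ (k + 1)) ^ 2 / 16 * t) = -(t * (M ^ (k + 1)) ^ 2 / 16) by ring]
                ring
      _ = _ := by
          rw [ENNReal.ofReal_sum_of_nonneg fun k _ => by positivity]
          exact Finset.sum_congr rfl fun k _ => ENNReal.ofReal_mul (by positivity)
  refine (ENNReal.rpow_le_rpow_iff (z := (2 : ℝ)) (by norm_num)).1 ?_
  rw [mixNorm_rpow_two]
  calc _ ≤ ∫⁻ t in Ioi (0 : ℝ), ∑ k ∈ Finset.range K,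
        ENNReal.ofReal (48 * (c * shellVol) ^ 2 * (M ^ (k + 1)) ^ 2) *
        ENNReal.ofReal (Real.exp (-((M ^ (k + 1)) ^ 2 / 16 * t))) :=
        setLIntegral_mono' measurableSet_Ioi hin
    _ = ∑ _k ∈ Finset.range K, ENNReal.ofReal (768 * (c * shellVol) ^ 2) := by
        rw [lintegral_finsetSum _ fun k _ => by fun_prop]
        refine Finset.sum_congr rfl fun k _ => ?_
        rw [lintegral_const_mul _ (by fun_prop), setLIntegral_congr Ioi_ae_eq_Ici,
          lintegral_exp_neg_mul_Ici (by positivity), ← ENNReal.ofReal_mul (by positivity)]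
        congr 1
        have := (hm k).ne'
        field_simp
        ring
    _ = ENNReal.ofReal (K * (768 * (c * shellVol) ^ 2)) := by
        rw [Finset.sum_const, Finset.card_range, nsmul_eq_mul, ENNReal.ofReal_mul (by positivity)]
        simp
    _ ≤ _ := by
        rw [ENNReal.rpow_two, ← ENNReal.ofReal_pow (by positivity)]
        refine ENNReal.ofReal_le_ofReal ?_
        rw [mul_pow, mul_pow, mul_pow, mul_pow c, Real.sq_sqrt (by positivity)]
        -- `768 ≤ 28²`
        have : 0 ≤ c ^ 2 * shellVol ^ 2 * K := by positivity
        nlinarith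

end

/-! ### Norms of the lacunary data -/

section
variable {c M : ℝ} {K : ℕ}

theorem lintegral_weight_lacunary_le (hc : 0 ≤ c) {φ : E3 → ℝ≥0∞} (hφ : Measurable φ) :
    ∫⁻ ξ, φ ξ * (‖ξ‖ₑ⁻¹ * ‖lacunary c M K ξ‖ₑ) ≤
      ∑ k ∈ Finset.range K, ENNReal.ofReal (2 * c) * ∫⁻ ξ in shell M k, φ ξ := by
  have hm : Measurable fun ξ : E3 => φ ξ * ‖ξ‖ₑ⁻¹ := hφ.mul measurable_enorm.inv
  simp only [← mul_assoc]
  refine (lintegral_mul_lacunary_le hc hm).trans (Finset.sum_le_sum fun k _ => ?_)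
  rw [← lintegral_const_mul _ hφ]
  refine lintegral_mono_ae (ae_restrict_of_ae ?_)
  filter_upwards [ae_ne_zero] with ξ hξ
  rw [ENNReal.ofReal_mul (by positivity), ofReal_norm]
  calc _ = ENNReal.ofReal (2 * c) * φ ξ * (‖ξ‖ₑ⁻¹ * ‖ξ‖ₑ) := by ring
    _ ≤ _ := by rw [ENNReal.inv_mul_cancel (by simpa using hξ) (by simp), mul_one]

theorem weightNorm_lacunary_le (hc : 0 ≤ c) :
    weightNorm (lacunary c M K) ≤ ENNReal.ofReal (2 * c * shellVol * K) := by
  have := lintegral_weight_lacunary_le (M := M) (K := K) hc (φ := fun _ => 1) measurable_const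
  simp only [one_mul, setLIntegral_const] at this
  refine this.trans ?_
  calc _ ≤ ∑ _k ∈ Finset.range K, ENNReal.ofReal (2 * c) * ENNReal.ofReal shellVol := by
        gcongr
        exact volume_shell_le M _
    _ = _ := by
        have hv := shellVol_nonneg
        rw [Finset.sum_const, Finset.card_range, nsmul_eq_mul, ← ENNReal.ofReal_mul (by positivity),
          mul_comm, ENNReal.ofReal_mul (p := 2 * c * shellVol) (by positivity),
          ENNReal.ofReal_natCast]

theorem weightNorm_lacunary_lt_top (hc : 0 ≤ c) : weightNorm (lacunary c M K) < ∞ :=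
  (weightNorm_lacunary_le hc).trans_lt ENNReal.ofReal_lt_top

/-- A dyadic annulus meets at most one of the shells. -/
theorem lintegral_blockWeight_lacunary_le (P : DyadicPartition) (hc : 0 ≤ c) (hM : 16 ≤ M) (j : ℤ) :
    ∫⁻ ξ, blockWeight P j ξ * (‖ξ‖ₑ⁻¹ * ‖lacunary c M K ξ‖ₑ) ≤
      ENNReal.ofReal (2 * c * shellVol) := by
  have hone : ∀ k, ∫⁻ ξ in shell M k, blockWeight P j ξ ≤ ENNReal.ofReal shellVol := by
    intro k
    refine le_trans ?_ (volume_shell_le M k)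
    rw [← setLIntegral_one]
    refine lintegral_mono_ae (ae_restrict_of_ae ?_)
    filter_upwards [ae_ne_zero] with ξ hξ
    exact blockWeight_le_one P j hξ
  have hlt : ∀ k l, k < l → ∀ ξ ∈ shell M k, ∀ η ∈ shell M l, blockWeight P j ξ ≠ 0 →
      blockWeight P j η ≠ 0 → False := by
    intro k l hkl ξ hξ η hη h1 h2
    have h1' := (bounds_of_blockWeight_ne_zero P h1).1
    have h2' := (bounds_of_blockWeight_ne_zero P h2).2
    have hξ' := (norm_le_of_mem_shell hM hξ).2
    have hη' := (norm_le_of_mem_shell hM hη).1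
    have hp : (0 : ℝ) < 2 ^ j := by positivity
    have hmm : 16 * M ^ (k + 1) ≤ M ^ (l + 1) := by
      calc 16 * M ^ (k + 1) ≤ M * M ^ (k + 1) := by gcongr
        _ = M ^ (k + 1 + 1) := by ring
        _ ≤ _ := pow_le_pow_right₀ (by linarith) (by omega)
    linarith
  refine (lintegral_weight_lacunary_le hc (measurable_blockWeight P j)).trans ?_
  rw [← Finset.mul_sum, ENNReal.ofReal_mul (p := 2 * c) (by positivity)]
  suffices hsum : ∑ k ∈ Finset.range K, ∫⁻ ξ in shell M k, blockWeight P j ξ ≤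
      ENNReal.ofReal shellVol from mul_le_mul_right hsum _
  by_cases h : ∀ k, ∀ ξ ∈ shell M k, blockWeight P j ξ = 0
  · have hz : ∀ k, ∫⁻ ξ in shell M k, blockWeight P j ξ = 0 := fun k => by
      rw [setLIntegral_congr_fun (measurableSet_shell M k) (h k)]
      simp
    simp [hz]
  · push Not at h
    obtain ⟨k, ξ, hξ, hne⟩ := h
    have hz : ∀ l, l ≠ k → ∫⁻ ξ in shell M l, blockWeight P j ξ = 0 := by
      intro l hl
      have : EqOn (blockWeight P j) (fun _ => 0) (shell M l) := by
        intro η hη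
        by_contra h0
        rcases lt_or_gt_of_ne hl with h' | h'
        · exact hlt l k h' η hη ξ hξ h0 hne
        · exact hlt k l h' ξ hξ η hη hne h0
      rw [setLIntegral_congr_fun (measurableSet_shell M l) this]
      simp
    by_cases hk : k ∈ Finset.range K
    · rw [Finset.sum_eq_single_of_mem k hk fun l _ hl => hz l hl]
      exact hone k
    · rw [Finset.sum_eq_zero fun l hl => hz l fun e => hk (e ▸ hl)]
      exact zero_le

section
variable (P : DyadicPartition) {F : Vec → C3} {u : VField}

theorem two_rpow_mul_blockNorm_lacunary_le (hc : 0 ≤ c) (hM : 16 ≤ M) (hF : Measurable F)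
    (hF2 : ∀ v, ‖F v‖ₑ ≤ 2 * ‖v‖ₑ) (hu : HasFourierDensity u (F ∘ lacunary c M K)) (j : ℤ) :
    (2 : ℝ≥0∞) ^ ((j : ℝ) * (-1)) * blockNorm P 1 j u ≤ ENNReal.ofReal (12 * c * shellVol) := by
  have hg := measurable_lacunary c M K
  have hw : Measurable fun ξ : E3 => blockWeight P j ξ * (‖ξ‖ₑ⁻¹ * ‖lacunary c M K ξ‖ₑ) :=
    (measurable_blockWeight P j).mul (measurable_enorm.inv.mul hg.enorm)
  rw [hu.blockNorm_eq]
  refine (two_rpow_neg_mul_lintegral_le P j (hF.comp hg)).trans ?_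
  calc _ ≤ 3 * ∫⁻ ξ, 2 * (blockWeight P j ξ * (‖ξ‖ₑ⁻¹ * ‖lacunary c M K ξ‖ₑ)) := by
        refine mul_le_mul_right (lintegral_mono fun ξ => ?_) 3
        calc _ ≤ blockWeight P j ξ * (‖ξ‖ₑ⁻¹ * (2 * ‖lacunary c M K ξ‖ₑ)) := by
              gcongr
              exact hF2 _
          _ = _ := by ring
    _ ≤ 3 * (2 * ENNReal.ofReal (2 * c * shellVol)) := by
        rw [lintegral_const_mul _ hw]
        gcongr
        exact lintegral_blockWeight_lacunary_le P hc hM j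
    _ = _ := by
        rw [← mul_assoc, show (3 * 2 : ℝ≥0∞) = ENNReal.ofReal 6 by norm_num,
          ← ENNReal.ofReal_mul (by norm_num)]
        congr 1; ring

theorem tsum_blockNorm_lacunary_le (hc : 0 ≤ c) (hF : Measurable F)
    (hF2 : ∀ v, ‖F v‖ₑ ≤ 2 * ‖v‖ₑ) (hu : HasFourierDensity u (F ∘ lacunary c M K)) :
    ∑' j : ℤ, (2 : ℝ≥0∞) ^ ((j : ℝ) * (-1)) * blockNorm P 1 j u ≤
      ENNReal.ofReal (12 * c * shellVol * K) := by
  have hg := measurable_lacunary c M K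
  have hw : Measurable fun ξ : E3 => ‖ξ‖ₑ⁻¹ * ‖lacunary c M K ξ‖ₑ := measurable_enorm.inv.mul hg.enorm
  have hw2 : Measurable fun ξ : E3 => ‖ξ‖ₑ⁻¹ * ‖(F ∘ lacunary c M K) ξ‖ₑ :=
    measurable_enorm.inv.mul (hF.comp hg).enorm
  calc _ ≤ ∑' j, 3 * ∫⁻ ξ, blockWeight P j ξ * (‖ξ‖ₑ⁻¹ * ‖(F ∘ lacunary c M K) ξ‖ₑ) := by
        refine ENNReal.tsum_le_tsum fun j => ?_
        rw [hu.blockNorm_eq]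
        exact two_rpow_neg_mul_lintegral_le P j (hF.comp hg)
    _ = 3 * ∫⁻ ξ, ‖ξ‖ₑ⁻¹ * ‖(F ∘ lacunary c M K) ξ‖ₑ := by
        rw [ENNReal.tsum_mul_left, tsum_lintegral_blockWeight P hw2]
    _ ≤ 3 * ∫⁻ ξ, 2 * (‖ξ‖ₑ⁻¹ * ‖lacunary c M K ξ‖ₑ) := by
        refine mul_le_mul_right (lintegral_mono fun ξ => ?_) 3
        calc _ ≤ ‖ξ‖ₑ⁻¹ * (2 * ‖lacunary c M K ξ‖ₑ) := by
              gcongr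
              exact hF2 _
          _ = _ := by ring
    _ ≤ 3 * (2 * ENNReal.ofReal (2 * c * shellVol * K)) := by
        rw [lintegral_const_mul _ hw]
        gcongr
        exact weightNorm_lacunary_le hc
    _ = _ := by
        rw [← mul_assoc, show (3 * 2 : ℝ≥0∞) = ENNReal.ofReal 6 by norm_num,
          ← ENNReal.ofReal_mul (by norm_num)]
        congr 1; ring

/-- For `r > 2` the norm of the lacunary data tends to zero if their amplitude tends to zero while
their norm in `ℓ²` over the scales stays bounded. -/
theorem tendsto_fbNorm_lacunary {r : ℝ≥0∞} (hr : 2 < r) {c M : ℕ → ℝ} {K : ℕ → ℕ} {e : ℝ}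
    (hc : ∀ n, 0 ≤ c n) (hM : ∀ n, 16 ≤ M n) (hlim : Tendsto c atTop (𝓝 0))
    (he : ∀ n, c n ^ 2 * K n = e) (hF : Measurable F) (hF2 : ∀ v, ‖F v‖ₑ ≤ 2 * ‖v‖ₑ)
    {u : ℕ → VField} (hu : ∀ n, HasFourierDensity (u n) (F ∘ lacunary (c n) (M n) (K n))) :
    Tendsto (fun n => fbNorm P (-1) 1 r (u n)) atTop (𝓝 0) := by
  have hv := shellVol_nonneg
  have hA : ∀ (n : ℕ) (j : ℤ), (2 : ℝ≥0∞) ^ ((j : ℝ) * (-1)) * blockNorm P 1 j (u n) ≤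
      ENNReal.ofReal (12 * c n * shellVol) := fun n j =>
    two_rpow_mul_blockNorm_lacunary_le P (hc n) (hM n) hF hF2 (hu n) j
  have hAlim : Tendsto (fun n => ENNReal.ofReal (12 * c n * shellVol)) atTop (𝓝 0) := by
    have := ENNReal.tendsto_ofReal ((hlim.const_mul 12).mul_const shellVol)
    simpa using this
  rcases eq_or_ne r ∞ with rfl | hrt
  · refine tendsto_of_tendsto_of_tendsto_of_le_of_le tendsto_const_nhds hAlim (fun _ => zero_le)
      fun n => ?_
    simp only [fbNorm, seqNorm, if_true]
    exact iSup_le (hA n)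
  · have hr2 : 2 < r.toReal := by
      rwa [← ENNReal.toReal_ofNat, ENNReal.toReal_lt_toReal (by simp) hrt]
    have hle : ∀ n, fbNorm P (-1) 1 r (u n) ≤ (ENNReal.ofReal (12 * c n * shellVol) ^ (r.toReal - 2) *
        ENNReal.ofReal ((12 * shellVol) ^ 2 * e)) ^ (1 / r.toReal) := by
      intro n
      refine (seqNorm_le_interpolate (lt_trans (by norm_num) hr) hrt (hA n)).trans ?_
      refine ENNReal.rpow_le_rpow ?_ (by positivity)
      have h1 := hc n
      calc _ ≤ ENNReal.ofReal (12 * c n * shellVol) ^ (r.toReal - 1) *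
            ENNReal.ofReal (12 * c n * shellVol * K n) := by
            gcongr
            exact tsum_blockNorm_lacunary_le P h1 hF hF2 (hu n)
        _ = ENNReal.ofReal (12 * c n * shellVol) ^ (r.toReal - 2) *
            (ENNReal.ofReal (12 * c n * shellVol) * ENNReal.ofReal (12 * c n * shellVol * K n)) := by
            rw [← mul_assoc]
            congr 1
            conv_rhs => enter [2]; rw [← ENNReal.rpow_one (ENNReal.ofReal (12 * c n * shellVol))]
            rw [← ENNReal.rpow_add_of_nonneg _ _ (by linarith) zero_le_one]
            congr 1; ring
        _ = _ := by
            rw [← ENNReal.ofReal_mul (by positivity), ← he n]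
            congr 2; ring
    refine tendsto_of_tendsto_of_tendsto_of_le_of_le tendsto_const_nhds ?_ (fun _ => zero_le) hle
    have h1 : Tendsto (fun n => ENNReal.ofReal (12 * c n * shellVol) ^ (r.toReal - 2)) atTop (𝓝 0) := by
      have := (ENNReal.continuous_rpow_const (y := r.toReal - 2)).tendsto 0 |>.comp hAlim
      rwa [ENNReal.zero_rpow_of_pos (by linarith)] at this
    have h2 := ENNReal.Tendsto.mul_const (b := ENNReal.ofReal ((12 * shellVol) ^ 2 * e)) h1
      (Or.inr (by simp))
    rw [zero_mul] at h2
    have h3 := (ENNReal.continuous_rpow_const (y := 1 / r.toReal)).tendsto 0 |>.comp h2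
    rwa [ENNReal.zero_rpow_of_pos (by positivity)] at h3

theorem tendsto_stateNorm_lacunary {r : ℝ≥0∞} (hr : 2 < r) {c M : ℕ → ℝ} {K : ℕ → ℕ} {e : ℝ}
    (hc : ∀ n, 0 ≤ c n) (hM : ∀ n, 16 ≤ M n) (hlim : Tendsto c atTop (𝓝 0))
    (he : ∀ n, c n ^ 2 * K n = e) :
    Tendsto (fun n => stateNorm P (-1) 1 r (stateOf (lacunary (c n) (M n) (K n)))) atTop (𝓝 0) := by
  have h1 := tendsto_fbNorm_lacunary P hr hc hM hlim he measurable_vel enorm_vel_le fun n =>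
    stateOf_fst (measurable_lacunary _ _ _) (weightNorm_lacunary_lt_top (hc n))
  have h2 := tendsto_fbNorm_lacunary P hr hc hM hlim he measurable_rot enorm_rot_le fun n =>
    stateOf_snd (measurable_lacunary _ _ _) (weightNorm_lacunary_lt_top (hc n))
  simpa [stateNorm] using h1.add h2

end

/-! ### Comparison of the linear evolution with the heat flow -/

/-- The heat evolution of the datum with the Fourier transform `g`. -/
def heatFlow (g : E3 → Vec) : ℝ → E3 → Vec := fun t ξ => (Real.exp (-(t * ‖ξ‖ ^ 2)) : ℂ) • g ξ

theorem measurable_heatFlow {g : E3 → Vec} (hg : Measurable g) :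
    Measurable (Function.uncurry (heatFlow g)) := by
  have h1 : Measurable fun p : ℝ × E3 => (Real.exp (-(p.1 * ‖p.2‖ ^ 2)) : ℂ) := by fun_prop
  exact h1.smul (hg.comp measurable_snd)

theorem norm_heatFlow (g : E3 → Vec) (t : ℝ) (ξ : E3) :
    ‖heatFlow g t ξ‖ = Real.exp (-(t * ‖ξ‖ ^ 2)) * ‖g ξ‖ := by
  rw [heatFlow, norm_smul, Complex.norm_real, Real.norm_eq_abs, abs_of_pos (Real.exp_pos _)]

theorem wNorm_heatFlow_lacunary_le (hc : 0 ≤ c) (hM : 16 ≤ M) :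
    wNorm (Ioi 0) (heatFlow (lacunary c M K)) ≤ ENNReal.ofReal (28 * shellVol * (c * √K)) := by
  refine le_trans (mixNorm_mono_ae ?_) (mixNorm_heat_lacunary_le hc hM)
  filter_upwards [ae_restrict_mem measurableSet_Ioi] with t ht
  refine ae_of_all _ fun ξ => ?_
  rw [← ofReal_norm, norm_heatFlow, ENNReal.ofReal_mul (by positivity), ofReal_norm]
  gcongr
  have : 0 ≤ t * ‖ξ‖ ^ 2 := mul_nonneg (mem_Ioi.1 ht).le (sq_nonneg _)
  linarith

theorem wNorm_linFlow_lacunary_le (hc : 0 ≤ c) (hM : 16 ≤ M) :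
    wNorm (Ioi 0) (linFlow (lacunary c M K)) ≤ 3 * ENNReal.ofReal (28 * shellVol * (c * √K)) := by
  have hm : Measurable (Function.uncurry fun (t : ℝ) (ξ : E3) =>
      ENNReal.ofReal (Real.exp (-(t * ‖ξ‖ ^ 2 / 4))) * ‖lacunary c M K ξ‖ₑ) := by
    have h1 : Measurable fun p : ℝ × E3 => ENNReal.ofReal (Real.exp (-(p.1 * ‖p.2‖ ^ 2 / 4))) := by
      fun_prop
    exact h1.mul ((measurable_lacunary c M K).comp measurable_snd).enorm
  refine le_trans (mixNorm_mono_ae ?_) ((mixNorm_const_mul (Ioi 0) hm 3).le.trans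
    (mul_le_mul_right (mixNorm_heat_lacunary_le hc hM) 3))
  filter_upwards [ae_restrict_mem measurableSet_Ioi] with t ht
  refine ae_of_all _ fun ξ => ?_
  have ht0 : 0 ≤ t := (mem_Ioi.1 ht).le
  refine (enorm_symG_mulVec_le ξ _ ht0).trans ?_
  rw [← mul_assoc]
  gcongr
  have : 0 ≤ t * ‖ξ‖ ^ 2 := mul_nonneg ht0 (sq_nonneg _)
  linarith

/-- On the data, the symbol `𝓐(ξ)` differs from `|ξ|²` by terms of first order, as the divergence
of both components vanishes. -/
theorem norm_symA_lacunary_sub_le (c M : ℝ) (K : ℕ) (ξ : E3) :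
    ‖(symA ξ).mulVec (lacunary c M K ξ) - ((‖ξ‖ ^ 2 : ℝ) : ℂ) • lacunary c M K ξ‖ ≤
      (2 * ‖ξ‖ + 2) * ‖lacunary c M K ξ‖ := by
  set v := lacunary c M K ξ with hv
  have hvv : ∀ i : Fin 3, v (.inr i) = v (.inl i) := fun i => rfl
  have hdiv : (ξ 0 : ℂ) * v (.inl 0) + ξ 1 * v (.inl 1) + ξ 2 * v (.inl 2) = 0 := by
    have := lacunary_longitudinal c M K ξ
    rwa [Fin.sum_univ_three] at this
  have hb : ∀ (i j : Fin 3) (p q : Fin 3 ⊕ Fin 3),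
      ‖Complex.I * ((ξ i : ℂ) * v p - ξ j * v q)‖ ≤ 2 * ‖ξ‖ * ‖v‖ := by
    intro i j p q
    rw [norm_mul, Complex.norm_I, one_mul]
    refine (norm_sub_le _ _).trans ?_
    rw [norm_mul, norm_mul, Complex.norm_real, Complex.norm_real, Real.norm_eq_abs, Real.norm_eq_abs]
    have h1 := mul_le_mul (abs_apply_le_norm ξ i) (norm_le_pi_norm v p) (norm_nonneg _) (norm_nonneg _)
    have h2 := mul_le_mul (abs_apply_le_norm ξ j) (norm_le_pi_norm v q) (norm_nonneg _) (norm_nonneg _)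
    linarith
  have hb2 : ∀ (i j : Fin 3) (p q s : Fin 3 ⊕ Fin 3),
      ‖Complex.I * ((ξ i : ℂ) * v p - ξ j * v q) + 2 * v s‖ ≤ (2 * ‖ξ‖ + 2) * ‖v‖ := by
    intro i j p q s
    refine (norm_add_le _ _).trans ?_
    have h1 := hb i j p q
    have h2 := norm_le_pi_norm v s
    rw [norm_mul 2, Complex.norm_ofNat]
    linarith
  have hb1 : ∀ (i j : Fin 3) (p q : Fin 3 ⊕ Fin 3),
      ‖Complex.I * ((ξ i : ℂ) * v p - ξ j * v q)‖ ≤ (2 * ‖ξ‖ + 2) * ‖v‖ := by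
    intro i j p q
    have h1 := hb i j p q
    have h2 := norm_nonneg v
    linarith
  rw [pi_norm_le_iff_of_nonneg (by positivity)]
  have e : ∀ k : Fin 3, (ξ k : ℂ) * ξ 0 * v (.inl 0) + ξ k * ξ 1 * v (.inl 1) +
      ξ k * ξ 2 * v (.inl 2) = 0 := fun k => by
    linear_combination (ξ k : ℂ) * hdiv
  rintro (i | i)
  · fin_cases i
    · refine le_of_eq_of_le (congrArg norm ?_) (hb1 2 1 (.inr 1) (.inr 2))
      simp [symA, symB, symC, Matrix.mulVec, dotProduct, Fin.sum_univ_three]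
      ring
    · refine le_of_eq_of_le (congrArg norm ?_) (hb1 0 2 (.inr 2) (.inr 0))
      simp [symA, symB, symC, Matrix.mulVec, dotProduct, Fin.sum_univ_three]
      ring
    · refine le_of_eq_of_le (congrArg norm ?_) (hb1 1 0 (.inr 0) (.inr 1))
      simp [symA, symB, symC, Matrix.mulVec, dotProduct, Fin.sum_univ_three]
      ring
  · fin_cases i
    · refine le_of_eq_of_le (congrArg norm ?_) (hb2 2 1 (.inl 1) (.inl 2) (.inl 0))
      simp [symA, symB, symC, Matrix.mulVec, dotProduct, Fin.sum_univ_three, hvv]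
      linear_combination e 0
    · refine le_of_eq_of_le (congrArg norm ?_) (hb2 0 2 (.inl 2) (.inl 0) (.inl 1))
      simp [symA, symB, symC, Matrix.mulVec, dotProduct, Fin.sum_univ_three, hvv]
      linear_combination e 1
    · refine le_of_eq_of_le (congrArg norm ?_) (hb2 1 0 (.inl 0) (.inl 1) (.inl 2))
      simp [symA, symB, symC, Matrix.mulVec, dotProduct, Fin.sum_univ_three, hvv]
      linear_combination e 2

theorem wNorm_linFlow_sub_heatFlow_le (hc : 0 ≤ c) (hM : 16 ≤ M) :
    wNorm (Ioi 0) (linFlow (lacunary c M K) - heatFlow (lacunary c M K)) ≤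
      ENNReal.ofReal (96 / M) * ENNReal.ofReal (28 * shellVol * (c * √K)) := by
  have hm : Measurable (Function.uncurry fun (t : ℝ) (ξ : E3) =>
      ENNReal.ofReal (Real.exp (-(t * ‖ξ‖ ^ 2 / 4))) * ‖lacunary c M K ξ‖ₑ) := by
    have h1 : Measurable fun p : ℝ × E3 => ENNReal.ofReal (Real.exp (-(p.1 * ‖p.2‖ ^ 2 / 4))) := by
      fun_prop
    exact h1.mul ((measurable_lacunary c M K).comp measurable_snd).enorm
  refine le_trans (mixNorm_mono_ae ?_) ((mixNorm_const_mul (Ioi 0) hm (ENNReal.ofReal (96 / M))).le.trans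
    (mul_le_mul_right (mixNorm_heat_lacunary_le hc hM) _))
  filter_upwards [ae_restrict_mem measurableSet_Ioi] with t ht
  refine ae_of_all _ fun ξ => ?_
  have ht0 : 0 ≤ t := (mem_Ioi.1 ht).le
  by_cases h0 : lacunary c M K ξ = 0
  · simp [linFlow, heatFlow, h0]
  obtain ⟨k, -, hk⟩ := exists_mem_shell_of_lacunary_ne_zero h0
  have hMk : M ≤ M ^ (k + 1) := le_self_pow₀ (by linarith) (by simp)
  have hξ : M / 2 ≤ ‖ξ‖ := le_trans (by linarith) (norm_le_of_mem_shell hM hk).1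
  have hξ0 : 0 < ‖ξ‖ := by linarith
  have key := norm_symG_mulVec_sub_le ξ (lacunary c M K ξ) ht0 (sq_nonneg ‖ξ‖) le_rfl
    (norm_symA_lacunary_sub_le c M K ξ)
  rw [← ofReal_norm, ← ofReal_norm, ← ENNReal.ofReal_mul (by positivity),
    ← ENNReal.ofReal_mul (by positivity)]
  refine ENNReal.ofReal_le_ofReal (key.trans ?_)
  -- one factor `e^{-t|ξ|²/4}` absorbs the factor `t`, at the expense of `4/|ξ|²`
  have hexp : t * Real.exp (-(t * ‖ξ‖ ^ 2 / 4)) ≤ 4 / ‖ξ‖ ^ 2 := by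
    rw [Real.exp_neg, ← div_eq_mul_inv, div_le_div_iff₀ (Real.exp_pos _) (by positivity)]
    linarith [Real.add_one_le_exp (t * ‖ξ‖ ^ 2 / 4)]
  have hE : Real.exp (-(t * ‖ξ‖ ^ 2 / 2)) =
      Real.exp (-(t * ‖ξ‖ ^ 2 / 4)) * Real.exp (-(t * ‖ξ‖ ^ 2 / 4)) := by
    rw [← Real.exp_add]; congr 1; ring
  have hfac : 3 * (2 * ‖ξ‖ + 2) * (4 / ‖ξ‖ ^ 2) ≤ 96 / M := by
    rw [mul_div_assoc', div_le_div_iff₀ (by positivity) (by linarith)]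
    nlinarith
  calc _ = 3 * (2 * ‖ξ‖ + 2) * (t * Real.exp (-(t * ‖ξ‖ ^ 2 / 4))) *
        (Real.exp (-(t * ‖ξ‖ ^ 2 / 4)) * ‖lacunary c M K ξ‖) := by rw [hE]; ring
    _ ≤ 3 * (2 * ‖ξ‖ + 2) * (4 / ‖ξ‖ ^ 2) *
        (Real.exp (-(t * ‖ξ‖ ^ 2 / 4)) * ‖lacunary c M K ξ‖) := by gcongr
    _ ≤ _ := mul_le_mul_of_nonneg_right hfac (by positivity)

end

/-! ### The low frequencies of the quadratic interaction -/

section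
variable {c M : ℝ} {K : ℕ}

theorem exists_mem_shell_of_mem_nearSet {ξ : E3} (h : ξ ∈ nearSet M K) : ∃ k < K, ξ ∈ shell M k := by
  obtain ⟨⟨k, hk, h0⟩, h1, h2⟩ := h
  exact ⟨k, hk, h0, h1.trans (by norm_num), h2⟩

theorem exists_mem_shell_of_mem_shiftSet {ξ : E3} (h : ξ ∈ shiftSet M K) :
    ∃ k < K, ξ ∈ shell M k := by
  obtain ⟨⟨k, hk, h0⟩, h1, h2⟩ := h
  refine ⟨k, hk, h0, ?_, h2⟩
  have := (abs_le.1 h1).2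
  linarith

theorem norm_le_of_exists_mem_shell (hM : 16 ≤ M) {ξ : E3} (h : ∃ k < K, ξ ∈ shell M k) :
    ‖ξ‖ ≤ 2 * M ^ K := by
  obtain ⟨k, hk, h⟩ := h
  refine (norm_le_of_mem_shell hM h).2.trans ?_
  gcongr
  · linarith
  · exact hk

theorem integrable_nearInd_mul (hM : 16 ≤ M) {φ : E3 → ℝ} (hφ : Continuous φ) :
    Integrable fun η => nearInd M K η * φ η := by
  have h1 : IntegrableOn φ (nearSet M K) :=
    (hφ.continuousOn.integrableOn_compact (isCompact_closedBall (0 : E3) (2 * M ^ K))).mono_set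
      fun η hη => mem_closedBall_zero_iff.2
        (norm_le_of_exists_mem_shell hM (exists_mem_shell_of_mem_nearSet hη))
  refine ((integrable_indicator_iff (measurableSet_nearSet M K)).2 h1).congr (ae_of_all _ fun η => ?_)
  by_cases h : η ∈ nearSet M K <;> simp [nearInd, h]

theorem integrable_shiftInd_mul (hM : 16 ≤ M) {φ : E3 → ℝ} (hφ : Continuous φ) :
    Integrable fun η => shiftInd M K η * φ η := by
  have h1 : IntegrableOn φ (shiftSet M K) :=
    (hφ.continuousOn.integrableOn_compact (isCompact_closedBall (0 : E3) (2 * M ^ K))).mono_set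
      fun η hη => mem_closedBall_zero_iff.2
        (norm_le_of_exists_mem_shell hM (exists_mem_shell_of_mem_shiftSet hη))
  refine ((integrable_indicator_iff (measurableSet_shiftSet M K)).2 h1).congr (ae_of_all _ fun η => ?_)
  by_cases h : η ∈ shiftSet M K <;> simp [shiftInd, h]

theorem continuous_coord (i : Fin 3) : Continuous fun ξ : E3 => ξ i :=
  (EuclideanSpace.proj i : E3 →L[ℝ] ℝ).continuous

theorem integrable_polar (hM : 16 ≤ M) (i : Fin 3) : Integrable fun η => polar M K η i := by
  fin_cases i
  · exact (integrable_nearInd_mul hM (continuous_coord 1)).sub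
      (integrable_shiftInd_mul hM (continuous_coord 2))
  · exact (integrable_nearInd_mul hM (continuous_coord 0)).neg
  · exact integrable_shiftInd_mul hM (continuous_coord 0)

theorem abs_polar_le_const (hM : 16 ≤ M) (ξ : E3) (i : Fin 3) : |polar M K ξ i| ≤ 4 * M ^ K := by
  by_cases h : lacunary 1 M K ξ = 0
  · have := congrFun h (.inl i)
    have h0 : polar M K ξ i = 0 := by simpa [lacunary] using this
    rw [h0, abs_zero]
    positivity
  · have h1 := norm_le_of_exists_mem_shell hM (exists_mem_shell_of_lacunary_ne_zero h)
    linarith [abs_polar_le M K ξ i]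

/-- The interaction of the heat evolutions at the frequencies `ξ - η` and `η`. -/
def heatFactor (τ : ℝ) (ξ η : E3) : ℝ := Real.exp (-(τ * ‖ξ - η‖ ^ 2)) * Real.exp (-(τ * ‖η‖ ^ 2))

theorem heatFactor_nonneg (τ : ℝ) (ξ η : E3) : 0 ≤ heatFactor τ ξ η := by
  unfold heatFactor; positivity

theorem continuous_heatFactor (τ : ℝ) (ξ : E3) : Continuous (heatFactor τ ξ) := by
  unfold heatFactor; fun_prop

theorem heatFactor_le_one {τ : ℝ} (hτ : 0 ≤ τ) (ξ η : E3) : heatFactor τ ξ η ≤ 1 := by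
  unfold heatFactor
  rw [← Real.exp_add, Real.exp_le_one_iff]
  have h1 : 0 ≤ τ * ‖ξ - η‖ ^ 2 := by positivity
  have h2 : 0 ≤ τ * ‖η‖ ^ 2 := by positivity
  linarith

theorem heatFactor_symm (τ : ℝ) (ξ η : E3) : heatFactor τ ξ (ξ - η) = heatFactor τ ξ η := by
  unfold heatFactor
  rw [sub_sub_cancel, mul_comm]

theorem integrable_interaction (hM : 16 ≤ M) {τ : ℝ} (hτ : 0 ≤ τ) (ξ : E3) (k l : Fin 3) :
    Integrable fun η => heatFactor τ ξ η * polar M K (ξ - η) k * polar M K η l := by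
  have hm : Measurable fun η => heatFactor τ ξ η * polar M K (ξ - η) k :=
    (continuous_heatFactor τ ξ).measurable.mul
      ((measurable_polar M K k).comp (measurable_const.sub measurable_id))
  refine (integrable_polar hM l).bdd_mul (c := 4 * M ^ K) hm.aestronglyMeasurable
    (ae_of_all _ fun η => ?_)
  rw [Real.norm_eq_abs, abs_mul, abs_of_nonneg (heatFactor_nonneg τ ξ η)]
  exact (mul_le_of_le_one_left (abs_nonneg _) (heatFactor_le_one hτ ξ η)).trans
    (abs_polar_le_const hM _ k)

/-- The real linear functional `v ↦ -Im (z · v)` for the vector `z = (0, -ξ₂, ξ₁)`, applied to the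
component of `v` that is selected by `q`. Since `z` is orthogonal to `ξ`, it does not see the Leray
projection. -/
def pairing (ξ : E3) (q : Fin 3 → Fin 3 ⊕ Fin 3) : Vec →L[ℝ] ℝ :=
  ξ 2 • Complex.imCLM.comp (ContinuousLinearMap.proj (q 1)) -
    ξ 1 • Complex.imCLM.comp (ContinuousLinearMap.proj (q 2))

theorem pairing_apply (ξ : E3) (q : Fin 3 → Fin 3 ⊕ Fin 3) (v : Vec) :
    pairing ξ q v = ξ 2 * (v (q 1)).im - ξ 1 * (v (q 2)).im := rfl

/-- The quadratic interaction of the data, seen by the above functional. -/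
def interaction (M : ℝ) (K : ℕ) (τ : ℝ) (ξ : E3) : ℝ :=
  ∫ η, heatFactor τ ξ η * ((∑ k, ξ k * polar M K (ξ - η) k) *
    (ξ 1 * polar M K η 2 - ξ 2 * polar M K η 1))

/-- The functional gives the same value on the two components of the quadratic term: the second one
has no Leray projection, and the functional does not see the projection in the first one. -/
theorem pairing_quad_heatFlow (hM : 16 ≤ M) {τ : ℝ} (hτ : 0 ≤ τ) (ξ : E3)
    {q : Fin 3 → Fin 3 ⊕ Fin 3} (hq : q = .inl ∨ q = .inr) :
    pairing ξ q (quad (heatFlow (lacunary c M K) τ) ξ) =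
      ((2 * Real.pi) ^ 3)⁻¹ * c ^ 2 * interaction M K τ ξ := by
  set A : E3 → C3 := fun η => WithLp.toLp 2 fun i =>
    (Real.exp (-(τ * ‖η‖ ^ 2)) : ℂ) * (Complex.I * c * polar M K η i) with hA
  set R : Fin 3 → Fin 3 → ℝ := fun k l =>
    ∫ η, heatFactor τ ξ η * polar M K (ξ - η) k * polar M K η l with hR
  have hI : ∀ k l, ∫ η, A (ξ - η) k * A η l = -((c ^ 2 * R k l : ℝ) : ℂ) := by
    intro k l
    have e : ∀ η, A (ξ - η) k * A η l =
        ((-(c ^ 2) * (heatFactor τ ξ η * polar M K (ξ - η) k * polar M K η l) : ℝ) : ℂ) := by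
      intro η
      simp only [hA, heatFactor, Complex.ofReal_mul, Complex.ofReal_neg, Complex.ofReal_pow]
      linear_combination ((Real.exp (-(τ * ‖ξ - η‖ ^ 2)) : ℂ) * polar M K (ξ - η) k *
        Real.exp (-(τ * ‖η‖ ^ 2)) * polar M K η l * c ^ 2) * Complex.I_sq
    simp only [e]
    rw [integral_complex_ofReal, integral_const_mul]
    push_cast
    ring
  have hdiv : ∀ l, divTensor A A ξ l =
      Complex.I * ((-(((2 * Real.pi) ^ 3)⁻¹ * c ^ 2 * ∑ k, ξ k * R k l) : ℝ) : ℂ) := by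
    intro l
    simp only [divTensor, hI, Fin.sum_univ_three]
    push_cast
    ring
  have hint : interaction M K τ ξ = ξ 1 * (∑ k, ξ k * R k 2) - ξ 2 * ∑ k, ξ k * R k 1 := by
    have hi := fun k l => (integrable_interaction (K := K) hM hτ ξ k l)
    simp only [hR, Fin.sum_univ_three, ← integral_const_mul]
    have hs : ∀ l, Integrable fun η => ξ 0 * (heatFactor τ ξ η * polar M K (ξ - η) 0 * polar M K η l) +
        ξ 1 * (heatFactor τ ξ η * polar M K (ξ - η) 1 * polar M K η l) +
        ξ 2 * (heatFactor τ ξ η * polar M K (ξ - η) 2 * polar M K η l) := fun l =>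
      (((hi 0 l).const_mul (ξ 0)).add ((hi 1 l).const_mul (ξ 1))).add ((hi 2 l).const_mul (ξ 2))
    have hs' : ∀ l, (∫ η, ξ 0 * (heatFactor τ ξ η * polar M K (ξ - η) 0 * polar M K η l)) +
        (∫ η, ξ 1 * (heatFactor τ ξ η * polar M K (ξ - η) 1 * polar M K η l)) +
        (∫ η, ξ 2 * (heatFactor τ ξ η * polar M K (ξ - η) 2 * polar M K η l)) =
        ∫ η, ξ 0 * (heatFactor τ ξ η * polar M K (ξ - η) 0 * polar M K η l) +
        ξ 1 * (heatFactor τ ξ η * polar M K (ξ - η) 1 * polar M K η l) +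
        ξ 2 * (heatFactor τ ξ η * polar M K (ξ - η) 2 * polar M K η l) := fun l => by
      have h01 : Integrable fun η => ξ 0 * (heatFactor τ ξ η * polar M K (ξ - η) 0 * polar M K η l) +
          ξ 1 * (heatFactor τ ξ η * polar M K (ξ - η) 1 * polar M K η l) :=
        ((hi 0 l).const_mul (ξ 0)).add ((hi 1 l).const_mul (ξ 1))
      rw [← integral_add ((hi 0 l).const_mul (ξ 0)) ((hi 1 l).const_mul (ξ 1)),
        ← integral_add h01 ((hi 2 l).const_mul (ξ 2))]
    rw [hs', hs', ← integral_const_mul, ← integral_const_mul,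
      ← integral_sub ((hs 2).const_mul _) ((hs 1).const_mul _), interaction]
    refine integral_congr_ae (ae_of_all _ fun η => ?_)
    simp only [Fin.sum_univ_three]
    ring
  have hquad : quad (heatFlow (lacunary c M K) τ) ξ =
      join (leray ξ (divTensor A A ξ)) (divTensor A A ξ) := rfl
  rw [hquad, pairing_apply, hint]
  rcases hq with rfl | rfl
  · have e : ∀ i, join (leray ξ (divTensor A A ξ)) (divTensor A A ξ) (.inl i) =
        divTensor A A ξ i - (ξ i : ℂ) * ((∑ j, (ξ j : ℂ) * divTensor A A ξ j) /
          ((‖ξ‖ ^ 2 : ℝ) : ℂ)) := by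
      intro i
      change divTensor A A ξ i - ∑ j, _ = _
      rw [Finset.sum_div, Finset.mul_sum]
      congr 1
      exact Finset.sum_congr rfl fun j _ => by ring
    set s := (∑ j, (ξ j : ℂ) * divTensor A A ξ j) / ((‖ξ‖ ^ 2 : ℝ) : ℂ) with hs
    rw [e, e, hdiv, hdiv, Complex.sub_im, Complex.sub_im, Complex.I_mul_im, Complex.I_mul_im,
      Complex.ofReal_re, Complex.ofReal_re, Complex.im_ofReal_mul, Complex.im_ofReal_mul]
    ring
  · have e : ∀ i, join (leray ξ (divTensor A A ξ)) (divTensor A A ξ) (.inr i) =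
        divTensor A A ξ i := fun i => rfl
    rw [e, e, hdiv, hdiv, Complex.I_mul_im, Complex.I_mul_im, Complex.ofReal_re, Complex.ofReal_re]
    ring

/-- The unit vector around which the output frequencies are considered. -/
def outCenter : E3 := EuclideanSpace.single 1 1

theorem coord_of_mem_ball {p ξ : E3} (h : ξ ∈ Metric.ball p (1 / 16)) (i : Fin 3) :
    |ξ i - p i| ≤ 1 / 16 := by
  have := abs_apply_le_norm (ξ - p) i
  rw [PiLp.sub_apply] at this
  exact this.trans (mem_ball_iff_norm.1 h).le

theorem coords_of_mem_outBall {ξ : E3} (h : ξ ∈ Metric.ball outCenter (1 / 16)) :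
    |ξ 0| ≤ 1 / 16 ∧ |ξ 1 - 1| ≤ 1 / 16 ∧ |ξ 2| ≤ 1 / 16 := by
  have := coord_of_mem_ball h
  exact ⟨by simpa [outCenter] using this 0, by simpa [outCenter] using this 1,
    by simpa [outCenter] using this 2⟩

/-- At an output frequency near `e₁`, only the interactions of one frequency of each family
contribute, and these contributions have a sign. -/
theorem interaction_integrand_lower {ξ θ η : E3} (hξ : ξ ∈ Metric.ball outCenter (1 / 16))
    (hsum : θ + η = ξ) (hM : 16 ≤ M) (hθ : θ ∈ nearSet M K) (hη : η ∈ shiftSet M K) :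
    θ 0 ^ 2 / 2 ≤ (ξ 0 * θ 1 - ξ 1 * θ 0) * (ξ 1 * η 0) + (ξ 2 * η 0 - ξ 0 * η 2) * (ξ 2 * θ 0) := by
  obtain ⟨h0, h1, h2⟩ := coords_of_mem_outBall hξ
  obtain ⟨⟨k, -, hk⟩, hθ1, -⟩ := hθ
  obtain ⟨-, -, hη2⟩ := hη
  have hm : 16 ≤ M ^ (k + 1) := hM.trans (le_self_pow₀ (by linarith) (by simp))
  have hθ0 : 15 ≤ |θ 0| := by linarith [(abs_le.1 hk).1]
  have hη0 : η 0 = ξ 0 - θ 0 := by rw [← hsum]; simp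
  have hT : |θ 0| ^ 2 = θ 0 ^ 2 := sq_abs _
  have hx1 : 15 / 16 ≤ ξ 1 ∧ ξ 1 ≤ 17 / 16 := by
    constructor <;> linarith [(abs_le.1 h1).1, (abs_le.1 h1).2]
  have hA : |ξ 0 * θ 0| ≤ 1 / 16 * |θ 0| := by rw [abs_mul]; gcongr
  have hprod : |ξ 0 * θ 1 * ξ 1 * η 0| ≤ 1 / 16 * (1 / 8) * (17 / 16) * (1 / 16 + |θ 0|) := by
    rw [abs_mul, abs_mul, abs_mul, hη0, abs_of_nonneg (by linarith : 0 ≤ ξ 1)]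
    gcongr
    · linarith [hx1.1]
    · exact hx1.2
    · linarith [abs_sub (ξ 0) (θ 0)]
  have hprod2 : |ξ 0 * η 2 * ξ 2 * θ 0| ≤ 1 / 16 * (1 / 8) * (1 / 16) * |θ 0| := by
    rw [abs_mul, abs_mul, abs_mul]
    gcongr
  have hmain : 3 / 4 * (θ 0 ^ 2 - 1 / 16 * |θ 0|) ≤
      (ξ 1 ^ 2 - ξ 2 ^ 2) * (θ 0 ^ 2 - ξ 0 * θ 0) := by
    have hs : 3 / 4 ≤ ξ 1 ^ 2 - ξ 2 ^ 2 := by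
      have := sq_le_sq' (abs_le.1 h2).1 (abs_le.1 h2).2
      nlinarith
    have hp : 0 ≤ θ 0 ^ 2 - 1 / 16 * |θ 0| := by nlinarith
    have hq : θ 0 ^ 2 - 1 / 16 * |θ 0| ≤ θ 0 ^ 2 - ξ 0 * θ 0 := by
      linarith [le_abs_self (ξ 0 * θ 0)]
    nlinarith
  have e : (ξ 0 * θ 1 - ξ 1 * θ 0) * (ξ 1 * η 0) + (ξ 2 * η 0 - ξ 0 * η 2) * (ξ 2 * θ 0) =
      (ξ 1 ^ 2 - ξ 2 ^ 2) * (θ 0 ^ 2 - ξ 0 * θ 0) + ξ 0 * θ 1 * ξ 1 * η 0 -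
        ξ 0 * η 2 * ξ 2 * θ 0 := by rw [hη0]; ring
  rw [e]
  nlinarith [(abs_le.1 hprod).1, (abs_le.1 hprod2).2]

/-- The integrand of the interaction after symmetrization. -/
def symIntegrand (M : ℝ) (K : ℕ) (τ : ℝ) (ξ η : E3) : ℝ :=
  heatFactor τ ξ η * (nearInd M K (ξ - η) * shiftInd M K η *
    ((ξ 0 * (ξ - η) 1 - ξ 1 * (ξ - η) 0) * (ξ 1 * η 0) +
      (ξ 2 * η 0 - ξ 0 * η 2) * (ξ 2 * (ξ - η) 0)))

theorem integrable_near_shift (hM : 16 ≤ M) (ξ : E3) {φ : E3 → ℝ} (hφ : Continuous φ) :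
    Integrable fun η => nearInd M K (ξ - η) * (shiftInd M K η * φ η) := by
  have hm : Measurable fun η => nearInd M K (ξ - η) :=
    (measurable_nearInd M K).comp (measurable_const.sub measurable_id)
  refine (integrable_shiftInd_mul hM hφ).bdd_mul (c := 1) hm.aestronglyMeasurable
    (ae_of_all _ fun η => ?_)
  rw [Real.norm_eq_abs, abs_of_nonneg (nearInd_nonneg _ _ _)]
  exact nearInd_le_one _ _ _

theorem integrable_symIntegrand (hM : 16 ≤ M) (τ : ℝ) (ξ : E3) :
    Integrable (symIntegrand M K τ ξ) := by
  have hc := continuous_heatFactor τ ξ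
  have hφ : Continuous fun η : E3 => heatFactor τ ξ η *
      ((ξ 0 * (ξ - η) 1 - ξ 1 * (ξ - η) 0) * (ξ 1 * η 0) +
      (ξ 2 * η 0 - ξ 0 * η 2) * (ξ 2 * (ξ - η) 0)) := by fun_prop
  refine (integrable_near_shift (K := K) hM ξ hφ).congr (ae_of_all _ fun η => ?_)
  simp only [symIntegrand]
  ring

/-- Only pairs of frequencies from different families contribute. -/
theorem interaction_eq (hM : 16 ≤ M) {τ : ℝ} {ξ : E3}
    (hξ : ξ ∈ Metric.ball outCenter (1 / 16)) :
    interaction M K τ ξ = ∫ η, symIntegrand M K τ ξ η := by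
  have hc := continuous_heatFactor τ ξ
  obtain ⟨h0, h1, h2⟩ := coords_of_mem_outBall hξ
  obtain ⟨h1a, h1b⟩ := abs_le.1 h1
  -- two frequencies of the same family do not add up to a frequency with `ξ₁` close to `1`
  have hnn : ∀ η, nearInd M K (ξ - η) * nearInd M K η = 0 := by
    intro η
    by_contra hne
    have ha : ξ - η ∈ nearSet M K := mem_of_indicator_ne_zero (left_ne_zero_of_mul hne)
    have hb : η ∈ nearSet M K := mem_of_indicator_ne_zero (right_ne_zero_of_mul hne)
    have ha1 := ha.2.1
    rw [PiLp.sub_apply] at ha1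
    linarith [(abs_le.1 ha1).2, (abs_le.1 hb.2.1).2]
  have hss : ∀ η, shiftInd M K (ξ - η) * shiftInd M K η = 0 := by
    intro η
    by_contra hne
    have ha : ξ - η ∈ shiftSet M K := mem_of_indicator_ne_zero (left_ne_zero_of_mul hne)
    have hb : η ∈ shiftSet M K := mem_of_indicator_ne_zero (right_ne_zero_of_mul hne)
    have ha1 := ha.2.1
    rw [PiLp.sub_apply] at ha1
    obtain ⟨a1, a2⟩ := abs_le.1 ha1
    obtain ⟨b1, b2⟩ := abs_le.1 hb.2.1
    rcases le_total 0 (ξ 1 - η 1) with ha3 | ha3 <;> rcases le_total 0 (η 1) with hb3 | hb3 <;>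
    simp only [abs_of_nonneg, abs_of_nonpos, ha3, hb3] at a1 a2 b1 b2 <;> linarith
  set f : E3 → ℝ := fun η => nearInd M K (ξ - η) * (shiftInd M K η *
    (heatFactor τ ξ η * ((ξ 0 * (ξ - η) 1 - ξ 1 * (ξ - η) 0) * (ξ 1 * η 0)))) with hf
  set f' : E3 → ℝ := fun η => nearInd M K (ξ - η) * (shiftInd M K η *
    (heatFactor τ ξ η * ((ξ 2 * η 0 - ξ 0 * η 2) * (ξ 2 * (ξ - η) 0)))) with hf'
  have hi : Integrable f := integrable_near_shift hM ξ (by fun_prop)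
  have hi' : Integrable f' := integrable_near_shift hM ξ (by fun_prop)
  have hi'' : Integrable fun η => f' (ξ - η) := hi'.comp_sub_left ξ
  calc interaction M K τ ξ = ∫ η, (f η + f' (ξ - η)) := by
        refine integral_congr_ae (ae_of_all _ fun η => ?_)
        simp only [hf, hf', Fin.sum_univ_three, polar, Matrix.cons_val_zero, Matrix.cons_val_one,
          Matrix.cons_val_two, Matrix.tail_cons, Matrix.head_cons, sub_sub_cancel, heatFactor_symm]
        linear_combination (heatFactor τ ξ η * (ξ 0 * (ξ - η) 1 - ξ 1 * (ξ - η) 0) * (ξ 2 * η 0)) *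
          hnn η + (heatFactor τ ξ η * (ξ 2 * (ξ - η) 0 - ξ 0 * (ξ - η) 2) * (ξ 1 * η 0)) * hss η
    -- the substitution `η ↦ ξ - η` exchanges the roles of the two families
    _ = (∫ η, f η) + ∫ η, f' η := by
        rw [integral_add hi hi'', integral_sub_left_eq_self f' volume ξ]
    _ = ∫ η, (f η + f' η) := (integral_add hi hi').symm
    _ = _ := by
        refine integral_congr_ae (ae_of_all _ fun η => ?_)
        simp only [hf, hf', symIntegrand]
        ring

theorem symIntegrand_nonneg (hM : 16 ≤ M) (τ : ℝ) {ξ : E3}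
    (hξ : ξ ∈ Metric.ball outCenter (1 / 16)) (η : E3) : 0 ≤ symIntegrand M K τ ξ η := by
  by_cases hz : nearInd M K (ξ - η) * shiftInd M K η = 0
  · simp [symIntegrand, hz]
  have ha : ξ - η ∈ nearSet M K := mem_of_indicator_ne_zero (left_ne_zero_of_mul hz)
  have hb : η ∈ shiftSet M K := mem_of_indicator_ne_zero (right_ne_zero_of_mul hz)
  have := interaction_integrand_lower hξ (sub_add_cancel ξ η) hM ha hb
  refine mul_nonneg (heatFactor_nonneg _ _ _) (mul_nonneg
    (mul_nonneg (nearInd_nonneg _ _ _) (shiftInd_nonneg _ _ _)) (le_trans (by positivity) this))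

/-- The interactions of the scale `M^{k+1}`. -/
theorem le_symIntegrand (hM : 16 ≤ M) {τ : ℝ} (hτ : 0 ≤ τ) {ξ η : E3}
    (hξ : ξ ∈ Metric.ball outCenter (1 / 16)) {k : ℕ} (hk : k < K)
    (hη : η ∈ Metric.ball (outCenter - EuclideanSpace.single 0 (M ^ (k + 1))) (1 / 16)) :
    (M ^ (k + 1)) ^ 2 / 4 * Real.exp (-(4 * (M ^ (k + 1)) ^ 2 * τ)) ≤ symIntegrand M K τ ξ η := by
  set m := M ^ (k + 1) with hmdef
  have hm : 16 ≤ m := hM.trans (le_self_pow₀ (by linarith) (by simp))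
  obtain ⟨x0, x1, x2⟩ := coords_of_mem_outBall hξ
  have hco := coord_of_mem_ball hη
  have e0 : |η 0 + m| ≤ 1 / 16 := by simpa [outCenter] using hco 0
  have e1 : |η 1 - 1| ≤ 1 / 16 := by simpa [outCenter] using hco 1
  have e2 : |η 2| ≤ 1 / 16 := by simpa [outCenter] using hco 2
  rw [abs_le] at x0 x1 x2 e0 e1 e2
  have t0 : (ξ - η) 0 = ξ 0 - η 0 := rfl
  have t1 : (ξ - η) 1 = ξ 1 - η 1 := rfl
  have t2 : (ξ - η) 2 = ξ 2 - η 2 := rfl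
  have ha : ξ - η ∈ nearSet M K := by
    refine ⟨⟨k, hk, ?_⟩, ?_, ?_⟩
    · rw [t0, abs_of_nonneg (show 0 ≤ ξ 0 - η 0 by linarith), abs_le]
      constructor <;> linarith
    · rw [t1, abs_le]
      constructor <;> linarith
    · rw [t2, abs_le]
      constructor <;> linarith
  have hb : η ∈ shiftSet M K := by
    refine ⟨⟨k, hk, ?_⟩, ?_, ?_⟩
    · rw [abs_of_nonpos (show η 0 ≤ 0 by linarith), abs_le]
      constructor <;> linarith
    · rw [abs_of_nonneg (show 0 ≤ η 1 by linarith), abs_le]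
      constructor <;> linarith
    · rw [abs_le]
      constructor <;> linarith
  have hlow := interaction_integrand_lower hξ (sub_add_cancel ξ η) hM ha hb
  have n1 : nearInd M K (ξ - η) = 1 := indicator_of_mem ha _
  have n2 : shiftInd M K η = 1 := indicator_of_mem hb _
  have hθ2 : m ^ 2 / 4 ≤ (ξ - η) 0 ^ 2 / 2 := by
    rw [t0]
    nlinarith
  have hE : Real.exp (-(4 * m ^ 2 * τ)) ≤ heatFactor τ ξ η := by
    unfold heatFactor
    rw [← Real.exp_add]
    refine Real.exp_le_exp.2 ?_
    have hle : ‖ξ - η‖ ^ 2 + ‖η‖ ^ 2 ≤ 4 * m ^ 2 := by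
      rw [norm_sq_eq, norm_sq_eq, t0, t1, t2]
      have s0 : (ξ 0 - η 0) ^ 2 ≤ (m + 1 / 8) ^ 2 := by
        refine sq_le_sq' ?_ ?_ <;> linarith
      have s1 : (ξ 1 - η 1) ^ 2 ≤ (1 / 8) ^ 2 := by
        refine sq_le_sq' ?_ ?_ <;> linarith
      have s2 : (ξ 2 - η 2) ^ 2 ≤ (1 / 8) ^ 2 := by
        refine sq_le_sq' ?_ ?_ <;> linarith
      have r0 : (η 0) ^ 2 ≤ (m + 1 / 8) ^ 2 := by
        refine sq_le_sq' ?_ ?_ <;> linarith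
      have r1 : (η 1) ^ 2 ≤ 2 ^ 2 := by
        refine sq_le_sq' ?_ ?_ <;> linarith
      have r2 : (η 2) ^ 2 ≤ 1 ^ 2 := by
        refine sq_le_sq' ?_ ?_ <;> linarith
      nlinarith
    nlinarith [mul_le_mul_of_nonneg_left hle hτ]
  rw [symIntegrand, n1, n2, one_mul, one_mul, mul_comm]
  exact mul_le_mul hE (hθ2.trans hlow) (by positivity) (heatFactor_nonneg _ _ _)

/-- The volume of the balls of output and interaction frequencies. -/
def ballVol : ℝ := (volume (Metric.ball (0 : E3) (1 / 16))).toReal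

theorem ballVol_pos : 0 < ballVol :=
  ENNReal.toReal_pos (Metric.measure_ball_pos _ _ (by norm_num)).ne' measure_ball_lt_top.ne

/-- The contributions of the scales add up: the terms have a sign, and the balls of interaction
frequencies that belong to different scales are disjoint. -/
theorem le_interaction (hM : 16 ≤ M) {τ : ℝ} (hτ : 0 ≤ τ) {ξ : E3}
    (hξ : ξ ∈ Metric.ball outCenter (1 / 16)) :
    ∑ k ∈ Finset.range K, ballVol * ((M ^ (k + 1)) ^ 2 / 4 *
      Real.exp (-(4 * (M ^ (k + 1)) ^ 2 * τ))) ≤ interaction M K τ ξ := by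
  set B : ℕ → Set E3 := fun k =>
    Metric.ball (outCenter - EuclideanSpace.single 0 (M ^ (k + 1))) (1 / 16) with hB
  set L : ℕ → ℝ := fun k => (M ^ (k + 1)) ^ 2 / 4 * Real.exp (-(4 * (M ^ (k + 1)) ^ 2 * τ)) with hL
  have hBm : ∀ k, MeasurableSet (B k) := fun k => measurableSet_ball
  have hBv : ∀ k, (volume (B k)).toReal = ballVol := fun k => by
    rw [hB, ballVol, Measure.addHaar_ball_center]
  have hlt : ∀ k l, k < l → ∀ η, η ∈ B k → η ∈ B l → False := by
    intro k l hkl η h1 h2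
    have e1 : |η 0 + M ^ (k + 1)| ≤ 1 / 16 := by simpa [outCenter] using coord_of_mem_ball h1 0
    have e2 : |η 0 + M ^ (l + 1)| ≤ 1 / 16 := by simpa [outCenter] using coord_of_mem_ball h2 0
    have hm : 16 ≤ M ^ (k + 1) := hM.trans (le_self_pow₀ (by linarith) (by simp))
    have hmm : 16 * M ^ (k + 1) ≤ M ^ (l + 1) := by
      calc 16 * M ^ (k + 1) ≤ M * M ^ (k + 1) := by gcongr
        _ = M ^ (k + 1 + 1) := by ring
        _ ≤ _ := pow_le_pow_right₀ (by linarith) (by omega)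
    linarith [(abs_le.1 e1).1, (abs_le.1 e2).2]
  have hpt : ∀ η, ∑ k ∈ Finset.range K, (B k).indicator (fun _ => L k) η ≤ symIntegrand M K τ ξ η := by
    intro η
    by_cases h : ∃ k ∈ Finset.range K, η ∈ B k
    · obtain ⟨k, hk, hη⟩ := h
      rw [Finset.sum_eq_single_of_mem k hk, indicator_of_mem hη]
      · exact le_symIntegrand hM hτ hξ (Finset.mem_range.1 hk) hη
      · intro l _ hl
        refine indicator_of_notMem (fun hl' => ?_) _
        rcases lt_or_gt_of_ne hl with h' | h'
        · exact hlt l k h' η hl' hη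
        · exact hlt k l h' η hη hl'
    · push Not at h
      rw [Finset.sum_eq_zero fun k hk => indicator_of_notMem (h k hk) _]
      exact symIntegrand_nonneg hM τ hξ η
  have hint : ∀ k, Integrable ((B k).indicator fun _ => L k) := fun k =>
    (integrable_indicator_iff (hBm k)).2 (integrableOn_const (measure_ball_lt_top.ne) (by simp))
  rw [interaction_eq hM hξ]
  refine le_trans (le_of_eq ?_) (integral_mono (integrable_finsetSum (Finset.range K) fun k _ => hint k)
    (integrable_symIntegrand hM τ ξ) hpt)
  rw [integral_finsetSum _ fun k _ => hint k]
  refine Finset.sum_congr rfl fun k _ => ?_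
  rw [integral_indicator (hBm k), setIntegral_const, smul_eq_mul, measureReal_def, hBv]

end

/-! ### Norm inflation -/

section
variable {c M : ℝ} {K : ℕ}

theorem norm_le_two_of_mem_outBall {ξ : E3} (h : ξ ∈ Metric.ball outCenter (1 / 16)) : ‖ξ‖ ≤ 2 := by
  have h1 : ‖outCenter‖ = 1 := by simp [outCenter]
  have h2 := norm_le_norm_add_norm_sub' ξ outCenter
  linarith [mem_ball_iff_norm.1 h]

theorem enorm_le_two {ξ : E3} (h : ‖ξ‖ ≤ 2) : ‖ξ‖ₑ ≤ 2 := by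
  rw [← ofReal_norm]
  exact (ENNReal.ofReal_le_ofReal h).trans (by simp)

theorem lacunary_eq_zero_of_mem_outBall (hM : 16 ≤ M) {ξ : E3}
    (h : ξ ∈ Metric.ball outCenter (1 / 16)) : lacunary c M K ξ = 0 := by
  by_contra hne
  obtain ⟨k, -, hk⟩ := exists_mem_shell_of_lacunary_ne_zero hne
  have h1 := (norm_le_of_mem_shell hM hk).1
  have hm : M ≤ M ^ (k + 1) := le_self_pow₀ (by linarith) (by simp)
  linarith [norm_le_two_of_mem_outBall h]

theorem continuous_symA : Continuous symA := by
  refine continuous_matrix fun i j => ?_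
  rcases i with i | i <;> rcases j with j | j <;> fin_cases i <;> fin_cases j <;>
    simp [symA, symB, symC] <;> fun_prop

theorem exists_norm_symA_mulVec_le :
    ∃ C : ℝ, 0 ≤ C ∧ ∀ ξ : E3, ‖ξ‖ ≤ 2 → ∀ v : Vec, ‖(symA ξ).mulVec v‖ ≤ C * ‖v‖ := by
  obtain ⟨C, hC⟩ := (isCompact_closedBall (0 : E3) 2).exists_bound_of_continuousOn
    (f := fun ξ => (fun i j => symA ξ i j : Fin 3 ⊕ Fin 3 → Vec))
    (continuous_pi fun i => continuous_pi fun j => continuous_symA.matrix_elem i j).continuousOn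
  have hC0 : 0 ≤ C := (norm_nonneg _).trans (hC 0 (by simp))
  refine ⟨6 * C, by positivity, fun ξ hξ v => ?_⟩
  rw [pi_norm_le_iff_of_nonneg (by positivity)]
  intro i
  change ‖∑ j, symA ξ i j * v j‖ ≤ _
  refine (norm_sum_le _ _).trans ?_
  calc _ ≤ ∑ _j : Fin 3 ⊕ Fin 3, C * ‖v‖ := by
        refine Finset.sum_le_sum fun j _ => ?_
        rw [norm_mul]
        gcongr
        · exact (norm_le_pi_norm (fun j => symA ξ i j : Vec) j).trans
            ((norm_le_pi_norm (fun i j => symA ξ i j : Fin 3 ⊕ Fin 3 → Vec) i).trans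
              (hC ξ (mem_closedBall_zero_iff.2 hξ)))
        · exact norm_le_pi_norm _ j
    _ = _ := by simp; ring

theorem intervalIntegrable_quad {w : ℝ → E3 → Vec} (hw : Measurable (Function.uncurry w)) {ξ : E3}
    (h : IsGoodFreq w ξ) {t : ℝ} (ht : 0 ≤ t) :
    IntervalIntegrable (fun τ => quad (w τ) ξ) volume 0 t := by
  rw [intervalIntegrable_iff_integrableOn_Ioc_of_le ht]
  exact (h.integrableOn_quad hw).mono_set Ioc_subset_Ioi_self

/-- At bounded frequencies and for short times, the semigroup in the Duhamel term is close to the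
identity. -/
theorem exists_enorm_duhamel_sub_integral_le :
    ∃ C : ℝ, 0 ≤ C ∧ ∀ (w : ℝ → E3 → Vec), Measurable (Function.uncurry w) → ∀ ξ : E3, ‖ξ‖ ≤ 2 →
      IsGoodFreq w ξ → ∀ t : ℝ, 0 ≤ t →
      ‖duhamel w t ξ - ∫ τ in (0 : ℝ)..t, quad (w τ) ξ‖ₑ ≤
        ENNReal.ofReal (C * t) * ∫⁻ τ in Ioi (0 : ℝ), absConv (w τ) (w τ) ξ := by
  obtain ⟨C, hC0, hC⟩ := exists_norm_symA_mulVec_le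
  refine ⟨3 * C * 24, by positivity, fun w hw ξ hξ h t ht => ?_⟩
  have hqi := intervalIntegrable_quad hw h ht
  have hsub : Ioc 0 t ⊆ Ioi 0 := Ioc_subset_Ioi_self
  have hm := measurable_absConv_time hw hw ξ
  rw [duhamel, ← intervalIntegral.integral_sub (h.intervalIntegrable hw ht) hqi,
    intervalIntegral.integral_of_le ht]
  calc _ ≤ ∫⁻ τ in Ioc 0 t, ‖(symG (t - τ) ξ).mulVec (quad (w τ) ξ) - quad (w τ) ξ‖ₑ :=
        enorm_integral_le_lintegral_enorm _
    _ ≤ ∫⁻ τ in Ioc 0 t, ENNReal.ofReal (3 * C * 24 * t) * absConv (w τ) (w τ) ξ := by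
        refine lintegral_mono_ae ?_
        filter_upwards [ae_restrict_of_ae_restrict_of_subset hsub (h.ae_lt_top hw),
          ae_restrict_mem measurableSet_Ioc] with τ h1 hτ
        have hs : 0 ≤ t - τ := by linarith [hτ.2]
        have key := norm_symG_mulVec_sub_le ξ (quad (w τ) ξ) hs le_rfl (sq_nonneg ‖ξ‖)
          (D := C * ‖quad (w τ) ξ‖) (by simpa using hC ξ hξ _)
        simp only [mul_zero, neg_zero, Real.exp_zero, Complex.ofReal_one, one_smul, zero_div,
          mul_one] at key
        have h2 : ‖(symG (t - τ) ξ).mulVec (quad (w τ) ξ) - quad (w τ) ξ‖ ≤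
            3 * C * t * ‖quad (w τ) ξ‖ := by
          refine key.trans ?_
          have : t - τ ≤ t := by linarith [hτ.1]
          calc _ ≤ 3 * (C * ‖quad (w τ) ξ‖) * t := by gcongr
            _ = _ := by ring
        calc _ = ENNReal.ofReal ‖(symG (t - τ) ξ).mulVec (quad (w τ) ξ) - quad (w τ) ξ‖ :=
              (ofReal_norm _).symm
          _ ≤ ENNReal.ofReal (3 * C * t * ‖quad (w τ) ξ‖) := ENNReal.ofReal_le_ofReal h2
          _ = ENNReal.ofReal (3 * C * t) * ‖quad (w τ) ξ‖ₑ := by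
              rw [ENNReal.ofReal_mul (by positivity), ofReal_norm]
          _ ≤ ENNReal.ofReal (3 * C * t) * (12 * 2 * absConv (w τ) (w τ) ξ) := by
              gcongr
              refine (enorm_quad_le hw.of_uncurry_left h1).trans ?_
              gcongr
              exact enorm_le_two hξ
          _ = _ := by
              rw [← mul_assoc, show (12 * 2 : ℝ≥0∞) = ENNReal.ofReal 24 by norm_num,
                ← ENNReal.ofReal_mul (by positivity)]
              congr 2; ring
    _ ≤ ∫⁻ τ in Ioi (0 : ℝ), ENNReal.ofReal (3 * C * 24 * t) * absConv (w τ) (w τ) ξ :=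
        lintegral_mono_set hsub
    _ = _ := lintegral_const_mul _ hm

/-- The constant in the lower bound of the quadratic interaction. -/
def lowConst : ℝ := ((2 * Real.pi) ^ 3)⁻¹ * ballVol / 32

theorem lowConst_pos : 0 < lowConst := by
  have := ballVol_pos
  unfold lowConst
  positivity

/-- Each of the `K` scales contributes a fixed amount to the time integral of the interaction. -/
theorem le_pairing_integral_quad (hM : 16 ≤ M) {ξ : E3}
    (hξ : ξ ∈ Metric.ball outCenter (1 / 16))
    (hg : IsGoodFreq (heatFlow (lacunary c M K)) ξ) {q : Fin 3 → Fin 3 ⊕ Fin 3}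
    (hq : q = .inl ∨ q = .inr) {t : ℝ} (ht : 0 ≤ t) (htM : 1 ≤ t * M) :
    lowConst * (c ^ 2 * K) ≤
      pairing ξ q (∫ τ in (0 : ℝ)..t, quad (heatFlow (lacunary c M K) τ) ξ) := by
  have hw := measurable_heatFlow (measurable_lacunary c M K)
  have hqi := intervalIntegrable_quad hw hg ht
  have hb := ballVol_pos
  rw [← (pairing ξ q).intervalIntegral_comp_comm hqi]
  set L : ℕ → ℝ → ℝ := fun k τ => ballVol * ((M ^ (k + 1)) ^ 2 / 4 *
      Real.exp (-(4 * (M ^ (k + 1)) ^ 2 * τ))) with hL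
  have hLi : ∀ k, IntervalIntegrable (L k) volume 0 t := fun k => by
    have : Continuous (L k) := by fun_prop
    exact this.intervalIntegrable 0 t
  have hLv : ∀ k, ballVol / 32 ≤ ∫ τ in (0 : ℝ)..t, L k τ := by
    intro k
    have hm : 16 ≤ M ^ (k + 1) := hM.trans (le_self_pow₀ (by linarith) (by simp))
    have hmM : M ≤ M ^ (k + 1) := le_self_pow₀ (by linarith) (by simp)
    set m := M ^ (k + 1) with hmdef
    have hd : ∀ τ ∈ uIcc 0 t, HasDerivAt (fun τ => -(ballVol / 16) * Real.exp (-(4 * m ^ 2 * τ)))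
        (L k τ) τ := by
      intro τ _
      have h1 : HasDerivAt (fun τ : ℝ => -(4 * m ^ 2 * τ)) (-(4 * m ^ 2)) τ := by
        have := (hasDerivAt_mul_const (x := τ) (-(4 * m ^ 2)))
        exact this.congr_of_eventuallyEq (.of_forall fun x => by ring)
      refine (h1.exp.const_mul (-(ballVol / 16))).congr_deriv ?_
      simp only [hL]
      ring
    rw [intervalIntegral.integral_eq_sub_of_hasDerivAt hd (hLi k)]
    -- the time `t ≥ 1/M` is long on the time scale `m⁻²` of the interaction
    have htm : 1 ≤ 4 * m ^ 2 * t := by nlinarith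
    have he : Real.exp (-(4 * m ^ 2 * t)) ≤ 1 / 2 := by
      rw [Real.exp_neg, inv_eq_one_div]
      refine one_div_le_one_div_of_le (by norm_num) ?_
      linarith [Real.add_one_le_exp (4 * m ^ 2 * t)]
    rw [mul_zero, neg_zero, Real.exp_zero]
    nlinarith
  have hmono : ∫ τ in (0 : ℝ)..t, ((2 * Real.pi) ^ 3)⁻¹ * c ^ 2 * ∑ k ∈ Finset.range K, L k τ ≤
      ∫ τ in (0 : ℝ)..t, pairing ξ q (quad (heatFlow (lacunary c M K) τ) ξ) := by
    refine intervalIntegral.integral_mono_on ht ?_ ?_ fun τ hτ => ?_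
    · have : Continuous fun τ => ((2 * Real.pi) ^ 3)⁻¹ * c ^ 2 * ∑ k ∈ Finset.range K, L k τ := by
        fun_prop
      exact this.intervalIntegrable 0 t
    · exact ⟨(pairing ξ q).integrable_comp hqi.1, (pairing ξ q).integrable_comp hqi.2⟩
    · rw [pairing_quad_heatFlow hM hτ.1 ξ hq]
      exact mul_le_mul_of_nonneg_left (le_interaction hM hτ.1 hξ) (by positivity)
  refine le_trans ?_ hmono
  rw [intervalIntegral.integral_const_mul, intervalIntegral.integral_finsetSum fun k _ => hLi k]
  calc lowConst * (c ^ 2 * K) = ((2 * Real.pi) ^ 3)⁻¹ * c ^ 2 * ∑ _k ∈ Finset.range K, ballVol / 32 := by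
        rw [Finset.sum_const, Finset.card_range, nsmul_eq_mul, lowConst]
        ring
    _ ≤ _ := by
        gcongr with k
        exact hLv k

theorem abs_pairing_le {ξ : E3} (hξ : ξ ∈ Metric.ball outCenter (1 / 16))
    (q : Fin 3 → Fin 3 ⊕ Fin 3) {v : Vec} {b : ℝ} (hb : ∀ i, ‖v (q i)‖ ≤ b) :
    |pairing ξ q v| ≤ 2 * b := by
  obtain ⟨-, h1, h2⟩ := coords_of_mem_outBall hξ
  have h1' : |ξ 1| ≤ 17 / 16 := by
    have := abs_sub_abs_le_abs_sub (ξ 1) 1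
    rw [abs_one] at this
    linarith
  have hi : ∀ i, |(v (q i)).im| ≤ b := fun i => (Complex.abs_im_le_norm _).trans (hb i)
  have hb0 : 0 ≤ b := (norm_nonneg _).trans (hb 0)
  rw [pairing_apply]
  refine (abs_sub _ _).trans ?_
  rw [abs_mul, abs_mul]
  have e1 := mul_le_mul h2 (hi 1) (abs_nonneg _) (by norm_num)
  have e2 := mul_le_mul h1' (hi 2) (abs_nonneg _) (by norm_num)
  linarith

/-- The lower bound for a solution at low frequencies, up to the terms that are of third order or
small for large `M`. -/
theorem exists_lower_bound_at_frequency :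
    ∃ C : ℝ, 0 ≤ C ∧ ∀ {c M : ℝ} {K : ℕ} {w : ℝ → E3 → Vec} {F : Vec → C3}
      {q : Fin 3 → Fin 3 ⊕ Fin 3}, 0 ≤ c → 16 ≤ M → IsFourierSol (lacunary c M K) w →
      (q = .inl ∨ q = .inr) → (∀ v i, F v i = v (q i)) →
      ∀ᵐ ξ, ξ ∈ Metric.ball outCenter (1 / 16) →
        ENNReal.ofReal (lowConst * (c ^ 2 * K)) ≤ 2 * ‖F (w (1 / M) ξ)‖ₑ +
          144 * (∫⁻ τ in Ioi (0 : ℝ), lipConv w (heatFlow (lacunary c M K)) τ ξ) +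
          ENNReal.ofReal (C / M) * ∫⁻ τ in Ioi (0 : ℝ),
            absConv (heatFlow (lacunary c M K) τ) (heatFlow (lacunary c M K) τ) ξ := by
  obtain ⟨C, hC0, hC⟩ := exists_enorm_duhamel_sub_integral_le
  refine ⟨2 * C, by positivity, ?_⟩
  intro c M K w F q hc hM h hq hF
  set H := heatFlow (lacunary c M K) with hH
  have hHm : Measurable (Function.uncurry H) := measurable_heatFlow (measurable_lacunary c M K)
  have hHf : wNorm (Ioi 0) H < ∞ := (wNorm_heatFlow_lacunary_le hc hM).trans_lt ENNReal.ofReal_lt_top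
  have hM0 : 0 < M := by linarith
  have ht : (0 : ℝ) ≤ 1 / M := by positivity
  filter_upwards [ae_isGoodFreq h.measurable h.finite, ae_isGoodFreq hHm hHf] with ξ hwξ hHξ hξ
  have hn := norm_le_two_of_mem_outBall hξ
  set I := ∫ τ in (0 : ℝ)..(1 / M), quad (H τ) ξ with hI
  set t := 1 / M with htdef
  have hlow : lowConst * (c ^ 2 * K) ≤ pairing ξ q I :=
    le_pairing_integral_quad hM hξ hHξ hq ht (one_div_mul_cancel hM0.ne').ge
  -- the datum has no low frequencies
  have hw0 : w t ξ = -duhamel w t ξ := by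
    rw [h.eq t ht, linFlow, lacunary_eq_zero_of_mem_outBall hM hξ, Matrix.mulVec_zero, zero_sub]
  have hsplit : I = -w t ξ - (duhamel w t ξ - duhamel H t ξ) - (duhamel H t ξ - I) := by
    rw [hw0]; abel
  have hreal : lowConst * (c ^ 2 * K) ≤ 2 * ‖F (w t ξ)‖ + 2 * ‖duhamel w t ξ - duhamel H t ξ‖ +
      2 * ‖duhamel H t ξ - I‖ := by
    rw [hsplit, map_sub, map_sub, map_neg] at hlow
    have e1 := abs_pairing_le hξ q (v := w t ξ) (b := ‖F (w t ξ)‖) fun i => by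
      rw [← hF (w t ξ) i]; exact PiLp.norm_apply_le _ i
    have e2 := abs_pairing_le hξ q (v := duhamel w t ξ - duhamel H t ξ) fun i => norm_le_pi_norm _ _
    have e3 := abs_pairing_le hξ q (v := duhamel H t ξ - I) fun i => norm_le_pi_norm _ _
    linarith [(abs_le.1 e1).1, (abs_le.1 e2).1, (abs_le.1 e3).1]
  have hE1 : ‖duhamel w t ξ - duhamel H t ξ‖ₑ ≤ 72 * ∫⁻ τ in Ioi (0 : ℝ), lipConv w H τ ξ := by
    refine (hwξ.enorm_duhamel_sub_le' hHξ h.measurable hHm ht).trans ?_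
    rw [← mul_assoc]
    gcongr
    calc ‖ξ‖ₑ * 36 ≤ 2 * 36 := by
          gcongr
          exact enorm_le_two hn
      _ = 72 := by norm_num
  have hE2 := hC H hHm ξ hn hHξ t ht
  calc _ ≤ ENNReal.ofReal (2 * ‖F (w t ξ)‖ + 2 * ‖duhamel w t ξ - duhamel H t ξ‖ +
      2 * ‖duhamel H t ξ - I‖) := ENNReal.ofReal_le_ofReal hreal
    _ = 2 * ‖F (w t ξ)‖ₑ + 2 * ‖duhamel w t ξ - duhamel H t ξ‖ₑ + 2 * ‖duhamel H t ξ - I‖ₑ := by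
        rw [ENNReal.ofReal_add (by positivity) (by positivity), ENNReal.ofReal_add (by positivity)
          (by positivity), ENNReal.ofReal_mul (by norm_num), ENNReal.ofReal_mul (by norm_num),
          ENNReal.ofReal_mul (by norm_num), ofReal_norm, ofReal_norm, ofReal_norm]
        simp
    _ ≤ 2 * ‖F (w t ξ)‖ₑ + 2 * (72 * ∫⁻ τ in Ioi (0 : ℝ), lipConv w H τ ξ) +
        2 * (ENNReal.ofReal (C * t) * ∫⁻ τ in Ioi (0 : ℝ), absConv (H τ) (H τ) ξ) := by gcongr
    _ = _ := by
        rw [← mul_assoc 2 72, ← mul_assoc 2 (ENNReal.ofReal (C * t))]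
        congr 2
        · norm_num
        · rw [show (2 : ℝ≥0∞) = ENNReal.ofReal 2 by simp, ← ENNReal.ofReal_mul (by norm_num), htdef]
          congr 1; ring

/-- The lower bound of the previous lemma, integrated over a ball. -/
theorem exists_lower_bound_on_ball :
    ∃ C : ℝ, 0 ≤ C ∧ ∀ {c M ρ : ℝ} {K : ℕ} {w : ℝ → E3 → Vec} {F : Vec → C3}
      {q : Fin 3 → Fin 3 ⊕ Fin 3}, 0 ≤ c → 16 ≤ M → ρ ≤ 1 / 16 →
      IsFourierSol (lacunary c M K) w → Measurable F →
      (q = .inl ∨ q = .inr) → (∀ v i, F v i = v (q i)) →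
        ENNReal.ofReal (lowConst * (c ^ 2 * K)) * volume (Metric.ball outCenter ρ) ≤
          2 * (∫⁻ ξ in Metric.ball outCenter ρ, ‖F (w (1 / M) ξ)‖ₑ) +
          144 * (wNorm (Ioi 0) (w - heatFlow (lacunary c M K)) *
            (wNorm (Ioi 0) w + wNorm (Ioi 0) (heatFlow (lacunary c M K)))) +
          ENNReal.ofReal (C / M) * (wNorm (Ioi 0) (heatFlow (lacunary c M K)) *
            wNorm (Ioi 0) (heatFlow (lacunary c M K))) := by
  obtain ⟨C, hC0, hC⟩ := exists_lower_bound_at_frequency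
  refine ⟨C, hC0, ?_⟩
  intro c M ρ K w F q hc hM hρ h hFm hq hF
  set H := heatFlow (lacunary c M K) with hH
  have hHm : Measurable (Function.uncurry H) := measurable_heatFlow (measurable_lacunary c M K)
  have hae := hC hc hM h hq hF
  have hm1 : Measurable fun ξ => ‖F (w (1 / M) ξ)‖ₑ := (hFm.comp (h.measurable_slice _)).enorm
  have hl := measurable_lipConv h.measurable hHm
  have hm2 : Measurable fun ξ => ∫⁻ τ in Ioi (0 : ℝ), lipConv w H τ ξ :=
    Measurable.lintegral_prod_left' hl
  have ha := measurable_absConv hHm hHm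
  have hm3 : Measurable fun ξ => ∫⁻ τ in Ioi (0 : ℝ), absConv (H τ) (H τ) ξ :=
    Measurable.lintegral_prod_left' ha
  have hm12 : Measurable fun ξ => 2 * ‖F (w (1 / M) ξ)‖ₑ +
      144 * (∫⁻ τ in Ioi (0 : ℝ), lipConv w H τ ξ) := (hm1.const_mul 2).add (hm2.const_mul 144)
  have hm123 : Measurable fun ξ => 2 * ‖F (w (1 / M) ξ)‖ₑ +
      144 * (∫⁻ τ in Ioi (0 : ℝ), lipConv w H τ ξ) +
      ENNReal.ofReal (C / M) * ∫⁻ τ in Ioi (0 : ℝ), absConv (H τ) (H τ) ξ :=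
    hm12.add (hm3.const_mul _)
  rw [← setLIntegral_const]
  refine (setLIntegral_mono_ae hm123.aemeasurable
    (hae.mono fun ξ hξ hmem => hξ (Metric.ball_subset_ball hρ hmem))).trans ?_
  rw [lintegral_add_left hm12, lintegral_add_left (hm1.const_mul 2), lintegral_const_mul _ hm1,
    lintegral_const_mul _ hm2, lintegral_const_mul _ hm3]
  gcongr
  · refine (setLIntegral_le_lintegral _ _).trans ?_
    rw [← lintegral_lintegral_swap hl.aemeasurable]
    exact lintegral_lipConv_le _ h.measurable hHm
  · refine (setLIntegral_le_lintegral _ _).trans ?_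
    rw [← lintegral_lintegral_swap ha.aemeasurable]
    exact lintegral_absConv_le _ hHm hHm

end

/-- Some dyadic block sees a whole ball around the output frequency. -/
theorem exists_blockWeight_ge (P : DyadicPartition) :
    ∃ (j : ℤ) (b ρ : ℝ), 0 < b ∧ 0 < ρ ∧ ρ ≤ 1 / 16 ∧
      ∀ ξ ∈ Metric.ball outCenter ρ, ENNReal.ofReal b ≤ blockWeight P j ξ := by
  have hne : outCenter ≠ 0 := by
    rw [← norm_pos_iff]
    simp [outCenter]
  have hj : ∃ j : ℤ, blockWeight P j outCenter ≠ 0 := by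
    by_contra! h
    simpa [h] using tsum_blockWeight P hne
  obtain ⟨j, hj⟩ := hj
  have hpos : 0 < P.ψ ((2 : ℝ) ^ (-j) • outCenter) := by
    simpa [blockWeight] using hj
  have hcont : Continuous fun ξ : E3 => P.ψ ((2 : ℝ) ^ (-j) • ξ) :=
    P.ψ.continuous.comp (continuous_const_smul _)
  have hev : ∀ᶠ ξ in 𝓝 outCenter,
      P.ψ ((2 : ℝ) ^ (-j) • outCenter) / 2 < P.ψ ((2 : ℝ) ^ (-j) • ξ) :=
    hcont.continuousAt.eventually_const_lt (half_lt_self hpos)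
  obtain ⟨ρ, hρ, hball⟩ := Metric.eventually_nhds_iff_ball.1 hev
  refine ⟨j, P.ψ ((2 : ℝ) ^ (-j) • outCenter) / 2, min ρ (1 / 16), half_pos hpos,
    lt_min hρ (by norm_num), min_le_right _ _, fun ξ hξ => ?_⟩
  exact ENNReal.ofReal_le_ofReal
    (hball ξ (Metric.ball_subset_ball (min_le_left _ _) hξ)).le

/-- The solution differs from the heat flow of the lacunary datum by a quantity that is of second
order in the size of the datum, up to a term that is small for large `M`. -/
theorem IsFourierSol.wNorm_sub_heatFlow_le {c M : ℝ} {K : ℕ} {w : ℝ → E3 → Vec} (hc : 0 ≤ c)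
    (hM : 16 ≤ M) (h : IsFourierSol (lacunary c M K) w) :
    wNorm (Ioi 0) (w - heatFlow (lacunary c M K)) ≤
      ENNReal.ofReal (96 / M) * ENNReal.ofReal (28 * shellVol * (c * √K)) +
        72 * (wNorm (Ioi 0) w * wNorm (Ioi 0) w) := by
  have hg := measurable_lacunary c M K
  have hl := measurable_linFlow hg
  have hH := measurable_heatFlow hg
  have hD : Measurable (Function.uncurry (duhamel w)) := measurable_duhamel h.measurable
  have hLH : Measurable (Function.uncurry (linFlow (lacunary c M K) - heatFlow (lacunary c M K))) :=
    hl.sub hH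
  calc _ = wNorm (Ioi 0)
        (linFlow (lacunary c M K) - heatFlow (lacunary c M K) - duhamel w) := by
        refine wNorm_congr ?_
        filter_upwards [ae_restrict_mem measurableSet_Ioi] with t ht
        refine .of_forall fun ξ => ?_
        simp only [Pi.sub_apply, h.eq t (le_of_lt ht) ξ]
        abel
    _ ≤ _ := (wNorm_sub_le hLH hD).trans
        (add_le_add (wNorm_linFlow_sub_heatFlow_le hc hM) (wNorm_duhamel_le h.measurable h.finite))

/-- Norm inflation: the size `ε` of the datum is fixed so small that the second-order interaction
beats the third-order remainder; all other errors vanish for `M → ∞`. -/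
theorem exists_inflation (P : DyadicPartition) :
    ∃ (ε M₀ : ℝ) (κ : ℝ≥0), 0 < ε ∧ 16 ≤ M₀ ∧ 0 < κ ∧
      ∀ (c M : ℝ) (K : ℕ), 0 ≤ c → M₀ ≤ M → c ^ 2 * K = ε ^ 2 →
        ∃ w, IsFourierSol (lacunary c M K) w ∧ ∀ r : ℝ≥0∞, r ≠ 0 →
          κ ≤ fbNorm P (-1) 1 r (stateOf (w (1 / M))).1 ∧
          κ ≤ fbNorm P (-1) 1 r (stateOf (w (1 / M))).2 := by
  obtain ⟨j, b, ρ, hb, hρ, hρ', hblock⟩ := exists_blockWeight_ge P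
  obtain ⟨C, hC0, hC⟩ := exists_lower_bound_on_ball
  have hL := lowConst_pos
  have hS : 0 ≤ 28 * shellVol := mul_nonneg (by norm_num) shellVol_nonneg
  set S := 28 * shellVol with hSdef
  set D := Metric.ball outCenter ρ with hD
  obtain ⟨v, hv, hvD⟩ : ∃ v : ℝ, 0 < v ∧ volume D = ENNReal.ofReal v :=
    ⟨(volume D).toReal, ENNReal.toReal_pos (Metric.measure_ball_pos _ _ hρ).ne'
      measure_ball_lt_top.ne, (ENNReal.ofReal_toReal measure_ball_lt_top.ne).symm⟩
  -- `ε₁` is small enough for the existence of the solution, with `2400 = 3 * 800`; `ε₂` makes the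
  -- third-order remainder small, with `8398080 = 144 * (72 * 9²) * (9 + 1)`
  obtain ⟨ε₁, hε₁, h₁⟩ := exists_pos_mul_lt one_pos (2400 * S)
  obtain ⟨ε₂, hε₂, h₂⟩ := exists_pos_mul_lt (show 0 < lowConst * v / 4 by positivity)
    (8398080 * S ^ 3)
  set ε := min ε₁ ε₂ with hεdef
  have hε : 0 < ε := lt_min hε₁ hε₂
  replace h₁ : 2400 * (S * ε) ≤ 1 := by
    have : 2400 * S * ε ≤ 2400 * S * ε₁ := by gcongr; exact min_le_left _ _
    linarith
  replace h₂ : 8398080 * S ^ 3 * ε ≤ lowConst * v / 4 := by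
    have : 8398080 * S ^ 3 * ε ≤ 8398080 * S ^ 3 * ε₂ := by gcongr; exact min_le_right _ _
    linarith
  set x := lowConst * v * ε ^ 2 / 2 with hx
  have hx0 : 0 < x := by positivity
  set κ₀ : ℝ≥0∞ := (2 : ℝ≥0∞) ^ ((j : ℝ) * (-1)) * (ENNReal.ofReal b * (ENNReal.ofReal x / 2)) with hκ₀
  have hκ₀pos : 0 < κ₀ := by
    refine ENNReal.mul_pos (ENNReal.rpow_pos (by norm_num) (by norm_num)).ne'
      (ENNReal.mul_pos (ENNReal.ofReal_pos.2 hb).ne' ?_).ne'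
    exact (ENNReal.half_pos (ENNReal.ofReal_pos.2 hx0).ne').ne'
  obtain ⟨κ, hκ, hκκ⟩ := ENNReal.lt_iff_exists_nnreal_btwn.1 hκ₀pos
  -- `138240 = 144 * 96 * (9 + 1)` is the factor of `1/M` in the linear part of the error
  refine ⟨ε, max 16 ((138240 + C) * S ^ 2 / (lowConst * v / 4)), κ, hε, le_max_left _ _,
    by exact_mod_cast hκ, ?_⟩
  intro c M K hc hMM hcK
  have hM : 16 ≤ M := (le_max_left _ _).trans hMM
  have hM0 : 0 < M := by linarith
  have hMC : (138240 + C) * S ^ 2 / M ≤ lowConst * v / 4 := by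
    have := (le_max_right _ _).trans hMM
    rw [div_le_iff₀ (by positivity)] at this ⊢
    linarith
  have hcε : c * √K = ε := by
    rw [← Real.sqrt_sq hε.le, ← hcK, Real.sqrt_mul (sq_nonneg c), Real.sqrt_sq hc]
  have hg := measurable_lacunary c M K
  have hgf : weightNorm (lacunary c M K) < ∞ := weightNorm_lacunary_lt_top hc
  have hlin := wNorm_linFlow_lacunary_le (K := K) hc hM
  have hheat := wNorm_heatFlow_lacunary_le (K := K) hc hM
  rw [← hSdef, hcε] at hlin hheat
  set d := S * ε with hd
  have hd0 : 0 ≤ d := by positivity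
  rw [show (3 : ℝ≥0∞) = ENNReal.ofReal 3 by simp, ← ENNReal.ofReal_mul (by norm_num)] at hlin
  obtain ⟨w, hw, hw3⟩ := exists_isFourierSol hg hlin (by
    rw [show (1 / 800 : ℝ≥0∞) = ENNReal.ofReal (1 / 800) by
      rw [ENNReal.ofReal_div_of_pos (by norm_num)]; simp]
    exact ENNReal.ofReal_le_ofReal (by linarith))
  refine ⟨w, hw, fun r hr => ?_⟩
  have hw9 : wNorm (Ioi 0) w ≤ ENNReal.ofReal (9 * d) := by
    refine hw3.trans_eq ?_
    rw [show (3 : ℝ≥0∞) = ENNReal.ofReal 3 by simp, ← ENNReal.ofReal_mul (by norm_num)]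
    congr 1; ring
  have hsub : wNorm (Ioi 0) (w - heatFlow (lacunary c M K)) ≤
      ENNReal.ofReal (96 / M * d + 5832 * d ^ 2) := by
    refine (hw.wNorm_sub_heatFlow_le hc hM).trans ?_
    rw [← hSdef, hcε, ENNReal.ofReal_add (by positivity) (by positivity),
      ENNReal.ofReal_mul (p := 96 / M) (by positivity)]
    refine add_le_add le_rfl ?_
    calc _ ≤ ENNReal.ofReal 72 * (ENNReal.ofReal (9 * d) * ENNReal.ofReal (9 * d)) := by
          rw [show (72 : ℝ≥0∞) = ENNReal.ofReal 72 by simp]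
          gcongr
      _ = _ := by
          rw [← ENNReal.ofReal_mul (by positivity), ← ENNReal.ofReal_mul (by positivity)]
          congr 1; ring
  have hlow : ∀ {F : Vec → C3} {q : Fin 3 → Fin 3 ⊕ Fin 3}, Measurable F →
      (q = .inl ∨ q = .inr) → (∀ v i, F v i = v (q i)) →
      ENNReal.ofReal x / 2 ≤ ∫⁻ ξ in D, ‖F (w (1 / M) ξ)‖ₑ := by
    intro F q hFm hq hF
    have key := hC hc hM hρ' hw hFm hq hF
    rw [hcK, ← hD, hvD] at key
    have herr : 144 * (wNorm (Ioi 0) (w - heatFlow (lacunary c M K)) *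
        (wNorm (Ioi 0) w + wNorm (Ioi 0) (heatFlow (lacunary c M K)))) +
        ENNReal.ofReal (C / M) * (wNorm (Ioi 0) (heatFlow (lacunary c M K)) *
          wNorm (Ioi 0) (heatFlow (lacunary c M K))) ≤ ENNReal.ofReal x := by
      calc _ ≤ ENNReal.ofReal 144 * (ENNReal.ofReal (96 / M * d + 5832 * d ^ 2) *
            (ENNReal.ofReal (9 * d) + ENNReal.ofReal d)) +
            ENNReal.ofReal (C / M) * (ENNReal.ofReal d * ENNReal.ofReal d) := by
            rw [show (144 : ℝ≥0∞) = ENNReal.ofReal 144 by simp]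
            gcongr
        _ = ENNReal.ofReal (144 * ((96 / M * d + 5832 * d ^ 2) * (9 * d + d)) +
            C / M * (d * d)) := by
            rw [← ENNReal.ofReal_add (by positivity) (by positivity),
              ← ENNReal.ofReal_mul (by positivity), ← ENNReal.ofReal_mul (by positivity),
              ← ENNReal.ofReal_mul (by positivity), ← ENNReal.ofReal_mul (by positivity),
              ← ENNReal.ofReal_add (by positivity) (by positivity)]
        _ ≤ _ := by
            refine ENNReal.ofReal_le_ofReal ?_
            have e1 := mul_le_mul_of_nonneg_right hMC (sq_nonneg ε)
            have e2 := mul_le_mul_of_nonneg_right h₂ (sq_nonneg ε)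
            calc _ = (138240 + C) * S ^ 2 / M * ε ^ 2 + 8398080 * S ^ 3 * ε * ε ^ 2 := by
                  rw [hd]; ring
              _ ≤ lowConst * v / 4 * ε ^ 2 + lowConst * v / 4 * ε ^ 2 := add_le_add e1 e2
              _ = x := by rw [hx]; ring
    rw [add_assoc] at key
    replace key := key.trans (add_le_add_right herr _)
    rw [← ENNReal.ofReal_mul (by positivity),
      show lowConst * ε ^ 2 * v = x + x by rw [hx]; ring,
      ENNReal.ofReal_add hx0.le hx0.le] at key
    exact ENNReal.div_le_of_le_mul' (ENNReal.le_of_add_le_add_right ENNReal.ofReal_ne_top key)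
  have hfb : ∀ {F : Vec → C3} {q : Fin 3 → Fin 3 ⊕ Fin 3} {u : VField}, Measurable F →
      (q = .inl ∨ q = .inr) → (∀ v i, F v i = v (q i)) →
      HasFourierDensity u (F ∘ w (1 / M)) → κ ≤ fbNorm P (-1) 1 r u := by
    intro F q u hFm hq hF hu
    refine hκκ.le.trans (le_trans ?_ (hu.le_fbNorm P hr (-1) j))
    rw [hκ₀]
    gcongr
    have hm : Measurable fun ξ => ‖F (w (1 / M) ξ)‖ₑ := (hFm.comp (hw.measurable_slice _)).enorm
    calc _ ≤ ENNReal.ofReal b * ∫⁻ ξ in D, ‖F (w (1 / M) ξ)‖ₑ := by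
          gcongr
          exact hlow hFm hq hF
      _ = ∫⁻ ξ in D, ENNReal.ofReal b * ‖F (w (1 / M) ξ)‖ₑ := (lintegral_const_mul _ hm).symm
      _ ≤ ∫⁻ ξ in D, blockWeight P j ξ * ‖F (w (1 / M) ξ)‖ₑ := by
          refine setLIntegral_mono' measurableSet_ball fun ξ hξ => ?_
          gcongr
          exact hblock ξ hξ
      _ ≤ _ := setLIntegral_le_lintegral _ _
  have hwm := hw.measurable_slice (1 / M)
  have hwf := hw.weightNorm_lt_top hg hgf (show 0 ≤ 1 / M by positivity)
  exact ⟨hfb measurable_vel (.inl rfl) vel_apply (stateOf_fst hwm hwf),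
    hfb measurable_rot (.inr rfl) rot_apply (stateOf_snd hwm hwf)⟩

/-- The lacunary data are admissible. -/
theorem isInitialDatum_lacunary (P : DyadicPartition) {c : ℝ} (hc : 0 ≤ c) (M : ℝ) (K : ℕ) :
    IsInitialDatum P (stateOf (lacunary c M K)) := by
  have hg := measurable_lacunary c M K
  have hgf : weightNorm (lacunary c M K) < ∞ := weightNorm_lacunary_lt_top hc
  exact ⟨(stateNorm_two_le P hg (stateOf_fst hg hgf) (stateOf_snd hg hgf)).trans_lt
      (ENNReal.mul_lt_top (by norm_num) hgf),
    isRealField_stateOf hg hgf (.of_forall (lacunary_neg c M K)),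
    isDivFree_stateOf hg hgf (.of_forall (lacunary_longitudinal c M K))⟩

/-- The sequence of data and solutions that violates continuity at the origin. -/
theorem exists_inflating_sequence (P : DyadicPartition) {r : ℝ≥0∞} (hr : 2 < r) :
    ∃ (f : ℕ → State) (t : ℕ → ℝ) (U : ℕ → ℝ → State) (c₀ : ℝ≥0),
      0 < c₀ ∧
      (∀ N, IsInitialDatum P (f N)) ∧
      Tendsto (fun N => stateNorm P (-1) 1 r (f N)) atTop (𝓝 0) ∧
      (∀ N, 0 < t N) ∧
      Tendsto t atTop (𝓝 0) ∧
      (∀ N, ∀ α ∈ Ioo (0 : ℝ) 1,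
        IsGlobalSolution P α (f N) (U N) ∧
        ∀ V : ℝ → State, IsGlobalSolution P α (f N) V → ∀ s : ℝ, 0 ≤ s → V s = U N s) ∧
      (∀ N, ∀ s : ℝ, 0 ≤ s →
        IsRealField (U N s).1 ∧ IsRealField (U N s).2 ∧ IsDivFree (U N s).1) ∧
      ∀ N, (c₀ : ℝ≥0∞) ≤ fbNorm P (-1) 1 r (U N (t N)).1 ∧
        (c₀ : ℝ≥0∞) ≤ fbNorm P (-1) 1 r (U N (t N)).2 := by
  obtain ⟨ε, M₀, κ, hε, hM₀, hκ, hinf⟩ := exists_inflation P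
  -- `K = N + 1` scales with the ratio `M = M₀ + N` and the amplitude `c = ε / √K`
  set c : ℕ → ℝ := fun N => ε / √((N + 1 : ℕ) : ℝ) with hcdef
  set M : ℕ → ℝ := fun N => M₀ + N with hMdef
  have hc : ∀ N, 0 ≤ c N := fun N => by positivity
  have hM : ∀ N, M₀ ≤ M N := fun N => by simp [hMdef]
  have hM0 : ∀ N, 0 < M N := fun N => by linarith [hM N]
  have hcK : ∀ N, c N ^ 2 * ((N + 1 : ℕ) : ℝ) = ε ^ 2 := fun N => by
    have : (0 : ℝ) < ((N + 1 : ℕ) : ℝ) := by positivity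
    simp only [hcdef]
    rw [div_pow, Real.sq_sqrt this.le, div_mul_cancel₀ _ this.ne']
  have hclim : Tendsto c atTop (𝓝 0) :=
    ((Real.tendsto_sqrt_atTop.comp tendsto_natCast_atTop_atTop).comp
      (tendsto_add_atTop_nat 1)).const_div_atTop ε
  have hMlim : Tendsto M atTop atTop :=
    tendsto_atTop_add_const_left _ _ tendsto_natCast_atTop_atTop
  choose w hw hκw using fun N => hinf (c N) (M N) (N + 1) (hc N) (hM N) (hcK N)
  have hgf : ∀ N, weightNorm (lacunary (c N) (M N) (N + 1)) < ∞ := fun N =>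
    weightNorm_lacunary_lt_top (hc N)
  have hg : ∀ N, Measurable (lacunary (c N) (M N) (N + 1)) := fun N => measurable_lacunary _ _ _
  refine ⟨fun N => stateOf (lacunary (c N) (M N) (N + 1)), fun N => 1 / M N,
    fun N s => stateOf (w N s), κ, hκ, fun N => isInitialDatum_lacunary P (hc N) _ _,
    tendsto_stateNorm_lacunary P hr hc (fun N => hM₀.trans (hM N)) hclim hcK,
    fun N => one_div_pos.2 (hM0 N), hMlim.const_div_atTop 1,
    fun N α hα => ⟨(hw N).isGlobalSolution (hg N) (hgf N) P hα, fun V hV s hs =>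
      (hw N).eq_stateOf (hg N) (hgf N) hα hV hs⟩, fun N s hs => ?_,
    fun N => hκw N r (zero_lt_two.trans hr).ne'⟩
  have hm := (hw N).measurable_slice s
  have hf := (hw N).weightNorm_lt_top (hg N) (hgf N) hs
  have hreal := isRealField_stateOf hm hf ((hw N).neg_eq_star (lacunary_neg _ _ _) hs)
  exact ⟨hreal.1, hreal.2,
    isDivFree_stateOf hm hf ((hw N).longitudinal (lacunary_longitudinal _ _ _) hs)⟩

/-- The zero solution is a global solution with the datum `0`. -/
theorem isGlobalSolution_zero (P : DyadicPartition) {α : ℝ} (hα : α ∈ Ioo (0 : ℝ) 1) :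
    IsGlobalSolution P α 0 0 := by
  have h := isFourierSol_zero.isGlobalSolution measurable_zero (by simp [weightNorm]) P hα
  simp only [Pi.zero_apply, stateOf_zero] at h
  exact h

end

end Micropolar

theorem theorem1p5 (P : Micropolar.DyadicPartition) (r : ℝ≥0∞) (hr : 2 < r) :
    (∀ α ∈ Ioo (0 : ℝ) 1, ∀ T : ℝ, 0 < T →
      ¬ Micropolar.SolutionMapContinuousAtOrigin P α r T) ∧
    ∃ (f : ℕ → Micropolar.State) (t : ℕ → ℝ) (U : ℕ → ℝ → Micropolar.State) (c₀ : ℝ≥0),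
      0 < c₀ ∧
      (∀ N, Micropolar.IsInitialDatum P (f N)) ∧
      Tendsto (fun N => Micropolar.stateNorm P (-1) 1 r (f N)) atTop (𝓝 0) ∧
      (∀ N, 0 < t N) ∧
      Tendsto t atTop (𝓝 0) ∧
      -- `U N` is the global solution with the initial datum `f N`, unique in its class
      (∀ N, ∀ α ∈ Ioo (0 : ℝ) 1,
        Micropolar.IsGlobalSolution P α (f N) (U N) ∧
        ∀ V : ℝ → Micropolar.State, Micropolar.IsGlobalSolution P α (f N) V →
          ∀ s : ℝ, 0 ≤ s → V s = U N s) ∧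
      (∀ N, ∀ s : ℝ, 0 ≤ s →
        Micropolar.IsRealField (U N s).1 ∧ Micropolar.IsRealField (U N s).2 ∧
        Micropolar.IsDivFree (U N s).1) ∧
      ∀ N, (c₀ : ℝ≥0∞) ≤ Micropolar.fbNorm P (-1) 1 r (U N (t N)).1 ∧
        (c₀ : ℝ≥0∞) ≤ Micropolar.fbNorm P (-1) 1 r (U N (t N)).2 := by
  refine ⟨fun α hα T hT hcont => ?_, Micropolar.exists_inflating_sequence P hr⟩
  obtain ⟨f, t, U, c₀, hc₀, hf, hlim, ht, htlim, hU, -, hlow⟩ :=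
    Micropolar.exists_inflating_sequence P hr
  obtain ⟨δ, hδ, h⟩ := hcont c₀ (by exact_mod_cast hc₀)
  obtain ⟨N, hN, hNT⟩ := ((hlim.eventually_lt_const hδ).and
    (htlim.eventually_lt_const hT)).exists
  have hlt := h (f N) (U N) 0 (hf N) (hU N α hα).1 (Micropolar.isGlobalSolution_zero P hα) hN
    (t N) ⟨(ht N).le, hNT.le⟩
  rw [Pi.zero_apply, sub_zero] at hlt
  exact absurd ((hlow N).1.trans le_self_add) hlt.not_ge
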